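/- Let $d\ge 3$ and write $\langle\cdot\rangle$ for integration over $\mathbb R^d$. For $\delta>0$ and $0\le g\in L^1_{\rm loc}([0,\infty))$, a vector field $b:[0,\infty)\times\mathbb R^d\to\mathbb R^d$ with $|b|\in L^2_{\rm loc}([0,\infty)\times\mathbb R^d)$ is said to belong to $\mathbf F_\delta$ with function $g$ if $$\int_0^\infty\|b(t,\cdot)\xi(t,\cdot)\|_{L^2}^2\,dt\le\delta\int_0^\infty\|\nabla\xi(t,\cdot)\|_{L^2}^2\,dt+\int_0^\infty g(t)\|\xi(t,\cdot)\|_{L^2}^2\,dt\qquad\text{for all }\xi\in C_c^\infty([0,\infty)\times\mathbb R^d).$$ Let $0<\delta<4$, $0<\nu<\infty$, let $g_\delta,g_\nu:[0,\infty)\to[0,\infty)$ be locally integrable, and let $T>0$, $1<\theta<\frac{d}{d-1}$, $\theta'=\frac{\theta}{\theta-1}$, $p>\frac{2}{2-\sqrt\delta}$, $p\ge 2$. Then there is a constant $K>0$, depending only on $d,p,\theta,T,\delta,\nu,g_\delta,g_\nu$, such that the following holds. Let $b,\mathsf h\in C_c^\infty((0,\infty)\times\mathbb R^d;\mathbb R^d)$,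 where $b$ belongs to $\mathbf F_\delta$ with function $g_\delta$ and $\mathsf h$ belongs to $\mathbf F_\nu$ with function $g_\nu$, let $f$ be a real-valued continuous function of $(t,x)$ with compact support, and let $u$ be a solution of the Cauchy problem $$(\partial_t-\Delta+b\cdot\nabla)u=|\mathsf h|f\ \text{ on }(0,\infty)\times\mathbb R^d,\qquad u(0,\cdot)=0,$$ that is, $u$ and $\nabla_x u$ are continuous on $[0,\infty)\times\mathbb R^d$, $u(0,\cdot)=0$, and $$\int_0^\infty\big\langle -u\,\partial_t\varphi+\nabla u\cdot\nabla\varphi+(b\cdot\nabla u)\varphi\big\rangle dt=\int_0^\infty\langle|\mathsf h|f\varphi\rangle dt\qquad\text{for all }\varphi\in C_c^\infty((0,\infty)\times\mathbb R^d).$$ Then, with $u_+=\max(u,0)$ and $B(0,r)$ the open ball of radius $r$ about the origin, $$\sup_{[0,T]\times B(0,\frac12)}u_+\le 2\Big(\int_0^T\big\langle\big(\mathbf 1_{\{|\mathsf h|\ge1\}}+\mathbf 1_{\{|\mathsf h|<1\}}|\mathsf h|^p\big)^{\theta'}|f|^{p\theta'}\mathbf 1_{B(0,1)}\big\rangle dt\Big)^{\frac1{p\theta'}}+K\Big(\int_0^T\langle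 u_+^p\mathbf 1_{B(0,1)}\rangle dt+\Big(\int_0^T\langle u_+^{p\theta}\mathbf 1_{B(0,1)}\rangle dt\Big)^{\frac1\theta}\Big)^{\frac1p}.$$ -/

import Mathlib

open MeasureTheory Set Metric
open scoped ContDiff

/-- `IsFormBounded δ g b`: the vector field `b` on `[0,∞) × ℝ^d` belongs to the class `𝐅_δ` of
form-bounded vector fields, with form-bound `δ` and with the function `g = g_δ`. The values of `b`
and `g` at negative times are irrelevant. Functions in `C_c^∞([0,∞) × ℝ^d)` are the restrictions to
nonnegative times of functions in `C_c^∞(ℝ × ℝ^d)`. -/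
structure IsFormBounded {d : ℕ} (δ : ℝ) (g : ℝ → ℝ)
    (b : ℝ → EuclideanSpace ℝ (Fin d) → EuclideanSpace ℝ (Fin d)) : Prop where
  pos : 0 < δ
  g_nonneg : ∀ t, 0 ≤ t → 0 ≤ g t
  g_locallyIntegrable : LocallyIntegrableOn g (Ici (0 : ℝ))
  measurable : AEStronglyMeasurable (Function.uncurry b)
    ((volume : Measure (ℝ × EuclideanSpace ℝ (Fin d))).restrict (Ici (0 : ℝ) ×ˢ univ))
  sq_locallyIntegrable :
    LocallyIntegrableOn (fun z : ℝ × EuclideanSpace ℝ (Fin d) => ‖b z.1 z.2‖ ^ 2)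
      (Ici (0 : ℝ) ×ˢ univ)
  bound : ∀ ξ : ℝ → EuclideanSpace ℝ (Fin d) → ℝ,
    ContDiff ℝ ∞ (Function.uncurry ξ) → HasCompactSupport (Function.uncurry ξ) →
    ∫ t in Ioi (0 : ℝ), ∫ x, ‖b t x‖ ^ 2 * ξ t x ^ 2 ≤
      δ * (∫ t in Ioi (0 : ℝ), ∫ x, ‖gradient (ξ t) x‖ ^ 2) +
        ∫ t in Ioi (0 : ℝ), g t * ∫ x, ξ t x ^ 2

/-- Membership in `C_c^∞((0,∞) × ℝ^d)`, for functions with values in `V`. -/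
structure IsTestFunction {d : ℕ} {V : Type*} [NormedAddCommGroup V] [NormedSpace ℝ V]
    (φ : ℝ → EuclideanSpace ℝ (Fin d) → V) : Prop where
  smooth : ContDiff ℝ ∞ (Function.uncurry φ)
  compactSupport : HasCompactSupport (Function.uncurry φ)
  support_pos : tsupport (Function.uncurry φ) ⊆ Ioi (0 : ℝ) ×ˢ univ

/-- `u` is a solution on `[0,∞) × ℝ^d` of the Cauchy problem
`(∂_t - Δ + b · ∇) u = F`, `u(0) = 0`: the function `u` and its spatial gradient are continuous up
to time `0`, the initial value is attained, and the equation holds in the weak sense. -/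
structure IsCauchySolution {d : ℕ}
    (b : ℝ → EuclideanSpace ℝ (Fin d) → EuclideanSpace ℝ (Fin d))
    (F : ℝ → EuclideanSpace ℝ (Fin d) → ℝ) (u : ℝ → EuclideanSpace ℝ (Fin d) → ℝ) : Prop where
  continuousOn : ContinuousOn (Function.uncurry u) (Ici (0 : ℝ) ×ˢ univ)
  differentiable : ∀ t, 0 ≤ t → Differentiable ℝ (u t)
  continuousOn_gradient :
    ContinuousOn (fun z : ℝ × EuclideanSpace ℝ (Fin d) => gradient (u z.1) z.2)
      (Ici (0 : ℝ) ×ˢ univ)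
  initial : ∀ x, u 0 x = 0
  weak : ∀ φ : ℝ → EuclideanSpace ℝ (Fin d) → ℝ, IsTestFunction φ →
    ∫ t in Ioi (0 : ℝ), ∫ x,
        (-(u t x * deriv (fun s => φ s x) t) + inner ℝ (gradient (u t) x) (gradient (φ t) x)
          + inner ℝ (b t x) (gradient (u t) x) * φ t x) =
      ∫ t in Ioi (0 : ℝ), ∫ x, F t x * φ t x

/-- The weight `𝟏_{|h| ≥ 1} + 𝟏_{|h| < 1} |h|^p`, evaluated at the value `y` of `h`. -/
noncomputable def truncWeight {d : ℕ} (p : ℝ) (y : EuclideanSpace ℝ (Fin d)) : ℝ :=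
  if 1 ≤ ‖y‖ then 1 else ‖y‖ ^ p

/-!
The estimate is a De Giorgi iteration for the level sets of `u`.

*Energy.* Extended by zero to negative times, `u` is still a weak solution, and it can be mollified
by a kernel looking forward in time, so that the mollified function solves the equation with
mollified data at all nonnegative times. Testing with `p (u - k)_+ ^ (p - 1) η²`, where `η` is a
cutoff function in space, produces the energy `∫ (u - k)_+ ^ p η²` and the dissipation
`p (p - 1) ∫∫ (u - k)_+ ^ (p - 2) |∇u|² η²`. With `v = (u - k)_+ ^ (p / 2)`, the drift term is
bounded by means of Cauchy–Schwarz and the form bound of `b` applied to `v η`, which is admissible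
by approximation; it costs the fraction `p √δ / (2 (p - 1))` of the dissipation, up to an
arbitrarily small error, and this fraction is less than one precisely because `p > 2 / (2 - √δ)`. In
the source term, Young's inequality puts as much of `|h|` on `(u - k)_+ ^ p` as the form bound of
`h` can take, that is `|h| ^ 2`, where `|h| ≥ 1`, and leaves `|h| ^ p |f| ^ p` where `|h| < 1`; this
explains the weight `truncWeight p`. The remaining terms `∫∫ (gδ + gν) (u - k)_+ ^ p η²` have a
coefficient that is merely integrable in time, and are removed by a Grönwall argument with an
exponential weight (`exists_energy_inequality`, `exists_gronwall_const`).

*Gain of integrability.* The energy bound controls `∇((u - k)_+ ^ p η²)` in `L¹`, and the Sobolev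
embedding `W^{1,1} ⊆ L^{d/(d-1)}` together with the bound uniform in time gives `(u - k)_+ ^ p η²`
in `L^κ`, `κ = d / (d - 1)`, in space-time (`exists_gain_const`).

*Iteration.* When the source has norm at most one and the levels `k` increase to `1` while the radii
decrease to `1/2`, the quantities `Z_n = ∫∫ (u - k_n)_+ ^ (p θ)` satisfy
`Z_{n+1} ≤ C B ^ n Z_n ^ (1 + α)` with `α = 1 - θ / κ > 0`, by interpolation between the gain of
integrability and Chebyshev's inequality for the measure of `{u > k_{n+1}}` (`truncMass_step`).
Hence `Z_n → 0` as soon as `Z_0` is below a threshold depending only on the data, which means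
`u ≤ 1` (`exists_boundedness_threshold`). The theorem follows by applying this to `u / M` and
`f / M`, where `M` exceeds the norm of the source plus a multiple of the `L ^ (p θ)` norm of `u_+`.
-/

/-! ### Space-time mollification -/

section Mollification

open Filter Topology
open scoped Convolution

instance isAddHaarMeasure_volume_spaceTime {d : ℕ} :
    (volume : Measure (ℝ × EuclideanSpace ℝ (Fin d))).IsAddHaarMeasure :=
  inferInstanceAs (((volume : Measure ℝ).prod
    (volume : Measure (EuclideanSpace ℝ (Fin d)))).IsAddHaarMeasure)

/-- The bump function of radius `1 / (n + 1)` about the origin of space-time. -/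
noncomputable def mollifierBump (d n : ℕ) :
    ContDiffBump (0 : ℝ × EuclideanSpace ℝ (Fin d)) where
  rIn := 1 / (2 * ((n : ℝ) + 1))
  rOut := 1 / ((n : ℝ) + 1)
  rIn_pos := by positivity
  rIn_lt_rOut := by
    apply one_div_lt_one_div_of_lt <;> nlinarith [(Nat.cast_nonneg n : (0 : ℝ) ≤ n)]

/-- The mollification kernel, with integral `1`. -/
noncomputable def mollifier (d n : ℕ) : ℝ × EuclideanSpace ℝ (Fin d) → ℝ :=
  (mollifierBump d n).normed volume

/-- Translation forward in time by twice the radius of the mollification kernel. -/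
noncomputable def timeShift (d n : ℕ) : ℝ × EuclideanSpace ℝ (Fin d) := (2 / ((n : ℝ) + 1), 0)

/-- The mollification of `V`, translated in time so that its values at nonnegative times involve
values of `V` at positive times only. -/
noncomputable def mollify {d : ℕ} (n : ℕ) (V : ℝ × EuclideanSpace ℝ (Fin d) → ℝ)
    (z : ℝ × EuclideanSpace ℝ (Fin d)) : ℝ :=
  (mollifier d n ⋆[ContinuousLinearMap.lsmul ℝ ℝ, volume] V) (z + timeShift d n)

variable {d : ℕ} {V : ℝ × EuclideanSpace ℝ (Fin d) → ℝ}

lemma contDiff_mollifier (n : ℕ) : ContDiff ℝ ∞ (mollifier d n) :=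
  (mollifierBump d n).contDiff_normed

lemma hasCompactSupport_mollifier (n : ℕ) : HasCompactSupport (mollifier d n) :=
  (mollifierBump d n).hasCompactSupport_normed

lemma mollify_eq_integral (n : ℕ) (V : ℝ × EuclideanSpace ℝ (Fin d) → ℝ)
    (z : ℝ × EuclideanSpace ℝ (Fin d)) :
    mollify n V z = ∫ y, mollifier d n (z + timeShift d n - y) * V y := by
  rw [mollify, convolution_lsmul_swap]; rfl

lemma contDiff_mollify (n : ℕ) (hV : Continuous V) : ContDiff ℝ ∞ (mollify n V) := by
  have := (hasCompactSupport_mollifier (d := d) n).contDiff_convolution_left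
    (ContinuousLinearMap.lsmul ℝ ℝ) (contDiff_mollifier n)
    (hV.locallyIntegrable (μ := volume))
  exact this.comp (contDiff_id.add contDiff_const)

lemma hasCompactSupport_mollify (n : ℕ) (hV : HasCompactSupport V) :
    HasCompactSupport (mollify n V) := by
  have h := (hasCompactSupport_mollifier (d := d) n).convolution
    (ContinuousLinearMap.lsmul ℝ ℝ) (μ := volume) hV
  exact h.comp_homeomorph (Homeomorph.addRight (timeShift d n))

lemma fderiv_mollify_apply (n : ℕ) (hV : Continuous V) (z w : ℝ × EuclideanSpace ℝ (Fin d)) :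
    fderiv ℝ (mollify n V) z w =
      ∫ y, fderiv ℝ (mollifier d n) (z + timeShift d n - y) w * V y := by
  have h := (hasCompactSupport_mollifier (d := d) n).hasFDerivAt_convolution_left
    (ContinuousLinearMap.lsmul ℝ ℝ) ((contDiff_mollifier n).of_le (by simp))
    (hV.locallyIntegrable (μ := volume)) (z + timeShift d n)
  have h2 := (h.comp z ((hasFDerivAt_id z).add_const (timeShift d n))).fderiv
  have h3 : fderiv ℝ (mollify n V) z = _ := h2
  have hint : ConvolutionExistsAt (fderiv ℝ (mollifier d n)) V (z + timeShift d n)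
      ((ContinuousLinearMap.lsmul ℝ ℝ).precompL _) volume :=
    ((hasCompactSupport_mollifier (d := d) n).fderiv ℝ).convolutionExists_left _
      ((contDiff_mollifier n).continuous_fderiv (by simp))
      (hV.locallyIntegrable (μ := volume)) _
  rw [h3]
  simp only [ContinuousLinearMap.comp_id]
  rw [convolution_eq_swap, ContinuousLinearMap.integral_apply]
  · rfl
  · exact hint.integrable_swap

lemma tendsto_mollify (hV : Continuous V) (z : ℝ × EuclideanSpace ℝ (Fin d)) :
    Tendsto (fun n => mollify n V z) atTop (𝓝 (V z)) := by
  refine ContDiffBump.convolution_tendsto_right (φ := fun n => mollifierBump d n)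
    (g := fun _ => V) (x₀ := z) ?_ (Eventually.of_forall fun _ => hV.aestronglyMeasurable) ?_ ?_
  · exact tendsto_one_div_add_atTop_nhds_zero_nat
  · exact (hV.tendsto z).comp tendsto_snd
  · have h0 : Tendsto (fun n : ℕ => 2 * (1 / ((n : ℝ) + 1))) atTop (𝓝 (2 * 0)) :=
      tendsto_one_div_add_atTop_nhds_zero_nat.const_mul 2
    have h1 : Tendsto (fun n : ℕ => timeShift d n) atTop (𝓝 0) := by
      have : Tendsto (fun n : ℕ => ((2 * (1 / ((n : ℝ) + 1)), 0) :
          ℝ × EuclideanSpace ℝ (Fin d))) atTop (𝓝 (2 * 0, 0)) :=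
        h0.prodMk_nhds tendsto_const_nhds
      convert this using 2
      · simp [timeShift]; ring
      · simp; rfl
    simpa using (tendsto_const_nhds (x := z)).add h1

lemma norm_timeShift_le (n : ℕ) : ‖timeShift d n‖ ≤ 2 := by
  have : (2 : ℝ) / ((n : ℝ) + 1) ≤ 2 := by
    apply div_le_self (by norm_num); linarith [(Nat.cast_nonneg n : (0 : ℝ) ≤ n)]
  have h2 : (0 : ℝ) ≤ 2 / ((n : ℝ) + 1) := by positivity
  simp only [timeShift, Prod.norm_def, norm_zero, Real.norm_eq_abs, abs_of_nonneg h2]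
  exact max_le this (by norm_num)

lemma abs_mollify_le (hV : Continuous V) (n : ℕ) {z : ℝ × EuclideanSpace ℝ (Fin d)} {C : ℝ}
    (hC : ∀ x, dist x z ≤ 3 → |V x| ≤ C) : |mollify n V z| ≤ 3 * C := by
  have hr : (mollifierBump d n).rOut ≤ 1 := by
    change (1 : ℝ) / ((n : ℝ) + 1) ≤ 1
    apply div_le_self (by norm_num); linarith [(Nat.cast_nonneg n : (0 : ℝ) ≤ n)]
  have hs : dist (z + timeShift d n) z ≤ 2 := by simpa using norm_timeShift_le n
  have h2 := hC _ (hs.trans (by norm_num))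
  have hd := ContDiffBump.dist_normed_convolution_le (φ := mollifierBump d n)
    (μ := volume) (g := V) (x₀ := z + timeShift d n) (ε := 2 * C) hV.aestronglyMeasurable
    (fun x hx => by
      have hx' : dist x z ≤ 3 := by
        have := dist_triangle x (z + timeShift d n) z
        have := mem_ball.1 hx
        linarith
      have h1 := hC x hx'
      rw [Real.dist_eq]
      have := abs_sub (V x) (V (z + timeShift d n))
      linarith)
  rw [Real.dist_eq] at hd
  have h3 : |mollify n V z - V (z + timeShift d n)| ≤ 2 * C := hd
  have := abs_sub_abs_le_abs_sub (mollify n V z) (V (z + timeShift d n))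
  linarith

lemma mollify_eq_zero (hV : Continuous V) (n : ℕ) {z : ℝ × EuclideanSpace ℝ (Fin d)}
    (h : ∀ x, dist x z ≤ 3 → V x = 0) : mollify n V z = 0 := by
  have := abs_mollify_le hV n (z := z) (C := 0) fun x hx => by simp [h x hx]
  simpa using this

/-- On a compact set, mollifications are bounded uniformly in the radius of the kernel. -/
lemma exists_bound_mollify (hV : Continuous V) {S : Set (ℝ × EuclideanSpace ℝ (Fin d))}
    (hS : IsCompact S) : ∃ C, 0 ≤ C ∧ ∀ n, ∀ z ∈ S, |mollify n V z| ≤ C := by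
  obtain ⟨C, hC⟩ := (hS.cthickening (r := 3)).exists_bound_of_continuousOn hV.continuousOn
  exact ⟨3 * |C|, by positivity, fun n z hz => abs_mollify_le hV n fun x hx =>
    (hC x (mem_cthickening_of_dist_le x z 3 S hz hx)).trans (le_abs_self C)⟩

/-- Mollification commutes with line derivatives. -/
lemma fderiv_mollify_of_hasLineDerivAt (n : ℕ) (hV : Continuous V)
    {V' : ℝ × EuclideanSpace ℝ (Fin d) → ℝ} (hV' : Continuous V')
    {w : ℝ × EuclideanSpace ℝ (Fin d)} (h : ∀ z, HasLineDerivAt ℝ V (V' z) z w)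
    (z : ℝ × EuclideanSpace ℝ (Fin d)) :
    fderiv ℝ (mollify n V) z w = mollify n V' z := by
  rw [fderiv_mollify_apply n hV, mollify_eq_integral]
  set c := z + timeShift d n
  have hρ := contDiff_mollifier (d := d) n
  have hcs : HasCompactSupport fun y => mollifier d n (c - y) :=
    (hasCompactSupport_mollifier n).comp_homeomorph (Homeomorph.subLeft c)
  have hcs' : HasCompactSupport fun y => fderiv ℝ (mollifier d n) (c - y) w := by
    have h1 : HasCompactSupport fun y => fderiv ℝ (mollifier d n) y w :=
      (hasCompactSupport_mollifier n).fderiv_apply (𝕜 := ℝ) w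
    exact h1.comp_homeomorph (Homeomorph.subLeft c)
  have hcont : Continuous fun y => mollifier d n (c - y) :=
    hρ.continuous.comp (continuous_const.sub continuous_id)
  have hcont' : Continuous fun y => fderiv ℝ (mollifier d n) (c - y) w :=
    ((hρ.continuous_fderiv (by simp)).comp (continuous_const.sub continuous_id)).clm_apply
      continuous_const
  have key := integral_bilinear_hasLineDerivAt_right_eq_neg_left_of_integrable
    (μ := (volume : Measure (ℝ × EuclideanSpace ℝ (Fin d))))
    (f := V) (f' := V') (g := fun y => mollifier d n (c - y))
    (g' := fun y => -fderiv ℝ (mollifier d n) (c - y) w) (v := w)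
    (B := ContinuousLinearMap.mul ℝ ℝ)
    ((hV'.mul hcont).integrable_of_hasCompactSupport hcs.mul_left)
    ((hV.mul hcont'.neg).integrable_of_hasCompactSupport hcs'.neg.mul_left)
    ((hV.mul hcont).integrable_of_hasCompactSupport hcs.mul_left)
    (fun x _ => h x)
    (fun x _ => by
      have h1 : HasFDerivAt (fun y => mollifier d n (c - y))
          ((fderiv ℝ (mollifier d n) (c - x)).comp
            (-ContinuousLinearMap.id ℝ (ℝ × EuclideanSpace ℝ (Fin d)))) x :=
        ((hρ.differentiable (by simp)).differentiableAt.hasFDerivAt).comp x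
          ((hasFDerivAt_id x).const_sub c)
      simpa using h1.hasLineDerivAt w)
  simp only [ContinuousLinearMap.mul_apply', mul_neg, integral_neg, neg_inj] at key
  simp only [mul_comm _ (V _), mul_comm _ (V' _)]
  exact key

/-- `U`, with spatial gradient `DU`, solves `∂_t U - Δ U = G` weakly at positive times and vanishes
at negative times. The functions are defined for all times, so that no boundary terms occur when
they are mollified. -/
structure IsExtendedSolution {d : ℕ} (G U : ℝ × EuclideanSpace ℝ (Fin d) → ℝ)
    (DU : ℝ × EuclideanSpace ℝ (Fin d) → EuclideanSpace ℝ (Fin d)) : Prop where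
  continuous_source : Continuous G
  continuous : Continuous U
  continuous_grad : Continuous DU
  hasGradientAt : ∀ t x, HasGradientAt (fun y => U (t, y)) (DU (t, x)) x
  eq_zero : ∀ z, z.1 ≤ 0 → U z = 0
  weak : ∀ φ : ℝ × EuclideanSpace ℝ (Fin d) → ℝ, ContDiff ℝ ∞ φ → HasCompactSupport φ →
    tsupport φ ⊆ Ioi (0 : ℝ) ×ˢ univ →
    ∫ z, (-(U z * fderiv ℝ φ z (1, 0)) + fderiv ℝ φ z (0, DU z)) = ∫ z, G z * φ z

variable {G U : ℝ × EuclideanSpace ℝ (Fin d) → ℝ}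
  {DU : ℝ × EuclideanSpace ℝ (Fin d) → EuclideanSpace ℝ (Fin d)}

/-- A gradient in the space variable gives the line derivatives in the spatial directions. -/
lemma hasLineDerivAt_of_hasGradientAt (h : ∀ t x, HasGradientAt (fun y => V (t, y)) (DU (t, x)) x)
    (w : EuclideanSpace ℝ (Fin d)) (z : ℝ × EuclideanSpace ℝ (Fin d)) :
    HasLineDerivAt ℝ V (inner ℝ (DU z) w) z (0, w) := by
  have h1 := (h z.1 z.2).hasFDerivAt.hasLineDerivAt w
  have h2 : HasLineDerivAt ℝ (fun y => V (z.1, y)) (inner ℝ (DU z) w) z.2 w := by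
    simpa using h1
  unfold HasLineDerivAt at h2 ⊢
  have h3 : (fun t : ℝ => V (z + t • ((0 : ℝ), w))) = fun t => V (z.1, z.2 + t • w) := by
    funext t; congr 1; ext1 <;> simp
  rw [h3]; exact h2

lemma inner_eq_coord (v : EuclideanSpace ℝ (Fin d)) (i : Fin d) :
    inner ℝ v (EuclideanSpace.single i (1 : ℝ)) = v i := by
  simp [EuclideanSpace.inner_single_right]

/-- The mollified functions satisfy the equation pointwise at nonnegative times. -/
lemma IsExtendedSolution.fderiv_mollify_time (h : IsExtendedSolution G U DU) (n : ℕ)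
    {z : ℝ × EuclideanSpace ℝ (Fin d)} (hz : 0 ≤ z.1) :
    fderiv ℝ (mollify n U) z (1, 0) = mollify n G z +
      ∑ i, fderiv ℝ (mollify n fun y => DU y i) z (0, EuclideanSpace.single i 1) := by
  have hDUi : ∀ i, Continuous fun y => DU y i := fun i =>
    (EuclideanSpace.proj (𝕜 := ℝ) i).continuous.comp h.continuous_grad
  rw [fderiv_mollify_apply n h.continuous, mollify_eq_integral,
    Finset.sum_congr rfl fun i _ => fderiv_mollify_apply n (hDUi i) z _]
  set c := z + timeShift d n with hc
  have hρ := contDiff_mollifier (d := d) n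
  have hcs : HasCompactSupport fun y => mollifier d n (c - y) :=
    (hasCompactSupport_mollifier n).comp_homeomorph (Homeomorph.subLeft c)
  have hcs' : ∀ w, HasCompactSupport fun y => fderiv ℝ (mollifier d n) (c - y) w := fun w => by
    have h1 : HasCompactSupport fun y => fderiv ℝ (mollifier d n) y w :=
      (hasCompactSupport_mollifier n).fderiv_apply (𝕜 := ℝ) w
    exact h1.comp_homeomorph (Homeomorph.subLeft c)
  have hcont : ContDiff ℝ ∞ fun y => mollifier d n (c - y) :=
    hρ.comp (contDiff_const.sub contDiff_id)
  have hcont' : ∀ w, Continuous fun y => fderiv ℝ (mollifier d n) (c - y) w := fun w =>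
    ((hρ.continuous_fderiv (by simp)).comp (continuous_const.sub continuous_id)).clm_apply
      continuous_const
  have hfd : ∀ y w, fderiv ℝ (fun y => mollifier d n (c - y)) y w =
      -fderiv ℝ (mollifier d n) (c - y) w := fun y w => by
    have h1 : HasFDerivAt (fun y => mollifier d n (c - y))
        ((fderiv ℝ (mollifier d n) (c - y)).comp
          (-ContinuousLinearMap.id ℝ (ℝ × EuclideanSpace ℝ (Fin d)))) y :=
      ((hρ.differentiable (by simp)).differentiableAt.hasFDerivAt).comp y
        ((hasFDerivAt_id y).const_sub c)
    rw [h1.fderiv]; simp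
  have hsupp : tsupport (fun y => mollifier d n (c - y)) ⊆ Ioi (0 : ℝ) ×ˢ univ := by
    have h1 : tsupport (fun y => mollifier d n (c - y)) ⊆
        closedBall c (1 / ((n : ℝ) + 1)) := by
      refine closure_minimal (fun y hy => ?_) isClosed_closedBall
      have h2 : c - y ∈ Function.support (mollifier d n) := hy
      rw [mollifier, ContDiffBump.support_normed_eq] at h2
      have h3 : ‖c - y‖ < 1 / ((n : ℝ) + 1) := by
        rw [mem_ball_zero_iff] at h2; exact h2
      rw [mem_closedBall, dist_eq_norm, norm_sub_rev]
      exact h3.le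
    intro y hy
    have h2 := h1 hy
    rw [mem_closedBall, dist_eq_norm] at h2
    have h3 : |y.1 - c.1| ≤ 1 / ((n : ℝ) + 1) := (norm_fst_le (y - c)).trans h2
    have h4 : c.1 = z.1 + 2 * (1 / ((n : ℝ) + 1)) := by
      simp [hc, timeShift]; ring
    have h5 : (0 : ℝ) < 1 / ((n : ℝ) + 1) := by positivity
    have h6 := (abs_le.1 h3).1
    refine ⟨?_, mem_univ _⟩
    simp only [mem_Ioi]
    linarith
  have hw := h.weak _ hcont hcs hsupp
  simp only [hfd] at hw
  have hi1 : Integrable fun y => fderiv ℝ (mollifier d n) (c - y) (1, 0) * U y :=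
    ((hcont' _).mul h.continuous).integrable_of_hasCompactSupport (hcs' _).mul_right
  have hi2 : ∀ i, Integrable fun y =>
      fderiv ℝ (mollifier d n) (c - y) (0, EuclideanSpace.single i 1) * DU y i := fun i =>
    ((hcont' _).mul (hDUi i)).integrable_of_hasCompactSupport (hcs' _).mul_right
  have hexp : ∀ y, fderiv ℝ (mollifier d n) (c - y) (0, DU y) =
      ∑ i, fderiv ℝ (mollifier d n) (c - y) (0, EuclideanSpace.single i 1) * DU y i := fun y => by
    have h1 : ((0 : ℝ), DU y) = ∑ i, DU y i • ((0 : ℝ), EuclideanSpace.single i (1 : ℝ)) := by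
      ext1
      · simp [Prod.fst_sum]
      · simp only [Prod.snd_sum, Prod.smul_mk]
        have := (EuclideanSpace.basisFun (Fin d) ℝ).sum_repr (DU y)
        simpa using this.symm
    rw [h1, map_sum]
    exact Finset.sum_congr rfl fun i _ => by rw [map_smul, smul_eq_mul, mul_comm]
  rw [← integral_finsetSum _ fun i _ => hi2 i]
  have h1 : ∀ y, -(U y * -fderiv ℝ (mollifier d n) (c - y) (1, 0)) +
      -fderiv ℝ (mollifier d n) (c - y) (0, DU y) =
      fderiv ℝ (mollifier d n) (c - y) (1, 0) * U y -
        ∑ i, fderiv ℝ (mollifier d n) (c - y) (0, EuclideanSpace.single i 1) * DU y i := fun y => by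
    rw [hexp]; ring
  simp only [h1] at hw
  rw [integral_sub hi1 (integrable_finsetSum _ fun i _ => hi2 i)] at hw
  simp only [mul_comm (G _)] at hw
  linarith

end Mollification

/-! ### Integrals over space-time cylinders -/

section Cylinder

open Filter Topology

/-- Lebesgue measure on the cylinder `(0, T] × ℝ^d`. -/
noncomputable def cylMeasure (d : ℕ) (T : ℝ) : Measure (ℝ × EuclideanSpace ℝ (Fin d)) :=
  volume.restrict (Ioc 0 T ×ˢ univ)

variable {d : ℕ} {T L C : ℝ} {a : ℝ → ℝ} {F : ℝ × EuclideanSpace ℝ (Fin d) → ℝ}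

lemma cylMeasure_eq_prod (d : ℕ) (T : ℝ) :
    cylMeasure d T = (volume.restrict (Ioc 0 T)).prod
      (volume : Measure (EuclideanSpace ℝ (Fin d))) := by
  rw [cylMeasure, Measure.volume_eq_prod, ← Measure.prod_restrict, Measure.restrict_univ]

lemma ae_cylMeasure_mem : ∀ᵐ z ∂cylMeasure d T, z.1 ∈ Ioc 0 T := by
  filter_upwards [ae_restrict_mem (measurableSet_Ioc.prod MeasurableSet.univ)] with z hz
  exact hz.1

lemma integrable_weight_cylinder (ha : IntegrableOn a (Ioc 0 T)) (L : ℝ) :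
    Integrable (fun z : ℝ × EuclideanSpace ℝ (Fin d) =>
      a z.1 * (closedBall 0 L).indicator (fun _ => (1 : ℝ)) z.2) (cylMeasure d T) := by
  rw [cylMeasure_eq_prod]
  refine Integrable.mul_prod (f := a) (g := (closedBall (0 : EuclideanSpace ℝ (Fin d)) L).indicator
    fun _ => (1 : ℝ)) ha ?_
  exact (integrable_indicator_iff measurableSet_closedBall).2
    (integrableOn_const (measure_closedBall_lt_top.ne))

/-- Bounded functions with bounded support in space are integrable over cylinders against
integrable functions of time. -/
lemma integrable_cylinder (ha : IntegrableOn a (Ioc 0 T))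
    (hm : AEStronglyMeasurable F (cylMeasure d T))
    (hC : ∀ z, z.1 ∈ Ioc 0 T → ‖z.2‖ ≤ L → |F z| ≤ C) (hs : ∀ z, L < ‖z.2‖ → F z = 0) :
    Integrable (fun z => a z.1 * F z) (cylMeasure d T) := by
  have ham : AEStronglyMeasurable (fun z : ℝ × EuclideanSpace ℝ (Fin d) => a z.1)
      (cylMeasure d T) := by
    rw [cylMeasure_eq_prod]; exact ha.aestronglyMeasurable.comp_fst
  refine ((integrable_weight_cylinder (d := d) ha L).norm.const_mul C).mono' (ham.mul hm) ?_
  filter_upwards [ae_cylMeasure_mem] with z hz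
  rw [norm_mul, norm_mul]
  by_cases hzL : ‖z.2‖ ≤ L
  · rw [indicator_of_mem (by simpa using hzL), norm_one, mul_one, mul_comm]
    exact mul_le_mul_of_nonneg_right (hC z hz hzL) (norm_nonneg _)
  · rw [hs z (not_le.1 hzL), indicator_of_notMem (by simpa using hzL)]; simp

lemma integrable_cylinder_one (hm : AEStronglyMeasurable F (cylMeasure d T))
    (hC : ∀ z, z.1 ∈ Ioc 0 T → ‖z.2‖ ≤ L → |F z| ≤ C) (hs : ∀ z, L < ‖z.2‖ → F z = 0) :
    Integrable F (cylMeasure d T) := by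
  simpa using integrable_cylinder (a := fun _ => 1) (integrableOn_const (by simp)) hm hC hs

/-- Dominated convergence over a cylinder, for uniformly bounded functions with uniformly bounded
support in space. -/
lemma tendsto_integral_cylinder (ha : IntegrableOn a (Ioc 0 T))
    {F : ℕ → ℝ × EuclideanSpace ℝ (Fin d) → ℝ} {F' : ℝ × EuclideanSpace ℝ (Fin d) → ℝ}
    (hm : ∀ n, AEStronglyMeasurable (F n) (cylMeasure d T))
    (hC : ∀ n z, z.1 ∈ Ioc 0 T → ‖z.2‖ ≤ L → |F n z| ≤ C) (hs : ∀ n z, L < ‖z.2‖ → F n z = 0)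
    (hlim : ∀ z, z.1 ∈ Ioc 0 T → Tendsto (fun n => F n z) atTop (𝓝 (F' z))) :
    Tendsto (fun n => ∫ z, a z.1 * F n z ∂cylMeasure d T) atTop
      (𝓝 (∫ z, a z.1 * F' z ∂cylMeasure d T)) := by
  have ham : AEStronglyMeasurable (fun z : ℝ × EuclideanSpace ℝ (Fin d) => a z.1)
      (cylMeasure d T) := by
    rw [cylMeasure_eq_prod]; exact ha.aestronglyMeasurable.comp_fst
  refine tendsto_integral_of_dominated_convergence _ (fun n => ham.mul (hm n))
    ((integrable_weight_cylinder (d := d) ha L).norm.const_mul C) (fun n => ?_) ?_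
  · filter_upwards [ae_cylMeasure_mem] with z hz
    rw [norm_mul, norm_mul]
    by_cases hzL : ‖z.2‖ ≤ L
    · rw [indicator_of_mem (by simpa using hzL), norm_one, mul_one, mul_comm]
      exact mul_le_mul_of_nonneg_right (hC n z hz hzL) (norm_nonneg _)
    · rw [hs n z (not_le.1 hzL), indicator_of_notMem (by simpa using hzL)]; simp
  · filter_upwards [ae_cylMeasure_mem] with z hz
    exact (hlim z hz).const_mul _

lemma tendsto_integral_cylinder_one
    {F : ℕ → ℝ × EuclideanSpace ℝ (Fin d) → ℝ} {F' : ℝ × EuclideanSpace ℝ (Fin d) → ℝ}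
    (hm : ∀ n, AEStronglyMeasurable (F n) (cylMeasure d T))
    (hC : ∀ n z, z.1 ∈ Ioc 0 T → ‖z.2‖ ≤ L → |F n z| ≤ C) (hs : ∀ n z, L < ‖z.2‖ → F n z = 0)
    (hlim : ∀ z, z.1 ∈ Ioc 0 T → Tendsto (fun n => F n z) atTop (𝓝 (F' z))) :
    Tendsto (fun n => ∫ z, F n z ∂cylMeasure d T) atTop (𝓝 (∫ z, F' z ∂cylMeasure d T)) := by
  simpa using tendsto_integral_cylinder (a := fun _ => 1) (integrableOn_const (by simp)) hm hC hs
    hlim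

lemma setIntegral_eq_cylinder (hI : Integrable (fun z => a z.1 * F z) (cylMeasure d T)) :
    ∫ t in Ioc 0 T, a t * ∫ x, F (t, x) = ∫ z, a z.1 * F z ∂cylMeasure d T := by
  rw [cylMeasure_eq_prod] at hI ⊢
  rw [integral_prod _ hI]
  simp only [integral_const_mul]

lemma setIntegral_eq_cylinder_one (hI : Integrable F (cylMeasure d T)) :
    ∫ t in Ioc 0 T, ∫ x, F (t, x) = ∫ z, F z ∂cylMeasure d T := by
  simpa using setIntegral_eq_cylinder (a := fun _ => 1) (F := F) (T := T) (by simpa using hI)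

lemma setIntegral_Ioi_eq_Ioc {f : ℝ → ℝ} (hf : ∀ t, T < t → f t = 0) :
    ∫ t in Ioi 0, f t = ∫ t in Ioc 0 T, f t := by
  refine (setIntegral_eq_of_subset_of_forall_sdiff_eq_zero measurableSet_Ioi
    Ioc_subset_Ioi_self fun t ht => hf t ?_)
  by_contra h
  exact ht.2 ⟨ht.1, not_lt.1 h⟩

/-- Integrals over a shorter cylinder. -/
lemma integral_cylinder_indicator {t : ℝ} (htT : t ≤ T)
    (F : ℝ × EuclideanSpace ℝ (Fin d) → ℝ) :
    ∫ z, (if z.1 ≤ t then (1 : ℝ) else 0) * F z ∂cylMeasure d T = ∫ z, F z ∂cylMeasure d t := by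
  have h1 : (fun z : ℝ × EuclideanSpace ℝ (Fin d) => (if z.1 ≤ t then (1 : ℝ) else 0) * F z) =
      (Iic t ×ˢ univ).indicator F := by
    funext z
    by_cases h : z.1 ≤ t
    · rw [if_pos h, indicator_of_mem (by simpa using h), one_mul]
    · rw [if_neg h, indicator_of_notMem (by simpa using h), zero_mul]
  have hms : MeasurableSet (Iic t ×ˢ (univ : Set (EuclideanSpace ℝ (Fin d)))) :=
    measurableSet_Iic.prod MeasurableSet.univ
  rw [h1, integral_indicator hms, cylMeasure, cylMeasure, Measure.restrict_restrict hms]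
  congr 2
  ext z
  simp only [mem_inter_iff, mem_prod, mem_Iic, mem_univ, and_true, mem_Ioc]
  constructor
  · rintro ⟨h1, h2, h3⟩; exact ⟨h2, h1⟩
  · rintro ⟨h1, h2⟩; exact ⟨h2, h1, h2.trans htT⟩

lemma cylMeasure_mono {t : ℝ} (htT : t ≤ T) : cylMeasure d t ≤ cylMeasure d T :=
  Measure.restrict_mono (prod_mono (Ioc_subset_Ioc_right htT) subset_rfl) le_rfl

end Cylinder

/-! ### The form bound for functions of low regularity -/

section FormBound

open Filter Topology

variable {d : ℕ} {δ : ℝ} {g : ℝ → ℝ}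
  {b : ℝ → EuclideanSpace ℝ (Fin d) → EuclideanSpace ℝ (Fin d)}
  {ξ : ℝ × EuclideanSpace ℝ (Fin d) → ℝ}
  {Dξ : ℝ × EuclideanSpace ℝ (Fin d) → EuclideanSpace ℝ (Fin d)} {L T : ℝ}

lemma fderiv_slice {V : ℝ × EuclideanSpace ℝ (Fin d) → ℝ} (hV : Differentiable ℝ V) (t : ℝ)
    (x w : EuclideanSpace ℝ (Fin d)) :
    fderiv ℝ (fun y => V (t, y)) x w = fderiv ℝ V (t, x) (0, w) := by
  have h1 : HasFDerivAt (fun y : EuclideanSpace ℝ (Fin d) => (t, y))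
      (ContinuousLinearMap.inr ℝ ℝ (EuclideanSpace ℝ (Fin d))) x := hasFDerivAt_prodMk_right t x
  have h2 := ((hV (t, x)).hasFDerivAt).comp x h1
  have h3 : fderiv ℝ (fun y => V (t, y)) x = _ := h2.fderiv
  rw [h3]; simp

lemma inner_gradient {f : EuclideanSpace ℝ (Fin d) → ℝ} (x w : EuclideanSpace ℝ (Fin d)) :
    inner ℝ (gradient f x) w = fderiv ℝ f x w := by
  rw [gradient, InnerProductSpace.toDual_symm_apply]

lemma fderiv_mollify_space (n : ℕ) (hξ : Continuous ξ) (hD : Continuous Dξ)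
    (hgrad : ∀ t x, HasGradientAt (fun y => ξ (t, y)) (Dξ (t, x)) x) (i : Fin d)
    (z : ℝ × EuclideanSpace ℝ (Fin d)) :
    fderiv ℝ (mollify n ξ) z (0, EuclideanSpace.single i 1) = mollify n (fun z => Dξ z i) z := by
  have hDi : Continuous fun z => Dξ z i :=
    (EuclideanSpace.proj (𝕜 := ℝ) i).continuous.comp hD
  refine fderiv_mollify_of_hasLineDerivAt n hξ hDi (fun z => ?_) z
  have := hasLineDerivAt_of_hasGradientAt hgrad (EuclideanSpace.single i 1) z
  rwa [inner_eq_coord] at this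

lemma norm_sq_gradient_mollify (n : ℕ) (hξ : Continuous ξ) (hD : Continuous Dξ)
    (hgrad : ∀ t x, HasGradientAt (fun y => ξ (t, y)) (Dξ (t, x)) x) (t : ℝ)
    (x : EuclideanSpace ℝ (Fin d)) :
    ‖gradient (fun y => mollify n ξ (t, y)) x‖ ^ 2 =
      ∑ i, mollify n (fun z => Dξ z i) (t, x) ^ 2 := by
  rw [EuclideanSpace.real_norm_sq_eq]
  refine Finset.sum_congr rfl fun i _ => ?_
  rw [← inner_eq_coord, inner_gradient, fderiv_slice ((contDiff_mollify n hξ).differentiable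
    (by simp)), fderiv_mollify_space n hξ hD hgrad]

/-- A function vanishing for `|x| > L` has a gradient with the same property. -/
lemma gradient_eq_zero_of_space (hgrad : ∀ t x, HasGradientAt (fun y => ξ (t, y)) (Dξ (t, x)) x)
    (hs : ∀ z : ℝ × EuclideanSpace ℝ (Fin d), L < ‖z.2‖ → ξ z = 0)
    {z : ℝ × EuclideanSpace ℝ (Fin d)} (hz : L < ‖z.2‖) : Dξ z = 0 := by
  have h1 : (fun y => ξ (z.1, y)) =ᶠ[𝓝 z.2] fun _ => 0 := by
    filter_upwards [(isOpen_lt continuous_const continuous_norm).mem_nhds hz] with y hy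
    exact hs (z.1, y) hy
  have h2 := (hgrad z.1 z.2).congr_of_eventuallyEq h1.symm
  exact h2.unique (hasGradientAt_const z.2 (0 : ℝ))

lemma IsFormBounded.integrableOn (hb : IsFormBounded δ g b) (T : ℝ) :
    IntegrableOn g (Ioc 0 T) :=
  (hb.g_locallyIntegrable.integrableOn_compact_subset (t := Icc 0 T) Icc_subset_Ici_self
    isCompact_Icc).mono_set Ioc_subset_Icc_self

/-- The form bound holds for continuous functions with compact support and with a continuous
gradient in the space variable, by mollification. -/
lemma IsFormBounded.bound_of_hasCompactSupport (hb : IsFormBounded δ g b)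
    (hbc : Continuous (Function.uncurry b)) (hξ : Continuous ξ) (hD : Continuous Dξ)
    (hgrad : ∀ t x, HasGradientAt (fun y => ξ (t, y)) (Dξ (t, x)) x)
    (hs : ∀ z, L < ‖z‖ → ξ z = 0) (hT : L + 4 ≤ T) :
    ∫ z, ‖b z.1 z.2‖ ^ 2 * ξ z ^ 2 ∂cylMeasure d T ≤
      δ * (∫ z, ‖Dξ z‖ ^ 2 ∂cylMeasure d T) + ∫ z, g z.1 * ξ z ^ 2 ∂cylMeasure d T := by
  have hDi : ∀ i, Continuous fun z => Dξ z i := fun i =>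
    (EuclideanSpace.proj (𝕜 := ℝ) i).continuous.comp hD
  have hDs : ∀ z : ℝ × EuclideanSpace ℝ (Fin d), L < ‖z‖ → Dξ z = 0 := by
    intro z hz
    have h1 : (fun y => ξ (z.1, y)) =ᶠ[𝓝 z.2] fun _ => 0 := by
      have : ∀ᶠ y in 𝓝 z.2, L < ‖(z.1, y)‖ :=
        (continuous_const.prodMk continuous_id).norm.continuousAt.eventually
          (isOpen_Ioi.mem_nhds hz)
      filter_upwards [this] with y hy
      exact hs (z.1, y) hy
    exact ((hgrad z.1 z.2).congr_of_eventuallyEq h1.symm).unique (hasGradientAt_const z.2 (0 : ℝ))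
  have hz3 : ∀ V : ℝ × EuclideanSpace ℝ (Fin d) → ℝ, Continuous V → (∀ z, L < ‖z‖ → V z = 0) →
      ∀ n z, L + 3 < ‖z‖ → mollify n V z = 0 := by
    intro V hV hV0 n z hz
    refine mollify_eq_zero hV n fun x hx => hV0 x ?_
    rw [dist_eq_norm] at hx
    have := norm_sub_norm_le z x
    rw [norm_sub_rev] at this
    linarith
  have hξn := hz3 ξ hξ hs
  have hDn := fun i => hz3 (fun z => Dξ z i) (hDi i) fun z hz => by simp [hDs z hz]
  set S : Set (ℝ × EuclideanSpace ℝ (Fin d)) := Icc 0 T ×ˢ closedBall 0 (L + 3)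
  have hSc : IsCompact S := isCompact_Icc.prod (isCompact_closedBall _ _)
  have hmem : ∀ z : ℝ × EuclideanSpace ℝ (Fin d), z.1 ∈ Ioc 0 T → ‖z.2‖ ≤ L + 3 → z ∈ S :=
    fun z h1 h2 => ⟨Ioc_subset_Icc_self h1, by simpa using h2⟩
  have hbig : ∀ z : ℝ × EuclideanSpace ℝ (Fin d), L + 3 < ‖z.2‖ → L + 3 < ‖z‖ :=
    fun z hz => hz.trans_le (norm_snd_le z)
  have hlate : ∀ t, T < t → ∀ x : EuclideanSpace ℝ (Fin d), L + 3 < ‖(t, x)‖ := by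
    intro t ht x
    have h1 : |t| ≤ ‖(t, x)‖ := norm_fst_le (t, x)
    have h2 := le_abs_self t
    linarith
  obtain ⟨Cξ, hCξ0, hCξ⟩ := exists_bound_mollify hξ hSc
  choose CD hCD0 hCD using fun i => exists_bound_mollify (hDi i) hSc
  obtain ⟨Cb, hCb⟩ := hSc.exists_bound_of_continuousOn hbc.continuousOn
  have hc1 : ∀ n, Continuous fun z : ℝ × EuclideanSpace ℝ (Fin d) =>
      ‖b z.1 z.2‖ ^ 2 * mollify n ξ z ^ 2 := fun n =>
    (hbc.norm.pow 2).mul ((contDiff_mollify n hξ).continuous.pow 2)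
  have hc2 : ∀ n, Continuous fun z => ∑ i, mollify n (fun z => Dξ z i) z ^ 2 := fun n =>
    continuous_finsetSum _ fun i _ => (contDiff_mollify n (hDi i)).continuous.pow 2
  have hc3 : ∀ n, Continuous fun z => mollify n ξ z ^ 2 := fun n =>
    (contDiff_mollify n hξ).continuous.pow 2
  have hB1 : ∀ n z, z.1 ∈ Ioc 0 T → ‖z.2‖ ≤ L + 3 →
      |‖b z.1 z.2‖ ^ 2 * mollify n ξ z ^ 2| ≤ Cb ^ 2 * Cξ ^ 2 := by
    intro n z h1 h2
    rw [abs_of_nonneg (by positivity), ← sq_abs (mollify n ξ z)]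
    have h3 : ‖b z.1 z.2‖ ≤ Cb := hCb z (hmem z h1 h2)
    have h4 := hCξ n z (hmem z h1 h2)
    gcongr
  have hB2 : ∀ n z, z.1 ∈ Ioc 0 T → ‖z.2‖ ≤ L + 3 →
      |∑ i, mollify n (fun z => Dξ z i) z ^ 2| ≤ ∑ i, CD i ^ 2 := by
    intro n z h1 h2
    rw [abs_of_nonneg (by positivity)]
    refine Finset.sum_le_sum fun i _ => ?_
    rw [← sq_abs]
    have h4 := hCD i n z (hmem z h1 h2)
    gcongr
  have hB3 : ∀ n z, z.1 ∈ Ioc 0 T → ‖z.2‖ ≤ L + 3 → |mollify n ξ z ^ 2| ≤ Cξ ^ 2 := by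
    intro n z h1 h2
    rw [abs_of_nonneg (by positivity), ← sq_abs (mollify n ξ z)]
    have h4 := hCξ n z (hmem z h1 h2)
    gcongr
  have hs1 : ∀ n (z : ℝ × EuclideanSpace ℝ (Fin d)), L + 3 < ‖z.2‖ →
      ‖b z.1 z.2‖ ^ 2 * mollify n ξ z ^ 2 = 0 := fun n z hz => by
    rw [hξn n z (hbig z hz)]; simp
  have hs2 : ∀ n (z : ℝ × EuclideanSpace ℝ (Fin d)), L + 3 < ‖z.2‖ →
      ∑ i, mollify n (fun z => Dξ z i) z ^ 2 = 0 := fun n z hz =>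
    Finset.sum_eq_zero fun i _ => by rw [hDn i n z (hbig z hz)]; simp
  have hs3 : ∀ n (z : ℝ × EuclideanSpace ℝ (Fin d)), L + 3 < ‖z.2‖ →
      mollify n ξ z ^ 2 = 0 := fun n z hz => by
    rw [hξn n z (hbig z hz)]; simp
  have hineq : ∀ n, ∫ z, ‖b z.1 z.2‖ ^ 2 * mollify n ξ z ^ 2 ∂cylMeasure d T ≤
      δ * (∫ z, ∑ i, mollify n (fun z => Dξ z i) z ^ 2 ∂cylMeasure d T) +
        ∫ z, g z.1 * mollify n ξ z ^ 2 ∂cylMeasure d T := by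
    intro n
    have hcs : HasCompactSupport (mollify n ξ) := by
      refine hasCompactSupport_mollify n (HasCompactSupport.intro
        (isCompact_closedBall (0 : ℝ × EuclideanSpace ℝ (Fin d)) L) fun z hz => hs z ?_)
      simpa using hz
    have h := hb.bound (fun t x => mollify n ξ (t, x)) (contDiff_mollify n hξ) hcs
    simp only [norm_sq_gradient_mollify n hξ hD hgrad] at h
    rw [setIntegral_Ioi_eq_Ioc (T := T) fun t ht => by
        simp [hξn n (t, _) (hlate t ht _)],
      setIntegral_Ioi_eq_Ioc (T := T) fun t ht => by
        simp [fun i x => hDn i n (t, x) (hlate t ht x)],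
      setIntegral_Ioi_eq_Ioc (T := T) fun t ht => by
        simp [hξn n (t, _) (hlate t ht _)]] at h
    rw [← setIntegral_eq_cylinder_one (integrable_cylinder_one (hc1 n).aestronglyMeasurable
        (hB1 n) (hs1 n)),
      ← setIntegral_eq_cylinder_one (integrable_cylinder_one (hc2 n).aestronglyMeasurable
        (hB2 n) (hs2 n)),
      ← setIntegral_eq_cylinder (a := g) (F := fun z => mollify n ξ z ^ 2)
        (integrable_cylinder (hb.integrableOn T)
          (hc3 n).aestronglyMeasurable (hB3 n) (hs3 n))]
    exact h
  have hl1 := tendsto_integral_cylinder_one (T := T)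
    (F' := fun z => ‖b z.1 z.2‖ ^ 2 * ξ z ^ 2)
    (fun n => (hc1 n).aestronglyMeasurable) hB1 hs1
    (fun z _ => ((tendsto_mollify hξ z).pow 2).const_mul _)
  have hl2 := tendsto_integral_cylinder_one (T := T) (F' := fun z => ‖Dξ z‖ ^ 2)
    (fun n => (hc2 n).aestronglyMeasurable) hB2 hs2
    (fun z _ => by
      rw [EuclideanSpace.real_norm_sq_eq]
      exact tendsto_finsetSum _ fun i _ => (tendsto_mollify (hDi i) z).pow 2)
  have hl3 := tendsto_integral_cylinder (T := T) (F' := fun z => ξ z ^ 2) (hb.integrableOn T)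
    (fun n => (hc3 n).aestronglyMeasurable) hB3 hs3
    (fun z _ => (tendsto_mollify hξ z).pow 2)
  exact le_of_tendsto_of_tendsto' hl1 ((hl2.const_mul δ).add hl3) hineq

/-- A continuous cutoff in time, equal to `1` up to time `t` and to `0` after time
`t + 1 / (m + 1)`. -/
noncomputable def timeCutoff (t : ℝ) (m : ℕ) (s : ℝ) : ℝ := max 0 (min 1 (1 - (m + 1) * (s - t)))

lemma continuous_timeCutoff (t : ℝ) (m : ℕ) : Continuous (timeCutoff t m) := by
  unfold timeCutoff; fun_prop

lemma timeCutoff_nonneg (t : ℝ) (m : ℕ) (s : ℝ) : 0 ≤ timeCutoff t m s := le_max_left _ _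

lemma timeCutoff_le_one (t : ℝ) (m : ℕ) (s : ℝ) : timeCutoff t m s ≤ 1 :=
  max_le zero_le_one (min_le_left _ _)

lemma timeCutoff_eq_zero {t : ℝ} (m : ℕ) {s : ℝ} (h : t + 1 ≤ s) : timeCutoff t m s = 0 := by
  refine max_eq_left ((min_le_right _ _).trans ?_)
  nlinarith [(Nat.cast_nonneg m : (0 : ℝ) ≤ m)]

lemma tendsto_timeCutoff (t s : ℝ) :
    Tendsto (fun m => timeCutoff t m s) atTop (𝓝 (if s ≤ t then 1 else 0)) := by
  split_ifs with h
  · refine tendsto_const_nhds.congr fun m => ?_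
    have h1 : 1 ≤ 1 - ((m : ℝ) + 1) * (s - t) := by
      nlinarith [(Nat.cast_nonneg m : (0 : ℝ) ≤ m)]
    rw [timeCutoff, min_eq_left h1, max_eq_right zero_le_one]
  · have hst : 0 < s - t := sub_pos.2 (not_le.1 h)
    obtain ⟨N, hN⟩ := exists_nat_gt (1 / (s - t))
    refine tendsto_const_nhds.congr' ?_
    filter_upwards [eventually_ge_atTop N] with m hm
    have h1 : (N : ℝ) ≤ m := by exact_mod_cast hm
    have h2 : 1 < (m : ℝ) * (s - t) := by
      rw [div_lt_iff₀ hst] at hN; nlinarith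
    refine (max_eq_left ((min_le_right _ _).trans ?_)).symm
    nlinarith

/-- The form bound over the time interval `(0, t]`, for functions vanishing at negative times. -/
lemma IsFormBounded.bound_cylinder (hb : IsFormBounded δ g b)
    (hbc : Continuous (Function.uncurry b)) (hξ : Continuous ξ) (hD : Continuous Dξ)
    (hgrad : ∀ t x, HasGradientAt (fun y => ξ (t, y)) (Dξ (t, x)) x)
    (h0 : ∀ z, z.1 ≤ 0 → ξ z = 0) (hs : ∀ z, L < ‖z.2‖ → ξ z = 0) (t : ℝ) :
    ∫ z, ‖b z.1 z.2‖ ^ 2 * ξ z ^ 2 ∂cylMeasure d t ≤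
      δ * (∫ z, ‖Dξ z‖ ^ 2 ∂cylMeasure d t) + ∫ z, g z.1 * ξ z ^ 2 ∂cylMeasure d t := by
  set M := max L (t + 1)
  set T := M + 4
  have hM1 : t + 1 ≤ M := le_max_right _ _
  have htT : t ≤ T := by linarith
  have hDs : ∀ z : ℝ × EuclideanSpace ℝ (Fin d), L < ‖z.2‖ → Dξ z = 0 := fun z hz =>
    gradient_eq_zero_of_space hgrad hs hz
  have hineq : ∀ m, ∫ z, ‖b z.1 z.2‖ ^ 2 * (timeCutoff t m z.1 * ξ z) ^ 2 ∂cylMeasure d T ≤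
      δ * (∫ z, ‖timeCutoff t m z.1 • Dξ z‖ ^ 2 ∂cylMeasure d T) +
        ∫ z, g z.1 * (timeCutoff t m z.1 * ξ z) ^ 2 ∂cylMeasure d T := fun m => by
    have hψ : Continuous fun z : ℝ × EuclideanSpace ℝ (Fin d) => timeCutoff t m z.1 :=
      (continuous_timeCutoff t m).comp continuous_fst
    refine hb.bound_of_hasCompactSupport hbc (hψ.mul hξ) (hψ.smul hD) (fun s x => ?_)
      (L := M) (fun z hz => ?_) le_rfl
    · rw [hasGradientAt_iff_hasFDerivAt, map_smul]
      exact (hgrad s x).hasFDerivAt.const_mul (timeCutoff t m s)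
    · by_cases h1 : L < ‖z.2‖
      · rw [hs z h1, mul_zero]
      by_cases h2 : z.1 ≤ 0
      · rw [h0 z h2, mul_zero]
      rw [timeCutoff_eq_zero, zero_mul]
      rw [Prod.norm_def, Real.norm_eq_abs, abs_of_pos (not_le.1 h2)] at hz
      rcases lt_max_iff.1 hz with h3 | h3
      · linarith
      · exact absurd ((le_max_left _ _).trans_lt h3) h1
  set S : Set (ℝ × EuclideanSpace ℝ (Fin d)) := Icc 0 T ×ˢ closedBall 0 L
  have hSc : IsCompact S := isCompact_Icc.prod (isCompact_closedBall _ _)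
  have hmem : ∀ z : ℝ × EuclideanSpace ℝ (Fin d), z.1 ∈ Ioc 0 T → ‖z.2‖ ≤ L → z ∈ S :=
    fun z h1 h2 => ⟨Ioc_subset_Icc_self h1, by simpa using h2⟩
  -- All three integrands have the form `timeCutoff ^ 2 * F`.
  have hlim : ∀ (a : ℝ → ℝ), IntegrableOn a (Ioc 0 T) →
      ∀ F : ℝ × EuclideanSpace ℝ (Fin d) → ℝ, Continuous F → (∀ z, L < ‖z.2‖ → F z = 0) →
      Tendsto (fun m => ∫ z, a z.1 * (timeCutoff t m z.1 ^ 2 * F z) ∂cylMeasure d T) atTop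
        (𝓝 (∫ z, a z.1 * F z ∂cylMeasure d t)) := by
    intro a ha F hF hF0
    obtain ⟨C, hC⟩ := hSc.exists_bound_of_continuousOn hF.continuousOn
    have h1 := tendsto_integral_cylinder ha (L := L) (C := C)
      (F := fun m z => timeCutoff t m z.1 ^ 2 * F z)
      (F' := fun z => (if z.1 ≤ t then 1 else 0) * F z)
      (fun m => ((((continuous_timeCutoff t m).comp continuous_fst).pow 2).mul
        hF).aestronglyMeasurable)
      (fun m z hz hzL => by
        have h2 : |F z| ≤ C := hC z (hmem z hz hzL)
        rw [abs_mul, abs_of_nonneg (by positivity)]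
        have h3 : timeCutoff t m z.1 ^ 2 ≤ 1 :=
          pow_le_one₀ (timeCutoff_nonneg _ _ _) (timeCutoff_le_one _ _ _)
        nlinarith [abs_nonneg (F z)])
      (fun m z hz => by rw [hF0 z hz, mul_zero])
      (fun z _ => by
        refine Tendsto.mul_const _ ?_
        have := (tendsto_timeCutoff t z.1).pow 2
        split_ifs at this ⊢ <;> simpa using this)
    convert h1 using 2
    rw [← integral_cylinder_indicator htT]
    exact integral_congr_ae (Eventually.of_forall fun z => by ring)
  have hl1 := hlim (fun _ => 1) (integrableOn_const (by simp)) (fun z => ‖b z.1 z.2‖ ^ 2 * ξ z ^ 2)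
    ((hbc.norm.pow 2).mul (hξ.pow 2)) (fun z hz => by rw [hs z hz]; simp)
  have hl2 := hlim (fun _ => 1) (integrableOn_const (by simp)) (fun z => ‖Dξ z‖ ^ 2)
    (hD.norm.pow 2) (fun z hz => by rw [hDs z hz]; simp)
  have hl3 := hlim g (hb.integrableOn T) (fun z => ξ z ^ 2) (hξ.pow 2)
    (fun z hz => by rw [hs z hz]; simp)
  simp only [one_mul] at hl1 hl2
  refine le_of_tendsto_of_tendsto' hl1 ((hl2.const_mul δ).add hl3) fun m => ?_
  have h := hineq m
  simp only [norm_smul, mul_pow, Real.norm_eq_abs, sq_abs] at h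
  simp only [mul_left_comm (timeCutoff t m _ ^ 2) (‖b _ _‖ ^ 2)]
  exact h

/-- The truncated power `(r - k)_+ ^ s`; for `s = 0` it is the indicator of `r > k`. -/
noncomputable def truncPow (k s r : ℝ) : ℝ := if k < r then (r - k) ^ s else 0

lemma truncPow_nonneg (k s r : ℝ) : 0 ≤ truncPow k s r := by
  unfold truncPow; split_ifs with h
  · exact Real.rpow_nonneg (sub_nonneg.2 h.le) s
  · exact le_rfl

lemma truncPow_of_le {k s r : ℝ} (h : r ≤ k) : truncPow k s r = 0 := if_neg (not_lt.2 h)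

lemma truncPow_mul (k s s' r : ℝ) :
    truncPow k s r * truncPow k s' r = truncPow k (s + s') r := by
  unfold truncPow; split_ifs with h
  · rw [Real.rpow_add (sub_pos.2 h)]
  · simp

lemma truncPow_sq (k s r : ℝ) : truncPow k s r ^ 2 = truncPow k (2 * s) r := by
  rw [sq, truncPow_mul, two_mul]

lemma truncPow_rpow (k s q r : ℝ) (hq : q ≠ 0) : truncPow k s r ^ q = truncPow k (s * q) r := by
  unfold truncPow; split_ifs with h
  · rw [Real.rpow_mul (sub_nonneg.2 h.le)]
  · rw [Real.zero_rpow hq]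

lemma truncPow_eq_max {k s : ℝ} (hs : 0 < s) (r : ℝ) : truncPow k s r = max (r - k) 0 ^ s := by
  unfold truncPow; split_ifs with h
  · rw [max_eq_left (sub_nonneg.2 h.le)]
  · rw [max_eq_right (sub_nonpos.2 (not_lt.1 h)), Real.zero_rpow hs.ne']

lemma continuous_truncPow (k : ℝ) {s : ℝ} (hs : 0 < s) : Continuous (truncPow k s) := by
  have : truncPow k s = fun r => max (r - k) 0 ^ s := funext (truncPow_eq_max hs)
  rw [this]
  exact ((continuous_id.sub continuous_const).max continuous_const).rpow_const
    fun _ => Or.inr hs.le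

lemma measurable_truncPow (k s : ℝ) : Measurable (truncPow k s) :=
  Measurable.ite measurableSet_Ioi ((measurable_id.sub_const k).pow_const s) measurable_const

lemma tendsto_truncPow (k r : ℝ) {s : ℝ} {q : ℕ → ℝ} (hq : Tendsto q atTop (𝓝 s)) :
    Tendsto (fun n => truncPow k (q n) r) atTop (𝓝 (truncPow k s r)) := by
  unfold truncPow; split_ifs with h
  · exact (Real.continuousAt_const_rpow (sub_pos.2 h).ne').tendsto.comp hq
  · exact tendsto_const_nhds

lemma truncPow_le {k s S r M : ℝ} (hs : 0 ≤ s) (hsS : s ≤ S) (hr : |r| ≤ M) :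
    truncPow k s r ≤ (1 + M + |k|) ^ S := by
  have hM : 0 ≤ M := (abs_nonneg r).trans hr
  have h1 : 1 ≤ 1 + M + |k| := by linarith [abs_nonneg k]
  unfold truncPow; split_ifs with h
  · calc (r - k) ^ s ≤ (1 + M + |k|) ^ s := by
          refine Real.rpow_le_rpow (sub_nonneg.2 h.le) ?_ hs
          linarith [le_abs_self r, neg_abs_le k]
      _ ≤ _ := Real.rpow_le_rpow_of_exponent_le h1 hsS
  · positivity

lemma hasDerivAt_truncPow (k : ℝ) {s : ℝ} (hs : 1 < s) (r : ℝ) :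
    HasDerivAt (truncPow k s) (s * truncPow k (s - 1) r) r := by
  rcases lt_trichotomy k r with h | h | h
  · have h1 : HasDerivAt (fun r => (r - k) ^ s) (1 * s * (r - k) ^ (s - 1)) r :=
      ((hasDerivAt_id r).sub_const k).rpow_const (Or.inl (sub_pos.2 h).ne')
    have h2 : truncPow k s =ᶠ[𝓝 r] fun r => (r - k) ^ s := by
      filter_upwards [isOpen_Ioi.mem_nhds h] with y hy
      exact if_pos hy
    rw [truncPow, if_pos h, ← one_mul s, one_mul s]
    simpa using h1.congr_of_eventuallyEq h2
  · subst h
    rw [truncPow_of_le le_rfl, mul_zero, hasDerivAt_iff_isLittleO_nhds_zero]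
    simp only [truncPow_of_le le_rfl, sub_zero, smul_zero]
    refine Asymptotics.isLittleO_iff.2 fun c hc => ?_
    have hcont : Tendsto (fun x : ℝ => |x| ^ (s - 1)) (𝓝 0) (𝓝 0) := by
      have : Continuous fun x : ℝ => |x| ^ (s - 1) :=
        continuous_abs.rpow_const fun _ => Or.inr (by linarith)
      simpa [Real.zero_rpow (sub_pos.2 hs).ne'] using this.tendsto 0
    filter_upwards [hcont.eventually (gt_mem_nhds hc)] with x hx
    rw [Real.norm_eq_abs, abs_of_nonneg (truncPow_nonneg _ _ _), Real.norm_eq_abs]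
    unfold truncPow; split_ifs with h
    · have hx0 : 0 < x := by linarith
      rw [add_sub_cancel_left, abs_of_pos hx0]
      rw [abs_of_pos hx0] at hx
      calc x ^ s = x ^ (s - 1) * x := by
            rw [← Real.rpow_add_one hx0.ne']; congr 1; ring
        _ ≤ c * x := mul_le_mul_of_nonneg_right hx.le hx0.le
    · positivity
  · have h2 : truncPow k s =ᶠ[𝓝 r] fun _ => 0 := by
      filter_upwards [isOpen_Iio.mem_nhds h] with y hy
      exact truncPow_of_le (le_of_lt hy)
    rw [truncPow_of_le h.le, mul_zero]
    exact (hasDerivAt_const r (0 : ℝ)).congr_of_eventuallyEq h2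

variable {U : ℝ × EuclideanSpace ℝ (Fin d) → ℝ}
  {DU : ℝ × EuclideanSpace ℝ (Fin d) → EuclideanSpace ℝ (Fin d)}
  {η : EuclideanSpace ℝ (Fin d) → ℝ} {k p : ℝ}

lemma continuous_gradient_of_contDiff (hη : ContDiff ℝ 1 η) : Continuous (gradient η) :=
  (InnerProductSpace.toDual ℝ (EuclideanSpace ℝ (Fin d))).symm.continuous.comp
    (hη.continuous_fderiv (by simp))

lemma gradient_eq_zero_of_forall (hη0 : ∀ x, L < ‖x‖ → η x = 0) {x : EuclideanSpace ℝ (Fin d)}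
    (hx : L < ‖x‖) : gradient η x = 0 := by
  have h1 : η =ᶠ[𝓝 x] fun _ => 0 := by
    filter_upwards [(isOpen_lt continuous_const continuous_norm).mem_nhds hx] with y hy
    exact hη0 y hy
  rw [h1.gradient_eq]
  exact gradient_const x (0 : ℝ)

/-- The form bound for `(U - k)_+ ^ (p / 2) η`. This function is continuously differentiable in
space for `p > 2`; for `p = 2` the bound is obtained as a limit. -/
lemma IsFormBounded.bound_truncPow (hb : IsFormBounded δ g b)
    (hbc : Continuous (Function.uncurry b)) (hU : Continuous U) (hDU : Continuous DU)
    (hgrad : ∀ t x, HasGradientAt (fun y => U (t, y)) (DU (t, x)) x)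
    (h0 : ∀ z, z.1 ≤ 0 → U z = 0) (hη : ContDiff ℝ 1 η) (hη0 : ∀ x, L < ‖x‖ → η x = 0)
    (hk : 0 ≤ k) (hp : 2 ≤ p) (t : ℝ) :
    ∫ z, ‖b z.1 z.2‖ ^ 2 * (truncPow k p (U z) * η z.2 ^ 2) ∂cylMeasure d t ≤
      δ * (∫ z, ‖(p / 2 * truncPow k (p / 2 - 1) (U z) * η z.2) • DU z +
        truncPow k (p / 2) (U z) • gradient η z.2‖ ^ 2 ∂cylMeasure d t) +
        ∫ z, g z.1 * (truncPow k p (U z) * η z.2 ^ 2) ∂cylMeasure d t := by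
  have hDη := continuous_gradient_of_contDiff hη
  have hDη0 := fun x => gradient_eq_zero_of_forall hη0 (x := x)
  have hηc : Continuous fun z : ℝ × EuclideanSpace ℝ (Fin d) => η z.2 :=
    hη.continuous.comp continuous_snd
  have hDηc : Continuous fun z : ℝ × EuclideanSpace ℝ (Fin d) => gradient η z.2 :=
    hDη.comp continuous_snd
  set s : ℕ → ℝ := fun n => p / 2 + 1 / ((n : ℝ) + 1) with hs
  have hs1 : ∀ n, 1 < s n := fun n => by
    have : (0 : ℝ) < 1 / ((n : ℝ) + 1) := by positivity
    simp only [hs]; linarith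
  have hs2 : ∀ n, s n ≤ p / 2 + 1 := fun n => by
    have : (1 : ℝ) / ((n : ℝ) + 1) ≤ 1 := by
      apply div_le_self (by norm_num); linarith [(Nat.cast_nonneg n : (0 : ℝ) ≤ n)]
    simp only [hs]; linarith
  have hslim : Tendsto s atTop (𝓝 (p / 2)) := by
    simpa only [add_zero] using tendsto_one_div_add_atTop_nhds_zero_nat.const_add (p / 2)
  set D : ℝ → ℝ × EuclideanSpace ℝ (Fin d) → EuclideanSpace ℝ (Fin d) := fun q z =>
    (q * truncPow k (q - 1) (U z) * η z.2) • DU z + truncPow k q (U z) • gradient η z.2 with hD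
  have hcont : ∀ q, 0 < q → Continuous fun z => truncPow k q (U z) := fun q hq =>
    (continuous_truncPow k hq).comp hU
  have hcD : ∀ n, Continuous (D (s n)) := fun n =>
    (((continuous_const.mul (hcont _ (by linarith [hs1 n]))).mul hηc).smul hDU).add
      ((hcont _ (by linarith [hs1 n])).smul hDηc)
  have hcξ : ∀ n, Continuous fun z => truncPow k (s n) (U z) * η z.2 := fun n =>
    (hcont _ (by linarith [hs1 n])).mul hηc
  have hineq : ∀ n, ∫ z, ‖b z.1 z.2‖ ^ 2 * (truncPow k (s n) (U z) * η z.2) ^ 2 ∂cylMeasure d t ≤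
      δ * (∫ z, ‖D (s n) z‖ ^ 2 ∂cylMeasure d t) +
        ∫ z, g z.1 * (truncPow k (s n) (U z) * η z.2) ^ 2 ∂cylMeasure d t := fun n => by
    refine hb.bound_cylinder hbc (hcξ n) (hcD n) (fun τ x => ?_) (fun z hz => ?_)
      (L := L) (fun z hz => ?_) t
    · have h1 := (hasDerivAt_truncPow k (hs1 n) (U (τ, x))).comp_hasFDerivAt x
        (hgrad τ x).hasFDerivAt
      have h2 : HasGradientAt η (gradient η x) x :=
        (hη.differentiable (by simp)).differentiableAt.hasGradientAt
      have h3 := h1.mul h2.hasFDerivAt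
      rw [hasGradientAt_iff_hasFDerivAt]
      refine h3.congr_fderiv ?_
      simp only [hD, map_add, map_smul, smul_smul, Function.comp]
      rw [add_comm]
      congr 2
      ring
    · rw [truncPow_of_le (by rw [h0 z hz]; exact hk), zero_mul]
    · rw [hη0 _ hz, mul_zero]
  have hSc : IsCompact (Icc (0 : ℝ) t ×ˢ closedBall (0 : EuclideanSpace ℝ (Fin d)) L) :=
    isCompact_Icc.prod (isCompact_closedBall _ _)
  have hmem : ∀ z : ℝ × EuclideanSpace ℝ (Fin d), z.1 ∈ Ioc 0 t → ‖z.2‖ ≤ L →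
      z ∈ Icc (0 : ℝ) t ×ˢ closedBall (0 : EuclideanSpace ℝ (Fin d)) L :=
    fun z h1 h2 => ⟨Ioc_subset_Icc_self h1, by simpa using h2⟩
  obtain ⟨M, hM⟩ := hSc.exists_bound_of_continuousOn hU.continuousOn
  obtain ⟨M1, hM1⟩ := hSc.exists_bound_of_continuousOn hDU.continuousOn
  obtain ⟨M2, hM2⟩ := hSc.exists_bound_of_continuousOn hηc.continuousOn
  obtain ⟨M3, hM3⟩ := hSc.exists_bound_of_continuousOn hDηc.continuousOn
  obtain ⟨M4, hM4⟩ := hSc.exists_bound_of_continuousOn hbc.continuousOn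
  set P := (1 + M + |k|) ^ (p / 2 + 1)
  have hP1 : ∀ n z, z.1 ∈ Ioc 0 t → ‖z.2‖ ≤ L → truncPow k (s n) (U z) ≤ P :=
    fun n z h1 h2 => truncPow_le (by linarith [hs1 n]) (hs2 n) (hM z (hmem z h1 h2))
  have hP2 : ∀ n z, z.1 ∈ Ioc 0 t → ‖z.2‖ ≤ L → truncPow k (s n - 1) (U z) ≤ P :=
    fun n z h1 h2 => truncPow_le (by linarith [hs1 n]) (by linarith [hs2 n]) (hM z (hmem z h1 h2))
  have hB : ∀ n z, z.1 ∈ Ioc 0 t → ‖z.2‖ ≤ L →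
      (truncPow k (s n) (U z) * η z.2) ^ 2 ≤ (P * M2) ^ 2 := fun n z h1 h2 => by
    rw [mul_pow, mul_pow, ← sq_abs (η z.2)]
    have h3 := hP1 n z h1 h2
    have h4 : |η z.2| ≤ M2 := hM2 z (hmem z h1 h2)
    have h5 := truncPow_nonneg k (s n) (U z)
    gcongr
  have hlimξ : ∀ z, Tendsto (fun n => (truncPow k (s n) (U z) * η z.2) ^ 2) atTop
      (𝓝 (truncPow k p (U z) * η z.2 ^ 2)) := fun z => by
    have h1 := ((tendsto_truncPow k (U z) hslim).mul_const (η z.2)).pow 2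
    rwa [mul_pow, truncPow_sq, mul_div_cancel₀ _ (two_ne_zero)] at h1
  have hl1 := tendsto_integral_cylinder_one (T := t) (L := L) (C := M4 ^ 2 * (P * M2) ^ 2)
    (F := fun n z => ‖b z.1 z.2‖ ^ 2 * (truncPow k (s n) (U z) * η z.2) ^ 2)
    (F' := fun z => ‖b z.1 z.2‖ ^ 2 * (truncPow k p (U z) * η z.2 ^ 2))
    (fun n => ((hbc.norm.pow 2).mul ((hcξ n).pow 2)).aestronglyMeasurable)
    (fun n z h1 h2 => by
      rw [abs_of_nonneg (by positivity)]
      have h3 := hB n z h1 h2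
      have h4 : ‖b z.1 z.2‖ ≤ M4 := hM4 z (hmem z h1 h2)
      gcongr)
    (fun n z hz => by rw [hη0 _ hz]; simp)
    (fun z _ => (hlimξ z).const_mul _)
  have hl2 := tendsto_integral_cylinder_one (T := t) (L := L)
    (C := ((p / 2 + 1) * P * M2 * M1 + P * M3) ^ 2)
    (F := fun n z => ‖D (s n) z‖ ^ 2) (F' := fun z => ‖D (p / 2) z‖ ^ 2)
    (fun n => ((hcD n).norm.pow 2).aestronglyMeasurable)
    (fun n z h1 h2 => by
      rw [abs_of_nonneg (by positivity)]
      refine pow_le_pow_left₀ (norm_nonneg _) ((norm_add_le _ _).trans ?_) 2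
      rw [norm_smul, norm_smul, norm_mul, norm_mul, Real.norm_eq_abs, Real.norm_eq_abs,
        Real.norm_eq_abs, Real.norm_eq_abs, abs_of_nonneg (truncPow_nonneg _ _ _),
        abs_of_nonneg (truncPow_nonneg _ _ _), abs_of_nonneg (by linarith [hs1 n])]
      have h3 := hP1 n z h1 h2
      have h4 := hP2 n z h1 h2
      have h5 : |η z.2| ≤ M2 := hM2 z (hmem z h1 h2)
      have h6 := hM1 z (hmem z h1 h2)
      have h7 := hM3 z (hmem z h1 h2)
      have h8 := truncPow_nonneg k (s n) (U z)
      have h9 := truncPow_nonneg k (s n - 1) (U z)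
      have h10 := hs2 n
      have h11 : 0 ≤ P := h8.trans h3
      have h12 : 0 ≤ M2 := (abs_nonneg _).trans h5
      gcongr)
    (fun n z hz => by simp [hD, hη0 _ hz, hDη0 _ hz])
    (fun z _ => by
      refine (Tendsto.norm ?_).pow 2
      exact (((hslim.mul (tendsto_truncPow k (U z) (hslim.sub_const 1))).mul_const _).smul_const
        _).add ((tendsto_truncPow k (U z) hslim).smul_const _))
  have hl3 := tendsto_integral_cylinder (T := t) (L := L) (C := (P * M2) ^ 2) (hb.integrableOn t)
    (F := fun n z => (truncPow k (s n) (U z) * η z.2) ^ 2)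
    (F' := fun z => truncPow k p (U z) * η z.2 ^ 2)
    (fun n => ((hcξ n).pow 2).aestronglyMeasurable)
    (fun n z h1 h2 => by
      rw [abs_of_nonneg (by positivity)]; exact hB n z h1 h2)
    (fun n z hz => by rw [hη0 _ hz]; simp)
    (fun z _ => hlimξ z)
  exact le_of_tendsto_of_tendsto' hl1 ((hl2.const_mul δ).add hl3) hineq

end FormBound

/-! ### The energy identity -/

section EnergyIdentity

open Filter Topology

variable {d : ℕ} {G U : ℝ × EuclideanSpace ℝ (Fin d) → ℝ}
  {DU : ℝ × EuclideanSpace ℝ (Fin d) → EuclideanSpace ℝ (Fin d)}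
  {η : EuclideanSpace ℝ (Fin d) → ℝ} {L k p : ℝ} {Φ Φ' Φ'' : ℝ → ℝ}

/-- The cylinder `[0, t] × {|x| ≤ L}`. -/
def closedCylinder (d : ℕ) (t L : ℝ) : Set (ℝ × EuclideanSpace ℝ (Fin d)) :=
  Icc 0 t ×ˢ closedBall 0 L

lemma isCompact_closedCylinder (t L : ℝ) : IsCompact (closedCylinder d t L) :=
  isCompact_Icc.prod (isCompact_closedBall _ _)

lemma mem_closedCylinder {t : ℝ} {z : ℝ × EuclideanSpace ℝ (Fin d)} (h1 : z.1 ∈ Ioc 0 t)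
    (h2 : ‖z.2‖ ≤ L) : z ∈ closedCylinder d t L :=
  ⟨Ioc_subset_Icc_self h1, by simpa using h2⟩

lemma integrable_cylinder_of_continuous {F : ℝ × EuclideanSpace ℝ (Fin d) → ℝ} (hF : Continuous F)
    (h0 : ∀ z, L < ‖z.2‖ → F z = 0) (t : ℝ) : Integrable F (cylMeasure d t) := by
  obtain ⟨C, hC⟩ := (isCompact_closedCylinder (d := d) t L).exists_bound_of_continuousOn
    hF.continuousOn
  exact integrable_cylinder_one hF.aestronglyMeasurable
    (fun z h1 h2 => hC z (mem_closedCylinder h1 h2)) h0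

lemma integrable_of_continuous {F : EuclideanSpace ℝ (Fin d) → ℝ} (hF : Continuous F)
    (h0 : ∀ x, L < ‖x‖ → F x = 0) : Integrable F :=
  hF.integrable_of_hasCompactSupport (HasCompactSupport.intro (isCompact_closedBall 0 L)
    fun x hx => h0 x (by simpa using hx))

/-- Integration by parts in space, for a fixed time. -/
lemma integral_mul_fderiv_slice {V W : ℝ × EuclideanSpace ℝ (Fin d) → ℝ} (hV : ContDiff ℝ 1 V)
    (hW : ContDiff ℝ 1 W) (h0 : ∀ z, L < ‖z.2‖ → W z = 0) (t : ℝ) (w : EuclideanSpace ℝ (Fin d)) :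
    ∫ x, W (t, x) * fderiv ℝ V (t, x) (0, w) = -∫ x, fderiv ℝ W (t, x) (0, w) * V (t, x) := by
  have hV1 : ContDiff ℝ 1 fun x => V (t, x) := hV.comp (contDiff_const.prodMk contDiff_id)
  have hW1 : ContDiff ℝ 1 fun x => W (t, x) := hW.comp (contDiff_const.prodMk contDiff_id)
  have hcs : HasCompactSupport fun x => W (t, x) :=
    HasCompactSupport.intro (isCompact_closedBall (0 : EuclideanSpace ℝ (Fin d)) L)
      fun x hx => h0 (t, x) (by simpa using hx)
  have hcs' := hcs.fderiv_apply (𝕜 := ℝ) w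
  have hc : Continuous fun x => fderiv ℝ (fun x => W (t, x)) x w :=
    (hW1.continuous_fderiv (by simp)).clm_apply continuous_const
  have hc' : Continuous fun x => fderiv ℝ (fun x => V (t, x)) x w :=
    (hV1.continuous_fderiv (by simp)).clm_apply continuous_const
  have key := integral_mul_fderiv_eq_neg_fderiv_mul_of_integrable (𝕜 := ℝ)
    (μ := (volume : Measure (EuclideanSpace ℝ (Fin d)))) (f := fun x => W (t, x))
    (g := fun x => V (t, x)) (v := w)
    ((hc.mul hV1.continuous).integrable_of_hasCompactSupport hcs'.mul_right)
    ((hW1.continuous.mul hc').integrable_of_hasCompactSupport hcs.mul_right)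
    ((hW1.continuous.mul hV1.continuous).integrable_of_hasCompactSupport hcs.mul_right)
    (fun x _ => (hW1.differentiable (by simp)).differentiableAt)
    (fun x _ => (hV1.differentiable (by simp)).differentiableAt)
  simpa only [fderiv_slice (hV.differentiable (by simp)),
    fderiv_slice (hW.differentiable (by simp))] using key

/-- The energy identity for the mollified solution. -/
lemma IsExtendedSolution.mollified_energy_identity (h : IsExtendedSolution G U DU)
    (hΦ : ∀ r, HasDerivAt Φ (Φ' r) r) (hΦ' : ∀ r, HasDerivAt Φ' (Φ'' r) r)
    (hΦ'' : Continuous Φ'') (hη : ContDiff ℝ 1 η) (hη0 : ∀ x, L < ‖x‖ → η x = 0)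
    {t : ℝ} (ht : 0 ≤ t) (n : ℕ) :
    (∫ x, Φ (mollify n U (t, x)) * η x ^ 2) - ∫ x, Φ (mollify n U (0, x)) * η x ^ 2 =
      ∫ z, (Φ' (mollify n U z) * mollify n G z * η z.2 ^ 2 -
        ∑ i, (Φ'' (mollify n U z) * mollify n (fun z => DU z i) z ^ 2 * η z.2 ^ 2 +
          2 * Φ' (mollify n U z) * η z.2 * (mollify n (fun z => DU z i) z * gradient η z.2 i)))
        ∂cylMeasure d t := by
  have hDUi : ∀ i, Continuous fun y => DU y i := fun i =>
    (EuclideanSpace.proj (𝕜 := ℝ) i).continuous.comp h.continuous_grad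
  set u := mollify n U with hu
  set v : Fin d → ℝ × EuclideanSpace ℝ (Fin d) → ℝ := fun i => mollify n fun z => DU z i
  have hu1 : ContDiff ℝ ∞ u := contDiff_mollify n h.continuous
  have hv1 : ∀ i, ContDiff ℝ ∞ (v i) := fun i => contDiff_mollify n (hDUi i)
  have hG1 : Continuous (mollify n G) := (contDiff_mollify n h.continuous_source).continuous
  have hΦc : Continuous Φ := continuous_iff_continuousAt.2 fun r => (hΦ r).continuousAt
  have hΦc' : Continuous Φ' := continuous_iff_continuousAt.2 fun r => (hΦ' r).continuousAt
  have hΦ1 : ContDiff ℝ 1 Φ' := by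
    rw [contDiff_one_iff_deriv]
    refine ⟨fun r => (hΦ' r).differentiableAt, ?_⟩
    rw [show deriv Φ' = Φ'' from funext fun r => (hΦ' r).deriv]
    exact hΦ''
  have hηc : Continuous fun z : ℝ × EuclideanSpace ℝ (Fin d) => η z.2 :=
    hη.continuous.comp continuous_snd
  have hDη := continuous_gradient_of_contDiff hη
  have hDηi : ∀ i, Continuous fun z : ℝ × EuclideanSpace ℝ (Fin d) => gradient η z.2 i := fun i =>
    (EuclideanSpace.proj (𝕜 := ℝ) i).continuous.comp (hDη.comp continuous_snd)
  have hut : Continuous fun z => fderiv ℝ u z (1, 0) :=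
    (hu1.continuous_fderiv (by simp)).clm_apply continuous_const
  have hvx : ∀ i, Continuous fun z => fderiv ℝ (v i) z (0, EuclideanSpace.single i 1) := fun i =>
    ((hv1 i).continuous_fderiv (by simp)).clm_apply continuous_const
  -- The fundamental theorem of calculus in time.
  have hftc : ∀ x, Φ (u (t, x)) * η x ^ 2 - Φ (u (0, x)) * η x ^ 2 =
      ∫ s in Ioc 0 t, Φ' (u (s, x)) * fderiv ℝ u (s, x) (1, 0) * η x ^ 2 := fun x => by
    rw [← intervalIntegral.integral_of_le ht]
    refine (intervalIntegral.integral_eq_sub_of_hasDerivAt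
      (f := fun s => Φ (u (s, x)) * η x ^ 2) (fun s _ => ?_) ?_).symm
    · have h1 : HasDerivAt (fun s : ℝ => (s, x)) (1, 0) s :=
        (hasDerivAt_id s).prodMk (hasDerivAt_const s x)
      have h2 := ((hu1.differentiable (by simp)) (s, x)).hasFDerivAt.comp_hasDerivAt s h1
      exact ((hΦ _).comp s h2).mul_const _
    · have hcx : Continuous fun s : ℝ => (s, x) := by fun_prop
      exact (((hΦc'.comp (hu1.continuous.comp hcx)).mul (hut.comp hcx)).mul
        continuous_const).intervalIntegrable _ _
  have hIη : ∀ s, Integrable fun x => Φ (u (s, x)) * η x ^ 2 := fun s =>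
    integrable_of_continuous (L := L) ((hΦc.comp (hu1.continuous.comp (by fun_prop))).mul
      (hη.continuous.pow 2)) fun x hx => by rw [hη0 x hx]; simp
  have hI1 : Integrable (fun z => Φ' (u z) * fderiv ℝ u z (1, 0) * η z.2 ^ 2)
      (cylMeasure d t) :=
    integrable_cylinder_of_continuous (L := L) (((hΦc'.comp hu1.continuous).mul hut).mul
      (hηc.pow 2)) (fun z hz => by simp [hη0 _ hz]) t
  have hstep1 : (∫ x, Φ (u (t, x)) * η x ^ 2) - ∫ x, Φ (u (0, x)) * η x ^ 2 =
      ∫ z, Φ' (u z) * fderiv ℝ u z (1, 0) * η z.2 ^ 2 ∂cylMeasure d t := by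
    rw [← integral_sub (hIη t) (hIη 0)]
    simp only [hftc]
    rw [cylMeasure_eq_prod] at hI1 ⊢
    rw [integral_prod_symm _ hI1]
  rw [hstep1, ← setIntegral_eq_cylinder_one hI1]
  have hI2 : Integrable (fun z => Φ' (u z) * mollify n G z * η z.2 ^ 2 -
        ∑ i, (Φ'' (u z) * v i z ^ 2 * η z.2 ^ 2 +
          2 * Φ' (u z) * η z.2 * (v i z * gradient η z.2 i))) (cylMeasure d t) := by
    refine integrable_cylinder_of_continuous (L := L) ?_ (fun z hz => ?_) t
    · refine (((hΦc'.comp hu1.continuous).mul hG1).mul (hηc.pow 2)).sub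
        (continuous_finsetSum _ fun i _ => ?_)
      exact (((hΦ''.comp hu1.continuous).mul ((hv1 i).continuous.pow 2)).mul (hηc.pow 2)).add
        (((continuous_const.mul (hΦc'.comp hu1.continuous)).mul hηc).mul
          ((hv1 i).continuous.mul (hDηi i)))
    · rw [hη0 _ hz]; simp
  rw [← setIntegral_eq_cylinder_one hI2]
  refine setIntegral_congr_fun measurableSet_Ioc fun s hs => ?_
  simp only
  -- The equation, and integration by parts in space, at a fixed time `s`.
  have heq : ∀ x, Φ' (u (s, x)) * fderiv ℝ u (s, x) (1, 0) * η x ^ 2 =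
      Φ' (u (s, x)) * mollify n G (s, x) * η x ^ 2 +
        ∑ i, (Φ' (u (s, x)) * η x ^ 2) *
          fderiv ℝ (v i) (s, x) (0, EuclideanSpace.single i 1) := fun x => by
    rw [hu, h.fderiv_mollify_time n (z := (s, x)) hs.1.le, ← Finset.mul_sum]
    ring
  have hcs : Continuous fun x : EuclideanSpace ℝ (Fin d) => (s, x) := by fun_prop
  have hus : Continuous fun x => u (s, x) := hu1.continuous.comp hcs
  have hJ1 : Integrable fun x => Φ' (u (s, x)) * mollify n G (s, x) * η x ^ 2 :=
    integrable_of_continuous (L := L) (((hΦc'.comp hus).mul (hG1.comp hcs)).mul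
      (hη.continuous.pow 2)) fun x hx => by rw [hη0 x hx]; simp
  have hJ2 : ∀ i, Integrable fun x => (Φ' (u (s, x)) * η x ^ 2) *
      fderiv ℝ (v i) (s, x) (0, EuclideanSpace.single i 1) := fun i =>
    integrable_of_continuous (L := L) (((hΦc'.comp hus).mul (hη.continuous.pow 2)).mul
      ((hvx i).comp hcs)) fun x hx => by rw [hη0 x hx]; simp
  have hJ3 : ∀ i, Integrable fun x => Φ'' (u (s, x)) * v i (s, x) ^ 2 * η x ^ 2 +
          2 * Φ' (u (s, x)) * η x * (v i (s, x) * gradient η x i) := fun i =>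
    integrable_of_continuous (L := L) ((((hΦ''.comp hus).mul
      (((hv1 i).continuous.comp hcs).pow 2)).mul (hη.continuous.pow 2)).add
        (((continuous_const.mul (hΦc'.comp hus)).mul hη.continuous).mul
          (((hv1 i).continuous.comp hcs).mul ((hDηi i).comp hcs))))
      fun x hx => by rw [hη0 x hx]; simp
  simp only [heq]
  rw [integral_add hJ1 (integrable_finsetSum _ fun i _ => hJ2 i),
    integral_sub hJ1 (integrable_finsetSum _ fun i _ => hJ3 i),
    integral_finsetSum _ fun i _ => hJ2 i, integral_finsetSum _ fun i _ => hJ3 i,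
    sub_eq_add_neg, ← Finset.sum_neg_distrib]
  congr 1
  refine Finset.sum_congr rfl fun i _ => ?_
  have hW : ContDiff ℝ 1 fun z : ℝ × EuclideanSpace ℝ (Fin d) => Φ' (u z) * η z.2 ^ 2 :=
    (hΦ1.comp (hu1.of_le (by simp))).mul ((hη.comp contDiff_snd).pow 2)
  rw [integral_mul_fderiv_slice (L := L) ((hv1 i).of_le (by simp)) hW
    (fun z hz => by rw [hη0 _ hz]; simp) s]
  congr 1
  refine integral_congr_ae (Eventually.of_forall fun x => ?_)
  simp only
  have hfd : fderiv ℝ (fun z : ℝ × EuclideanSpace ℝ (Fin d) => Φ' (u z) * η z.2 ^ 2) (s, x)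
      (0, EuclideanSpace.single i 1) =
      Φ'' (u (s, x)) * v i (s, x) * η x ^ 2 + 2 * Φ' (u (s, x)) * η x * gradient η x i := by
    have h1 : HasFDerivAt (fun z => Φ' (u z)) (Φ'' (u (s, x)) • fderiv ℝ u (s, x)) (s, x) :=
      (hΦ' _).comp_hasFDerivAt _ ((hu1.differentiable (by simp)) _).hasFDerivAt
    have h2 : HasFDerivAt (fun z : ℝ × EuclideanSpace ℝ (Fin d) => η z.2)
        ((fderiv ℝ η x).comp (ContinuousLinearMap.snd ℝ _ _)) (s, x) :=
      HasFDerivAt.comp (s, x) ((hη.differentiable (by simp)) x).hasFDerivAt hasFDerivAt_snd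
    have h5 : fderiv ℝ (fun z : ℝ × EuclideanSpace ℝ (Fin d) => Φ' (u z) * η z.2 ^ 2) (s, x) = _ :=
      (h1.mul (h2.pow 2)).fderiv
    rw [h5]
    have h3 : fderiv ℝ u (s, x) (0, EuclideanSpace.single i 1) = v i (s, x) :=
      fderiv_mollify_space n h.continuous h.continuous_grad h.hasGradientAt i (s, x)
    have h4 : fderiv ℝ η x (EuclideanSpace.single i 1) = gradient η x i := by
      rw [← inner_eq_coord, inner_gradient]
    simp [h3, h4]
    ring
  rw [hfd]
  ring

lemma tendsto_integral_slice {F : ℕ → EuclideanSpace ℝ (Fin d) → ℝ}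
    {F' : EuclideanSpace ℝ (Fin d) → ℝ} {C : ℝ} (hm : ∀ n, AEStronglyMeasurable (F n))
    (hC : ∀ n x, ‖x‖ ≤ L → |F n x| ≤ C) (hs : ∀ n x, L < ‖x‖ → F n x = 0)
    (hlim : ∀ x, Tendsto (fun n => F n x) atTop (𝓝 (F' x))) :
    Tendsto (fun n => ∫ x, F n x) atTop (𝓝 (∫ x, F' x)) := by
  refine tendsto_integral_of_dominated_convergence
    ((closedBall (0 : EuclideanSpace ℝ (Fin d)) L).indicator fun _ => C) hm
    ((integrable_indicator_iff measurableSet_closedBall).2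
      (integrableOn_const (measure_closedBall_lt_top.ne)))
    (fun n => Eventually.of_forall fun x => ?_) (Eventually.of_forall hlim)
  by_cases hx : ‖x‖ ≤ L
  · rw [indicator_of_mem (by simpa using hx)]; exact hC n x hx
  · rw [hs n x (not_le.1 hx), indicator_of_notMem (by simpa using hx)]; simp

lemma exists_bound_comp {Ψ : ℝ → ℝ} (hΨ : Continuous Ψ) (M : ℝ) :
    ∃ C, ∀ r, |r| ≤ M → |Ψ r| ≤ C := by
  obtain ⟨C, hC⟩ := (isCompact_closedBall (0 : ℝ) M).exists_bound_of_continuousOn hΨ.continuousOn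
  exact ⟨C, fun r hr => hC r (by simpa using hr)⟩

/-- The energy identity for twice continuously differentiable functions of the solution. -/
lemma IsExtendedSolution.energy_identity (h : IsExtendedSolution G U DU)
    (hΦ : ∀ r, HasDerivAt Φ (Φ' r) r) (hΦ' : ∀ r, HasDerivAt Φ' (Φ'' r) r)
    (hΦ'' : Continuous Φ'') (hΦ0 : Φ 0 = 0) (hη : ContDiff ℝ 1 η)
    (hη0 : ∀ x, L < ‖x‖ → η x = 0) {t : ℝ} (ht : 0 ≤ t) :
    ∫ x, Φ (U (t, x)) * η x ^ 2 =
      ∫ z, (Φ' (U z) * G z * η z.2 ^ 2 - (Φ'' (U z) * ‖DU z‖ ^ 2 * η z.2 ^ 2 +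
          2 * Φ' (U z) * η z.2 * inner ℝ (DU z) (gradient η z.2))) ∂cylMeasure d t := by
  have hDUi : ∀ i, Continuous fun y => DU y i := fun i =>
    (EuclideanSpace.proj (𝕜 := ℝ) i).continuous.comp h.continuous_grad
  have hu1 : ∀ n, Continuous (mollify n U) := fun n => (contDiff_mollify n h.continuous).continuous
  have hv1 : ∀ i n, Continuous (mollify n fun z => DU z i) := fun i n =>
    (contDiff_mollify n (hDUi i)).continuous
  have hG1 : ∀ n, Continuous (mollify n G) := fun n =>
    (contDiff_mollify n h.continuous_source).continuous
  have hΦc : Continuous Φ := continuous_iff_continuousAt.2 fun r => (hΦ r).continuousAt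
  have hΦc' : Continuous Φ' := continuous_iff_continuousAt.2 fun r => (hΦ' r).continuousAt
  have hηc : Continuous fun z : ℝ × EuclideanSpace ℝ (Fin d) => η z.2 :=
    hη.continuous.comp continuous_snd
  have hDη := continuous_gradient_of_contDiff hη
  have hDηi : ∀ i, Continuous fun z : ℝ × EuclideanSpace ℝ (Fin d) => gradient η z.2 i := fun i =>
    (EuclideanSpace.proj (𝕜 := ℝ) i).continuous.comp (hDη.comp continuous_snd)
  have hS := isCompact_closedCylinder (d := d) t L
  obtain ⟨Mu, hMu0, hMu⟩ := exists_bound_mollify h.continuous hS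
  obtain ⟨MG, hMG0, hMG⟩ := exists_bound_mollify h.continuous_source hS
  choose Mv hMv0 hMv using fun i => exists_bound_mollify (hDUi i) hS
  obtain ⟨Mη, hMη⟩ := hS.exists_bound_of_continuousOn hηc.continuousOn
  choose MD hMD using fun i => hS.exists_bound_of_continuousOn (hDηi i).continuousOn
  obtain ⟨C0, hC0⟩ := exists_bound_comp hΦc Mu
  obtain ⟨C1, hC1⟩ := exists_bound_comp hΦc' Mu
  obtain ⟨C2, hC2⟩ := exists_bound_comp hΦ'' Mu
  have hslice : ∀ s ∈ Icc 0 t, Tendsto (fun n => ∫ x, Φ (mollify n U (s, x)) * η x ^ 2) atTop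
      (𝓝 (∫ x, Φ (U (s, x)) * η x ^ 2)) := fun s hs => by
    refine tendsto_integral_slice (L := L) (C := C0 * Mη ^ 2)
      (fun n => ((hΦc.comp ((hu1 n).comp (by fun_prop))).mul
        (hη.continuous.pow 2)).aestronglyMeasurable) (fun n x hx => ?_)
      (fun n x hx => by rw [hη0 x hx]; simp)
      (fun x => ((hΦc.tendsto _).comp (tendsto_mollify h.continuous (s, x))).mul_const _)
    have hz : ((s, x) : ℝ × EuclideanSpace ℝ (Fin d)) ∈ closedCylinder d t L :=
      ⟨hs, by simpa using hx⟩
    rw [abs_mul, abs_pow]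
    have h1 := hC0 _ (hMu n _ hz)
    have h2 : |η x| ≤ Mη := hMη _ hz
    have h3 := (abs_nonneg _).trans h1
    gcongr
  have hL := (hslice t ⟨ht, le_rfl⟩).sub (hslice 0 ⟨le_rfl, ht⟩)
  have h00 : ∀ x, U ((0 : ℝ), x) = 0 := fun x => h.eq_zero _ le_rfl
  simp only [h00, hΦ0, zero_mul, integral_zero, sub_zero] at hL
  refine tendsto_nhds_unique hL ?_
  simp only [h.mollified_energy_identity hΦ hΦ' hΦ'' hη hη0 ht]
  refine tendsto_integral_cylinder_one (L := L)
    (C := C1 * MG * Mη ^ 2 + ∑ i, (C2 * Mv i ^ 2 * Mη ^ 2 + 2 * C1 * Mη * (Mv i * MD i)))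
    (fun n => Continuous.aestronglyMeasurable ?_) (fun n z h1 h2 => ?_)
    (fun n z hz => by rw [hη0 _ hz]; simp) (fun z _ => ?_)
  · refine (((hΦc'.comp (hu1 n)).mul (hG1 n)).mul (hηc.pow 2)).sub
      (continuous_finsetSum _ fun i _ => ?_)
    exact (((hΦ''.comp (hu1 n)).mul ((hv1 i n).pow 2)).mul (hηc.pow 2)).add
      (((continuous_const.mul (hΦc'.comp (hu1 n))).mul hηc).mul ((hv1 i n).mul (hDηi i)))
  · have hz := mem_closedCylinder h1 h2
    have e1 := hC1 _ (hMu n z hz)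
    have e2 := hC2 _ (hMu n z hz)
    have e3 := hMG n z hz
    have e4 : |η z.2| ≤ Mη := hMη z hz
    have e5 := (abs_nonneg _).trans e1
    have e6 := (abs_nonneg _).trans e2
    have e7 := (abs_nonneg _).trans e4
    refine (abs_sub _ _).trans (add_le_add ?_ ((Finset.abs_sum_le_sum_abs _ _).trans
      (Finset.sum_le_sum fun i _ => (abs_add_le _ _).trans (add_le_add ?_ ?_))))
    · rw [abs_mul, abs_mul, abs_pow]; gcongr
    · have e8 := hMv i n z hz
      rw [abs_mul, abs_mul, abs_pow, abs_pow]; gcongr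
    · have e8 := hMv i n z hz
      have e9 : |gradient η z.2 i| ≤ MD i := hMD i z hz
      have e10 := hMv0 i
      rw [abs_mul, abs_mul, abs_mul, abs_mul, abs_two]; gcongr
  · have t0 := tendsto_mollify h.continuous z
    have t1 := (hΦc'.tendsto _).comp t0
    have t2 := (hΦ''.tendsto _).comp t0
    have t3 := tendsto_mollify h.continuous_source z
    have t4 := fun i => tendsto_mollify (hDUi i) z
    have key := ((t1.mul t3).mul_const (η z.2 ^ 2)).sub (tendsto_finsetSum Finset.univ fun i _ =>
      ((t2.mul ((t4 i).pow 2)).mul_const (η z.2 ^ 2)).add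
        (((t1.const_mul 2).mul_const (η z.2)).mul ((t4 i).mul_const (gradient η z.2 i))))
    refine Eq.subst (motive := fun y => Tendsto _ atTop (𝓝 y)) ?_ key
    rw [Finset.sum_add_distrib, EuclideanSpace.real_norm_sq_eq, PiLp.inner_apply, Finset.mul_sum,
      Finset.mul_sum, Finset.sum_mul]
    simp [mul_comm]

/-- The energy identity for `(U - k)_+ ^ p`, `p ≥ 2`. -/
lemma IsExtendedSolution.energy_identity_truncPow (h : IsExtendedSolution G U DU) (hk : 0 ≤ k)
    (hp : 2 ≤ p) (hη : ContDiff ℝ 1 η) (hη0 : ∀ x, L < ‖x‖ → η x = 0) {t : ℝ} (ht : 0 ≤ t) :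
    ∫ x, truncPow k p (U (t, x)) * η x ^ 2 =
      ∫ z, (p * truncPow k (p - 1) (U z) * G z * η z.2 ^ 2 -
        (p * (p - 1) * truncPow k (p - 2) (U z) * ‖DU z‖ ^ 2 * η z.2 ^ 2 +
          2 * (p * truncPow k (p - 1) (U z)) * η z.2 * inner ℝ (DU z) (gradient η z.2)))
        ∂cylMeasure d t := by
  set q : ℕ → ℝ := fun n => p + 1 / ((n : ℝ) + 1) with hq
  have hq1 : ∀ n, 2 < q n := fun n => by
    have : (0 : ℝ) < 1 / ((n : ℝ) + 1) := by positivity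
    simp only [hq]; linarith
  have hq2 : ∀ n, q n ≤ p + 1 := fun n => by
    have : (1 : ℝ) / ((n : ℝ) + 1) ≤ 1 := by
      apply div_le_self (by norm_num); linarith [(Nat.cast_nonneg n : (0 : ℝ) ≤ n)]
    simp only [hq]; linarith
  have hqlim : Tendsto q atTop (𝓝 p) := by
    simpa only [add_zero] using tendsto_one_div_add_atTop_nhds_zero_nat.const_add p
  have hid := fun n => h.energy_identity (Φ := truncPow k (q n))
    (Φ' := fun r => q n * truncPow k (q n - 1) r)
    (Φ'' := fun r => q n * ((q n - 1) * truncPow k (q n - 2) r))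
    (hasDerivAt_truncPow k (by linarith [hq1 n]))
    (fun r => by
      have := (hasDerivAt_truncPow k (s := q n - 1) (by linarith [hq1 n]) r).const_mul (q n)
      rwa [show q n - 1 - 1 = q n - 2 by ring] at this)
    (continuous_const.mul (continuous_const.mul (continuous_truncPow k (by linarith [hq1 n]))))
    (truncPow_of_le hk) hη hη0 ht
  have hηc : Continuous fun z : ℝ × EuclideanSpace ℝ (Fin d) => η z.2 :=
    hη.continuous.comp continuous_snd
  have hDηc : Continuous fun z : ℝ × EuclideanSpace ℝ (Fin d) => gradient η z.2 :=
    (continuous_gradient_of_contDiff hη).comp continuous_snd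
  have hS := isCompact_closedCylinder (d := d) t L
  obtain ⟨MU, hMU⟩ := hS.exists_bound_of_continuousOn h.continuous.continuousOn
  obtain ⟨MG, hMG⟩ := hS.exists_bound_of_continuousOn h.continuous_source.continuousOn
  obtain ⟨MD, hMD⟩ := hS.exists_bound_of_continuousOn h.continuous_grad.continuousOn
  obtain ⟨Mη, hMη⟩ := hS.exists_bound_of_continuousOn hηc.continuousOn
  obtain ⟨Mg, hMg⟩ := hS.exists_bound_of_continuousOn hDηc.continuousOn
  set P := (1 + MU + |k|) ^ (p + 1)
  have hP0 : ∀ n (σ : ℝ), 0 ≤ σ → σ ≤ 2 → ∀ z ∈ closedCylinder d t L,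
      truncPow k (q n - σ) (U z) ≤ P := fun n σ h1 h2 z hz =>
    truncPow_le (by linarith [hq1 n]) (by linarith [hq2 n]) (hMU z hz)
  have htr : ∀ (σ : ℝ) z, Tendsto (fun n => truncPow k (q n - σ) (U z)) atTop
      (𝓝 (truncPow k (p - σ) (U z))) := fun σ z => tendsto_truncPow k _ (hqlim.sub_const σ)
  have hL : Tendsto (fun n => ∫ x, truncPow k (q n) (U (t, x)) * η x ^ 2) atTop
      (𝓝 (∫ x, truncPow k p (U (t, x)) * η x ^ 2)) := by
    refine tendsto_integral_slice (L := L) (C := P * Mη ^ 2)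
      (fun n => (((continuous_truncPow k (by linarith [hq1 n])).comp
        (h.continuous.comp (by fun_prop))).mul (hη.continuous.pow 2)).aestronglyMeasurable)
      (fun n x hx => ?_) (fun n x hx => by rw [hη0 x hx]; simp)
      (fun x => (tendsto_truncPow k _ hqlim).mul_const _)
    have hz : ((t, x) : ℝ × EuclideanSpace ℝ (Fin d)) ∈ closedCylinder d t L :=
      ⟨⟨ht, le_rfl⟩, by simpa using hx⟩
    have e1 := hP0 n 0 le_rfl (by norm_num) _ hz
    rw [sub_zero] at e1
    have e2 : |η x| ≤ Mη := hMη _ hz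
    have e3 := truncPow_nonneg k (q n) (U (t, x))
    have e4 := e3.trans e1
    rw [abs_mul, abs_pow, abs_of_nonneg e3]
    gcongr
  refine tendsto_nhds_unique hL ?_
  simp only [hid]
  have hU := h.continuous
  have hG := h.continuous_source
  have hDU := h.continuous_grad
  refine tendsto_integral_cylinder_one (L := L)
    (C := (p + 1) * P * MG * Mη ^ 2 + ((p + 1) * ((p + 1) * P) * MD ^ 2 * Mη ^ 2 +
      2 * ((p + 1) * P) * Mη * (MD * Mg)))
    (fun n => Continuous.aestronglyMeasurable ?_) (fun n z h1 h2 => ?_)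
    (fun n z hz => by rw [hη0 _ hz]; simp) (fun z _ => ?_)
  · have c1 := (continuous_truncPow k (s := q n - 1) (by linarith [hq1 n])).comp hU
    have c2 := (continuous_truncPow k (s := q n - 2) (by linarith [hq1 n])).comp hU
    have c3 := hDU.inner (𝕜 := ℝ) hDηc
    exact (((continuous_const.mul c1).mul hG).mul (hηc.pow 2)).sub
      ((((continuous_const.mul (continuous_const.mul c2)).mul (hDU.norm.pow 2)).mul
        (hηc.pow 2)).add (((continuous_const.mul (continuous_const.mul c1)).mul hηc).mul c3))
  · have hz := mem_closedCylinder h1 h2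
    have e1 := hP0 n 1 (by norm_num) (by norm_num) z hz
    have e2 := hP0 n 2 (by norm_num) (by norm_num) z hz
    have e1' := truncPow_nonneg k (q n - 1) (U z)
    have e2' := truncPow_nonneg k (q n - 2) (U z)
    have e3 : |G z| ≤ MG := hMG z hz
    have e4 : |η z.2| ≤ Mη := hMη z hz
    have e5 := hMD z hz
    have e6 : |inner ℝ (DU z) (gradient η z.2)| ≤ MD * Mg := by
      refine (abs_real_inner_le_norm _ _).trans ?_
      have := hMg z hz
      have := (norm_nonneg _).trans e5
      gcongr
    have e7 := hq1 n
    have e8 := hq2 n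
    have e9 := (abs_nonneg _).trans e4
    have e10 := e1'.trans e1
    have eq0 : 0 ≤ q n := by linarith
    have eq1 : 0 ≤ q n - 1 := by linarith
    have eq2 : q n - 1 ≤ p + 1 := by linarith
    have eG := (abs_nonneg _).trans e3
    refine (abs_sub _ _).trans (add_le_add ?_ ((abs_add_le _ _).trans (add_le_add ?_ ?_)))
    · rw [abs_mul, abs_mul, abs_mul, abs_pow, abs_of_nonneg e1', abs_of_nonneg eq0]
      gcongr
    · rw [abs_mul, abs_mul, abs_mul, abs_mul, abs_pow, abs_pow, abs_of_nonneg e2',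
        abs_of_nonneg eq0, abs_of_nonneg eq1, abs_norm]
      gcongr
    · rw [abs_mul, abs_mul, abs_mul, abs_mul, abs_two, abs_of_nonneg e1', abs_of_nonneg eq0]
      gcongr
  · have t1 := hqlim.mul (htr 1 z)
    have t2 := hqlim.mul ((hqlim.sub_const 1).mul (htr 2 z))
    have key := ((t1.mul_const (G z)).mul_const (η z.2 ^ 2)).sub
      (((t2.mul_const (‖DU z‖ ^ 2)).mul_const (η z.2 ^ 2)).add
        (((t1.const_mul 2).mul_const (η z.2)).mul_const (inner ℝ (DU z) (gradient η z.2))))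
    convert key using 2
    ring

end EnergyIdentity

/-! ### Grönwall's inequality with an integrable coefficient -/

section Gronwall

open Filter Topology

/-- Grönwall's inequality for an integrable coefficient `a`. The constant depends only on `a`: the
part of `a` above a high level `N` has small integral, and the rest is absorbed by the exponential
weight `exp (4 N t)`. -/
lemma exists_gronwall_const {a : ℝ → ℝ} {T : ℝ} (ha : IntegrableOn a (Ioc 0 T))
    (ha0 : ∀ t ∈ Ioc 0 T, 0 ≤ a t) :
    ∃ C, 1 ≤ C ∧ ∀ (y : ℝ → ℝ) (M R : ℝ), (∀ t ∈ Icc 0 T, 0 ≤ y t) → (∀ t ∈ Icc 0 T, y t ≤ M) →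
      (∀ t ∈ Icc 0 T, y t ≤ R + ∫ s in Ioc 0 t, a s * y s) → ∀ t ∈ Icc 0 T, y t ≤ C * R := by
  have hlim : Tendsto (fun n : ℕ => ∫ s in Ioc 0 T, (a s - min (a s) n)) atTop
      (𝓝 (∫ s in Ioc 0 T, (0 : ℝ))) := by
    refine tendsto_integral_of_dominated_convergence a (fun n => ?_) ha (fun n => ?_) ?_
    · exact ha.aestronglyMeasurable.sub (ha.aestronglyMeasurable.inf aestronglyMeasurable_const)
    · filter_upwards [ae_restrict_mem measurableSet_Ioc] with s hs
      have h1 : 0 ≤ min (a s) n := le_min (ha0 s hs) (Nat.cast_nonneg n)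
      rw [Real.norm_of_nonneg (sub_nonneg.2 (min_le_left _ _))]
      linarith
    · refine Eventually.of_forall fun s => tendsto_const_nhds.congr' ?_
      obtain ⟨N, hN⟩ := exists_nat_ge (a s)
      filter_upwards [eventually_ge_atTop N] with n hn
      rw [min_eq_left (hN.trans (by exact_mod_cast hn)), sub_self]
  rw [integral_zero] at hlim
  obtain ⟨N, hN, hN1⟩ := ((hlim.eventually (gt_mem_nhds (show (0 : ℝ) < 1 / 4 by norm_num))).and
    (eventually_ge_atTop 1)).exists
  have hN1' : (1 : ℝ) ≤ N := by exact_mod_cast hN1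
  set l : ℝ := 4 * N with hl
  have hl0 : 0 < l := by linarith
  refine ⟨2 * Real.exp (l * |T|), ?_, fun y M R hy0 hyM hy => ?_⟩
  · have : 1 ≤ Real.exp (l * |T|) := Real.one_le_exp (by positivity)
    linarith
  set w : ℝ → ℝ := fun t => Real.exp (-(l * t)) * y t with hw
  have hbdd : BddAbove (w '' Icc 0 T) := by
    refine ⟨|M|, ?_⟩
    rintro _ ⟨t, ht, rfl⟩
    have h1 : Real.exp (-(l * t)) ≤ 1 := Real.exp_le_one_iff.2 (by nlinarith [ht.1])
    calc w t ≤ 1 * y t := mul_le_mul_of_nonneg_right h1 (hy0 t ht)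
      _ ≤ |M| := by rw [one_mul]; exact (hyM t ht).trans (le_abs_self M)
  intro t0 ht0
  set S := sSup (w '' Icc 0 T)
  have hwS : ∀ t ∈ Icc 0 T, w t ≤ S := fun t ht => le_csSup hbdd ⟨t, ht, rfl⟩
  have hS0 : 0 ≤ S := (mul_nonneg (Real.exp_pos _).le (hy0 t0 ht0)).trans (hwS t0 ht0)
  have hyS : ∀ t ∈ Icc 0 T, y t ≤ S * Real.exp (l * t) := fun t ht => by
    have h1 := hwS t ht
    simp only [hw, Real.exp_neg] at h1
    rwa [inv_mul_le_iff₀ (Real.exp_pos _), mul_comm] at h1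
  have key : ∀ t ∈ Icc 0 T, w t ≤ R + S / 2 := fun t ht => by
    have hsub : Ioc 0 t ⊆ Ioc 0 T := Ioc_subset_Ioc_right ht.2
    have hmin : IntegrableOn (fun s => a s - min (a s) N) (Ioc 0 T) := by
      refine ha.mono' (ha.aestronglyMeasurable.sub
        (ha.aestronglyMeasurable.inf aestronglyMeasurable_const)) ?_
      filter_upwards [ae_restrict_mem measurableSet_Ioc] with s hs
      have h1 : 0 ≤ min (a s) N := le_min (ha0 s hs) (Nat.cast_nonneg N)
      rw [Real.norm_of_nonneg (sub_nonneg.2 (min_le_left _ _))]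
      linarith
    have hexp : IntegrableOn (fun s => (N : ℝ) * (S * Real.exp (l * s))) (Ioc 0 t) :=
      (Continuous.integrableOn_Icc (by fun_prop)).mono_set Ioc_subset_Icc_self
    have hint : ∫ s in Ioc 0 t, a s * y s ≤ ∫ s in Ioc 0 t, ((N : ℝ) * (S * Real.exp (l * s)) +
        (a s - min (a s) N) * (S * Real.exp (l * t))) := by
      refine integral_mono_of_nonneg ?_ (hexp.add ((hmin.mono_set hsub).mul_const _)) ?_
      · filter_upwards [ae_restrict_mem measurableSet_Ioc] with s hs
        exact mul_nonneg (ha0 s (hsub hs)) (hy0 s (Ioc_subset_Icc_self (hsub hs)))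
      · filter_upwards [ae_restrict_mem measurableSet_Ioc] with s hs
        have h1 := hyS s (Ioc_subset_Icc_self (hsub hs))
        have h2 : S * Real.exp (l * s) ≤ S * Real.exp (l * t) :=
          mul_le_mul_of_nonneg_left (Real.exp_le_exp.2 (by nlinarith [hs.2])) hS0
        have h3 : min (a s) N ≤ N := min_le_right _ _
        have h4 : min (a s) N ≤ a s := min_le_left _ _
        have h5 : 0 ≤ S * Real.exp (l * s) := by positivity
        calc a s * y s ≤ a s * (S * Real.exp (l * s)) :=
              mul_le_mul_of_nonneg_left h1 (ha0 s (hsub hs))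
          _ = min (a s) N * (S * Real.exp (l * s)) +
              (a s - min (a s) N) * (S * Real.exp (l * s)) := by ring
          _ ≤ _ := by
            refine add_le_add (mul_le_mul_of_nonneg_right h3 h5)
              (mul_le_mul_of_nonneg_left h2 (by linarith))
    have hE : ∫ s in Ioc 0 t, (N : ℝ) * (S * Real.exp (l * s)) ≤ S * Real.exp (l * t) / 4 := by
      rw [← intervalIntegral.integral_of_le ht.1]
      have h1 : ∀ s ∈ uIcc 0 t, HasDerivAt (fun s => S * Real.exp (l * s) / 4)
          ((N : ℝ) * (S * Real.exp (l * s))) s := fun s _ => by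
        have h2 := ((((hasDerivAt_id s).const_mul l).exp).const_mul S).div_const 4
        refine h2.congr_deriv ?_
        simp only [id, mul_one, hl]; ring
      rw [intervalIntegral.integral_eq_sub_of_hasDerivAt h1
        (Continuous.intervalIntegrable (by fun_prop) _ _)]
      have : 0 ≤ S * Real.exp (l * 0) / 4 := by positivity
      linarith
    have hF : ∫ s in Ioc 0 t, (a s - min (a s) N) * (S * Real.exp (l * t)) ≤
        S * Real.exp (l * t) / 4 := by
      rw [integral_mul_const]
      have h1 : ∫ s in Ioc 0 t, (a s - min (a s) N) ≤ ∫ s in Ioc 0 T, (a s - min (a s) N) :=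
        setIntegral_mono_set hmin
          (Eventually.of_forall fun s => sub_nonneg.2 (min_le_left _ _))
          (Eventually.of_forall hsub)
      have h2 : 0 ≤ S * Real.exp (l * t) := by positivity
      nlinarith
    rw [integral_add hexp ((hmin.mono_set hsub).mul_const _)] at hint
    have h1 : y t ≤ R + S * Real.exp (l * t) / 2 := by linarith [hy t ht]
    have hR0 : 0 ≤ R := by
      have := hy 0 ⟨le_rfl, ht.1.trans ht.2⟩
      simp only [lt_self_iff_false, not_false_eq_true, Ioc_eq_empty, setIntegral_empty,
        add_zero] at this
      exact (hy0 0 ⟨le_rfl, ht.1.trans ht.2⟩).trans this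
    have h2 : Real.exp (-(l * t)) ≤ 1 := Real.exp_le_one_iff.2 (by nlinarith [ht.1])
    calc w t ≤ Real.exp (-(l * t)) * (R + S * Real.exp (l * t) / 2) :=
          mul_le_mul_of_nonneg_left h1 (Real.exp_pos _).le
      _ = Real.exp (-(l * t)) * R + S / 2 * (Real.exp (-(l * t)) * Real.exp (l * t)) := by ring
      _ ≤ R + S / 2 := by
        rw [← Real.exp_add, neg_add_cancel, Real.exp_zero, mul_one]
        nlinarith
  have hSR : S ≤ 2 * R := by
    have : S ≤ R + S / 2 := csSup_le ⟨_, t0, ht0, rfl⟩ (by rintro _ ⟨t, ht, rfl⟩; exact key t ht)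
    linarith
  calc y t0 ≤ S * Real.exp (l * t0) := hyS t0 ht0
    _ ≤ (2 * R) * Real.exp (l * |T|) := by
      refine mul_le_mul hSR (Real.exp_le_exp.2 ?_) (Real.exp_pos _).le (hS0.trans hSR)
      exact mul_le_mul_of_nonneg_left (ht0.2.trans (le_abs_self T)) hl0.le
    _ = _ := by ring

end Gronwall

/-! ### The energy inequality -/

section EnergyInequality

open Filter Topology

variable {d : ℕ} {U : ℝ × EuclideanSpace ℝ (Fin d) → ℝ}
  {DU : ℝ × EuclideanSpace ℝ (Fin d) → EuclideanSpace ℝ (Fin d)}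
  {η : EuclideanSpace ℝ (Fin d) → ℝ} {L k p : ℝ}

/-- The gradient part of the energy, `∫∫ (U - k)_+ ^ (p - 2) |∇U|² η²`. -/
noncomputable def gradEnergy (k p : ℝ) (U : ℝ × EuclideanSpace ℝ (Fin d) → ℝ)
    (DU : ℝ × EuclideanSpace ℝ (Fin d) → EuclideanSpace ℝ (Fin d))
    (η : EuclideanSpace ℝ (Fin d) → ℝ) (t : ℝ) : ℝ :=
  ∫ z, truncPow k (p - 2) (U z) * (‖DU z‖ ^ 2 * η z.2 ^ 2) ∂cylMeasure d t

/-- The error `∫∫ (U - k)_+ ^ p |∇η|²` due to the cutoff function `η`. -/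
noncomputable def cutoffError (k p : ℝ) (U : ℝ × EuclideanSpace ℝ (Fin d) → ℝ)
    (η : EuclideanSpace ℝ (Fin d) → ℝ) (t : ℝ) : ℝ :=
  ∫ z, truncPow k p (U z) * ‖gradient η z.2‖ ^ 2 ∂cylMeasure d t

/-- The integral `∫∫ a (U - k)_+ ^ p η²` with a coefficient `a` depending on time. -/
noncomputable def weightedMass (a : ℝ → ℝ) (k p : ℝ) (U : ℝ × EuclideanSpace ℝ (Fin d) → ℝ)
    (η : EuclideanSpace ℝ (Fin d) → ℝ) (t : ℝ) : ℝ :=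
  ∫ z, a z.1 * (truncPow k p (U z) * η z.2 ^ 2) ∂cylMeasure d t

/-- The contribution of the right-hand side `|h| f` on the set `{U > k}`. -/
noncomputable def sourceTerm (k p : ℝ) (h : ℝ → EuclideanSpace ℝ (Fin d) → EuclideanSpace ℝ (Fin d))
    (f U : ℝ × EuclideanSpace ℝ (Fin d) → ℝ) (η : EuclideanSpace ℝ (Fin d) → ℝ) (t : ℝ) : ℝ :=
  ∫ z, truncWeight p (h z.1 z.2) * |f z| ^ p * (truncPow k 0 (U z) * η z.2 ^ 2) ∂cylMeasure d t

lemma integrable_weight_truncPow_mul {a : ℝ → ℝ} {t s : ℝ} (ha : IntegrableOn a (Ioc 0 t))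
    (hU : Continuous U) (hs : 0 ≤ s) {F : ℝ × EuclideanSpace ℝ (Fin d) → ℝ} (hF : Continuous F)
    (h0 : ∀ z, L < ‖z.2‖ → F z = 0) :
    Integrable (fun z => a z.1 * (truncPow k s (U z) * F z)) (cylMeasure d t) := by
  have hS := isCompact_closedCylinder (d := d) t L
  obtain ⟨MU, hMU⟩ := hS.exists_bound_of_continuousOn hU.continuousOn
  obtain ⟨MF, hMF⟩ := hS.exists_bound_of_continuousOn hF.continuousOn
  refine integrable_cylinder ha (L := L) (C := (1 + MU + |k|) ^ s * MF)
    (((measurable_truncPow k s).comp hU.measurable).mul hF.measurable).aestronglyMeasurable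
    (fun z h1 h2 => ?_) (fun z hz => by rw [h0 z hz, mul_zero])
  have hz := mem_closedCylinder h1 h2
  have e1 := truncPow_le (k := k) hs le_rfl (hMU z hz)
  have e2 : |F z| ≤ MF := hMF z hz
  have e3 := truncPow_nonneg k s (U z)
  have e4 := e3.trans e1
  rw [abs_mul, abs_of_nonneg e3]
  gcongr

lemma integrable_truncPow_mul {t s : ℝ} (hU : Continuous U) (hs : 0 ≤ s)
    {F : ℝ × EuclideanSpace ℝ (Fin d) → ℝ} (hF : Continuous F) (h0 : ∀ z, L < ‖z.2‖ → F z = 0) :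
    Integrable (fun z => truncPow k s (U z) * F z) (cylMeasure d t) := by
  simpa using integrable_weight_truncPow_mul (a := fun _ => 1) (integrableOn_const (by simp)) hU hs
    hF h0 (t := t) (k := k)

lemma truncWeight_nonneg (p : ℝ) (y : EuclideanSpace ℝ (Fin d)) : 0 ≤ truncWeight p y := by
  unfold truncWeight; split_ifs
  · exact zero_le_one
  · positivity

lemma truncWeight_le_one (hp : 0 ≤ p) (y : EuclideanSpace ℝ (Fin d)) : truncWeight p y ≤ 1 := by
  unfold truncWeight; split_ifs with h
  · exact le_rfl
  · exact Real.rpow_le_one (norm_nonneg _) (not_le.1 h).le hp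

lemma measurable_truncWeight (p : ℝ) :
    Measurable (truncWeight p : EuclideanSpace ℝ (Fin d) → ℝ) :=
  Measurable.ite (measurableSet_le measurable_const measurable_norm) measurable_const
    (measurable_norm.pow_const p)

lemma truncPow_zero_le_one (k r : ℝ) : truncPow k 0 r ≤ 1 := by
  unfold truncPow; split_ifs <;> simp

lemma integrable_sourceTerm {h : ℝ → EuclideanSpace ℝ (Fin d) → EuclideanSpace ℝ (Fin d)}
    {f : ℝ × EuclideanSpace ℝ (Fin d) → ℝ} (hh : Continuous (Function.uncurry h))
    (hf : Continuous f) (hU : Continuous U) (hp : 0 ≤ p) (hη : Continuous η)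
    (hη0 : ∀ x, L < ‖x‖ → η x = 0) (t : ℝ) :
    Integrable (fun z => truncWeight p (h z.1 z.2) * |f z| ^ p *
      (truncPow k 0 (U z) * η z.2 ^ 2)) (cylMeasure d t) := by
  have hS := isCompact_closedCylinder (d := d) t L
  have hfp : Continuous fun z => |f z| ^ p := hf.abs.rpow_const fun _ => Or.inr hp
  have hηc : Continuous fun z : ℝ × EuclideanSpace ℝ (Fin d) => η z.2 := hη.comp continuous_snd
  obtain ⟨Mf, hMf⟩ := hS.exists_bound_of_continuousOn hfp.continuousOn
  obtain ⟨Mη, hMη⟩ := hS.exists_bound_of_continuousOn hηc.continuousOn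
  have hw : Measurable fun z : ℝ × EuclideanSpace ℝ (Fin d) => truncWeight p (h z.1 z.2) :=
    (measurable_truncWeight p).comp hh.measurable
  refine integrable_cylinder_one (L := L) (C := 1 * Mf * (1 * Mη ^ 2))
    ((hw.mul hfp.measurable).mul (((measurable_truncPow k 0).comp hU.measurable).mul
      (hηc.pow 2).measurable)).aestronglyMeasurable (fun z h1 h2 => ?_)
    (fun z hz => by rw [hη0 _ hz]; simp)
  have hz := mem_closedCylinder h1 h2
  have e1 : |(|f z| ^ p)| ≤ Mf := hMf z hz
  have e2 : |η z.2| ≤ Mη := hMη z hz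
  have e3 := truncPow_nonneg k 0 (U z)
  have e4 := truncPow_zero_le_one k (U z)
  have e5 := truncWeight_nonneg p (h z.1 z.2)
  have e6 := truncWeight_le_one hp (h z.1 z.2)
  have e7 := (abs_nonneg _).trans e1
  rw [abs_mul, abs_mul, abs_mul, abs_pow, abs_of_nonneg e3, abs_of_nonneg e5]
  gcongr

/-- The form bound for `(U - k)_+ ^ (p / 2) η`, with the square of the gradient expanded. -/
lemma IsFormBounded.bound_energy {δ : ℝ} {g : ℝ → ℝ}
    {b : ℝ → EuclideanSpace ℝ (Fin d) → EuclideanSpace ℝ (Fin d)} (hb : IsFormBounded δ g b)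
    (hbc : Continuous (Function.uncurry b)) (hU : Continuous U) (hDU : Continuous DU)
    (hgrad : ∀ t x, HasGradientAt (fun y => U (t, y)) (DU (t, x)) x)
    (h0 : ∀ z, z.1 ≤ 0 → U z = 0) (hη : ContDiff ℝ 1 η) (hη0 : ∀ x, L < ‖x‖ → η x = 0)
    (hk : 0 ≤ k) (hp : 2 ≤ p) (t : ℝ) {ε : ℝ} (hε : 0 < ε) :
    ∫ z, truncPow k p (U z) * (‖b z.1 z.2‖ ^ 2 * η z.2 ^ 2) ∂cylMeasure d t ≤
      δ * ((1 + ε) * (p ^ 2 / 4) * gradEnergy k p U DU η t +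
        (1 + 1 / ε) * cutoffError k p U η t) + weightedMass g k p U η t := by
  have hηc : Continuous fun z : ℝ × EuclideanSpace ℝ (Fin d) => η z.2 :=
    hη.continuous.comp continuous_snd
  have hDηc : Continuous fun z : ℝ × EuclideanSpace ℝ (Fin d) => gradient η z.2 :=
    (continuous_gradient_of_contDiff hη).comp continuous_snd
  have hDη0 := fun x => gradient_eq_zero_of_forall hη0 (x := x)
  have h := hb.bound_truncPow hbc hU hDU hgrad h0 hη hη0 hk hp t
  have hID : Integrable (fun z => truncPow k (p - 2) (U z) * (‖DU z‖ ^ 2 * η z.2 ^ 2))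
      (cylMeasure d t) :=
    integrable_truncPow_mul (L := L) hU (by linarith) ((hDU.norm.pow 2).mul (hηc.pow 2))
      fun z hz => by rw [hη0 _ hz]; simp
  have hIN : Integrable (fun z => truncPow k p (U z) * ‖gradient η z.2‖ ^ 2) (cylMeasure d t) :=
    integrable_truncPow_mul (L := L) hU (by linarith) (hDηc.norm.pow 2)
      fun z hz => by rw [hDη0 _ hz]; simp
  have hle : ∫ z, ‖(p / 2 * truncPow k (p / 2 - 1) (U z) * η z.2) • DU z +
        truncPow k (p / 2) (U z) • gradient η z.2‖ ^ 2 ∂cylMeasure d t ≤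
      (1 + ε) * (p ^ 2 / 4) * gradEnergy k p U DU η t + (1 + 1 / ε) * cutoffError k p U η t := by
    rw [gradEnergy, cutoffError, ← integral_const_mul, ← integral_const_mul,
      ← integral_add (hID.const_mul _) (hIN.const_mul _)]
    refine integral_mono_of_nonneg (Eventually.of_forall fun z => by positivity)
      ((hID.const_mul _).add (hIN.const_mul _)) (Eventually.of_forall fun z => ?_)
    simp only
    have e1 : truncPow k (p - 2) (U z) = truncPow k (p / 2 - 1) (U z) ^ 2 := by
      rw [truncPow_sq]; congr 1; ring
    have e2 : truncPow k p (U z) = truncPow k (p / 2) (U z) ^ 2 := by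
      rw [truncPow_sq]; congr 1; ring
    rw [e1, e2]
    set X := p / 2 * truncPow k (p / 2 - 1) (U z) * η z.2 with hX
    set W := truncPow k (p / 2) (U z)
    have e3 : ‖X • DU z + W • gradient η z.2‖ ≤ |X| * ‖DU z‖ + |W| * ‖gradient η z.2‖ := by
      refine (norm_add_le _ _).trans ?_
      rw [norm_smul, norm_smul, Real.norm_eq_abs, Real.norm_eq_abs]
    set A := |X| * ‖DU z‖ with hA
    set B := |W| * ‖gradient η z.2‖ with hB
    have e4 : (A + B) ^ 2 ≤ (1 + ε) * A ^ 2 + (1 + 1 / ε) * B ^ 2 := by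
      have : (1 + ε) * A ^ 2 + (1 + 1 / ε) * B ^ 2 - (A + B) ^ 2 = 1 / ε * (ε * A - B) ^ 2 := by
        field_simp; ring
      have : 0 ≤ 1 / ε * (ε * A - B) ^ 2 := by positivity
      linarith
    refine (pow_le_pow_left₀ (norm_nonneg _) e3 2).trans (e4.trans (le_of_eq ?_))
    rw [hA, hB, mul_pow, mul_pow, sq_abs, sq_abs, hX]
    ring
  have hδ := hb.pos.le
  calc ∫ z, truncPow k p (U z) * (‖b z.1 z.2‖ ^ 2 * η z.2 ^ 2) ∂cylMeasure d t
      = ∫ z, ‖b z.1 z.2‖ ^ 2 * (truncPow k p (U z) * η z.2 ^ 2) ∂cylMeasure d t := by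
        simp only [mul_left_comm]
    _ ≤ _ := h.trans (add_le_add_left (mul_le_mul_of_nonneg_left hle hδ) _)

/-- The source term is absorbed, up to the weight, by `H ^ 2 (r - k)_+ ^ p`. For `H ≥ 1` this
uses `H ≤ H ^ (2 (p - 1) / p)`, that is, `p ≥ 2`. -/
lemma truncPow_source_le {H F ε r w : ℝ} (hH : 0 ≤ H) (hF : 0 ≤ F) (hε : 0 < ε) (hp : 2 ≤ p)
    (hw : w = if 1 ≤ H then 1 else H ^ p) :
    truncPow k (p - 1) r * (H * F) ≤ ε * (truncPow k p r * H ^ 2) + truncPow k p r +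
      (ε ^ (1 - p) + 1) * (w * F ^ p * truncPow k 0 r) := by
  have young : ∀ a F e : ℝ, 0 ≤ a → 0 ≤ F → 0 < e →
      a ^ (p - 1) * F ≤ e * a ^ p + e ^ (1 - p) * F ^ p := by
    intro a F e ha hF he
    have hmul : ∀ x : ℝ, 0 ≤ x → x ^ (p - 1) * x = x ^ p := fun x hx => by
      rw [← Real.rpow_add_one' hx (by linarith)]; congr 1; ring
    by_cases hc : F ≤ e * a
    · have h1 : a ^ (p - 1) * F ≤ a ^ (p - 1) * (e * a) := by gcongr
      have h2 : 0 ≤ e ^ (1 - p) * F ^ p := by positivity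
      have h3 := hmul a ha
      nlinarith
    · have h1 : a ≤ F / e := by rw [le_div_iff₀ he]; linarith
      have h2 : a ^ (p - 1) * F ≤ (F / e) ^ (p - 1) * F := by
        gcongr; linarith
      have h3 : (F / e) ^ (p - 1) * F = e ^ (1 - p) * F ^ p := by
        rw [Real.div_rpow hF he.le, ← hmul F hF, show 1 - p = -(p - 1) by ring,
          Real.rpow_neg he.le]
        field_simp
      have h4 : 0 ≤ e * a ^ p := by positivity
      linarith
  unfold truncPow
  split_ifs with hr
  · have hv : 0 < r - k := sub_pos.2 hr
    rw [Real.rpow_zero, mul_one]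
    have hvp : 0 ≤ (r - k) ^ p := by positivity
    have hFp : 0 ≤ F ^ p := by positivity
    by_cases h1 : 1 ≤ H
    · rw [if_pos h1] at hw
      have h2 := young (H ^ (2 / p) * (r - k)) F ε (by positivity) hF hε
      rw [Real.mul_rpow (by positivity) hv.le, Real.mul_rpow (by positivity) hv.le,
        ← Real.rpow_mul hH, ← Real.rpow_mul hH, div_mul_cancel₀ _ (by linarith : p ≠ 0),
        Real.rpow_two] at h2
      have h3 : H ≤ H ^ (2 / p * (p - 1)) := by
        conv_lhs => rw [← Real.rpow_one H]
        refine Real.rpow_le_rpow_of_exponent_le h1 ?_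
        rw [div_mul_eq_mul_div, le_div_iff₀ (by linarith)]; linarith
      have h4 : (r - k) ^ (p - 1) * (H * F) ≤ H ^ (2 / p * (p - 1)) * (r - k) ^ (p - 1) * F := by
        have : 0 ≤ (r - k) ^ (p - 1) := by positivity
        calc (r - k) ^ (p - 1) * (H * F) ≤
            (r - k) ^ (p - 1) * (H ^ (2 / p * (p - 1)) * F) := by gcongr
          _ = _ := by ring
      rw [hw]
      nlinarith
    · rw [if_neg h1] at hw
      have h2 := young (r - k) (H * F) 1 hv.le (by positivity) one_pos
      rw [Real.one_rpow, one_mul, one_mul, Real.mul_rpow hH hF] at h2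
      have h3 : 0 ≤ ε * ((r - k) ^ p * H ^ 2) := by positivity
      have h4 : 0 ≤ ε ^ (1 - p) * (H ^ p * F ^ p) := by positivity
      rw [hw]
      nlinarith
  · simp

/-- The pointwise form of the energy inequality: Young's inequality for the drift, the cutoff and
the source. Here `X ^ 2` and `W ^ 2` stand for the truncated powers of exponents `p - 2` and `p`. -/
lemma energy_integrand_le {X W S e n D B H F Q β γ μ ε ε' C₁ : ℝ} (hp : 0 ≤ p) (hX : 0 ≤ X)
    (hW : 0 ≤ W) (hμ : 0 < μ) (hε : 0 < ε)
    (hβ : |β| ≤ B * D) (hγ : |γ| ≤ D * n)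
    (hS : X * W * (H * |F|) ≤ ε' * (W ^ 2 * H ^ 2) + W ^ 2 + C₁ * (Q * S)) (hH : 0 ≤ H) :
    p * (X * W) * (H * F - β) * e ^ 2 -
        (p * (p - 1) * X ^ 2 * D ^ 2 * e ^ 2 + 2 * (p * (X * W)) * e * γ) ≤
      p * ε' * (W ^ 2 * (H ^ 2 * e ^ 2)) + p * (W ^ 2 * e ^ 2) + p * C₁ * (Q * (S * e ^ 2)) +
        p * μ / 2 * (W ^ 2 * (B ^ 2 * e ^ 2)) + p / ε * (W ^ 2 * n ^ 2) +
        (p / (2 * μ) + p * ε - p * (p - 1)) * (X ^ 2 * (D ^ 2 * e ^ 2)) := by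
  have hXW : 0 ≤ X * W := mul_nonneg hX hW
  have h1 : X * W * (H * F) * e ^ 2 ≤ (ε' * (W ^ 2 * H ^ 2) + W ^ 2 + C₁ * (Q * S)) * e ^ 2 := by
    refine mul_le_mul_of_nonneg_right (le_trans ?_ hS) (sq_nonneg e)
    exact mul_le_mul_of_nonneg_left (mul_le_mul_of_nonneg_left (le_abs_self F) hH) hXW
  have h2 : -(X * W * β * e ^ 2) ≤
      μ / 2 * (W ^ 2 * (B ^ 2 * e ^ 2)) + 1 / (2 * μ) * (X ^ 2 * (D ^ 2 * e ^ 2)) := by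
    have e1 : -(X * W * β * e ^ 2) ≤ X * W * (B * D) * e ^ 2 := by
      have := mul_le_mul_of_nonneg_left ((neg_le_abs β).trans hβ)
        (mul_nonneg hXW (sq_nonneg e))
      linarith
    have e2 : μ / 2 * (W ^ 2 * (B ^ 2 * e ^ 2)) + 1 / (2 * μ) * (X ^ 2 * (D ^ 2 * e ^ 2)) -
        X * W * (B * D) * e ^ 2 = 1 / (2 * μ) * (μ * (W * B * e) - X * D * e) ^ 2 := by
      field_simp; ring
    have e3 : 0 ≤ 1 / (2 * μ) * (μ * (W * B * e) - X * D * e) ^ 2 := by positivity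
    linarith
  have h3 : -(2 * (X * W) * e * γ) ≤ ε * (X ^ 2 * (D ^ 2 * e ^ 2)) + 1 / ε * (W ^ 2 * n ^ 2) := by
    have e1 : -(2 * (X * W) * e * γ) ≤ 2 * (X * W) * (|e| * (D * n)) := by
      have e0 : -(e * γ) ≤ |e| * (D * n) := by
        refine (neg_le_abs _).trans ?_
        rw [abs_mul]
        exact mul_le_mul_of_nonneg_left hγ (abs_nonneg e)
      have := mul_le_mul_of_nonneg_left e0 hXW
      linarith
    have e2 : ε * (X ^ 2 * (D ^ 2 * |e| ^ 2)) + 1 / ε * (W ^ 2 * n ^ 2) -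
        2 * (X * W) * (|e| * (D * n)) = 1 / ε * (ε * (X * D * |e|) - W * n) ^ 2 := by
      field_simp; ring
    have e3 : 0 ≤ 1 / ε * (ε * (X * D * |e|) - W * n) ^ 2 := by positivity
    rw [sq_abs] at e2
    linarith
  have h4 := mul_le_mul_of_nonneg_left (add_le_add (add_le_add h1 h2) h3) hp
  calc _ = p * (X * W * (H * F) * e ^ 2 + -(X * W * β * e ^ 2) + -(2 * (X * W) * e * γ)) -
        p * (p - 1) * (X ^ 2 * (D ^ 2 * e ^ 2)) := by ring
    _ ≤ _ := by
      refine (sub_le_sub_right h4 _).trans (le_of_eq ?_)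
      field_simp
      ring

lemma gradEnergy_nonneg (k p : ℝ) (U : ℝ × EuclideanSpace ℝ (Fin d) → ℝ)
    (DU : ℝ × EuclideanSpace ℝ (Fin d) → EuclideanSpace ℝ (Fin d))
    (η : EuclideanSpace ℝ (Fin d) → ℝ) (t : ℝ) : 0 ≤ gradEnergy k p U DU η t :=
  integral_nonneg fun _ => mul_nonneg (truncPow_nonneg _ _ _) (by positivity)

lemma cutoffError_nonneg (k p : ℝ) (U : ℝ × EuclideanSpace ℝ (Fin d) → ℝ)
    (η : EuclideanSpace ℝ (Fin d) → ℝ) (t : ℝ) : 0 ≤ cutoffError k p U η t :=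
  integral_nonneg fun _ => mul_nonneg (truncPow_nonneg _ _ _) (by positivity)

lemma sourceTerm_nonneg (k p : ℝ)
    (h : ℝ → EuclideanSpace ℝ (Fin d) → EuclideanSpace ℝ (Fin d))
    (f U : ℝ × EuclideanSpace ℝ (Fin d) → ℝ) (η : EuclideanSpace ℝ (Fin d) → ℝ) (t : ℝ) :
    0 ≤ sourceTerm k p h f U η t :=
  integral_nonneg fun _ => mul_nonneg (mul_nonneg (truncWeight_nonneg _ _) (by positivity))
    (mul_nonneg (truncPow_nonneg _ _ _) (by positivity))

lemma integral_linear_comb_six {α : Type*} [MeasurableSpace α] {μ : Measure α}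
    {f₁ f₂ f₃ f₄ f₅ f₆ : α → ℝ} (h₁ : Integrable f₁ μ) (h₂ : Integrable f₂ μ)
    (h₃ : Integrable f₃ μ) (h₄ : Integrable f₄ μ) (h₅ : Integrable f₅ μ) (h₆ : Integrable f₆ μ)
    {c₁ c₂ c₃ c₄ c₅ c₆ : ℝ} :
    ∫ z, (c₁ * f₁ z + c₂ * f₂ z + c₃ * f₃ z + c₄ * f₄ z + c₅ * f₅ z + c₆ * f₆ z) ∂μ =
      c₁ * ∫ z, f₁ z ∂μ + c₂ * ∫ z, f₂ z ∂μ + c₃ * ∫ z, f₃ z ∂μ + c₄ * ∫ z, f₄ z ∂μ +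
        c₅ * ∫ z, f₅ z ∂μ + c₆ * ∫ z, f₆ z ∂μ := by
  have i₂ : Integrable (fun z => c₁ * f₁ z + c₂ * f₂ z) μ := (h₁.const_mul _).add (h₂.const_mul _)
  have i₃ : Integrable (fun z => c₁ * f₁ z + c₂ * f₂ z + c₃ * f₃ z) μ := i₂.add (h₃.const_mul _)
  have i₄ : Integrable (fun z => c₁ * f₁ z + c₂ * f₂ z + c₃ * f₃ z + c₄ * f₄ z) μ :=
    i₃.add (h₄.const_mul _)
  have i₅ : Integrable (fun z => c₁ * f₁ z + c₂ * f₂ z + c₃ * f₃ z + c₄ * f₄ z + c₅ * f₅ z) μ :=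
    i₄.add (h₅.const_mul _)
  rw [integral_add i₅ (h₆.const_mul _), integral_add i₄ (h₅.const_mul _),
    integral_add i₃ (h₄.const_mul _), integral_add i₂ (h₃.const_mul _),
    integral_add (h₁.const_mul _) (h₂.const_mul _)]
  simp only [integral_const_mul]

/-- The energy inequality. The condition `p > 2 / (2 - √δ)` says that the form bound of the drift
is less than the coercivity constant `4 (p - 1) / p ^ 2` of `-Δ` on `L ^ p`. -/
lemma exists_energy_inequality (d : ℕ) {δ ν p : ℝ} (hδ0 : 0 < δ) (hδ4 : δ < 4) (hν : 0 < ν)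
    (hpδ : 2 / (2 - Real.sqrt δ) < p) (hp : 2 ≤ p) :
    ∃ c C : ℝ, 0 < c ∧ 0 < C ∧
      ∀ (gδ gν : ℝ → ℝ) (b h : ℝ → EuclideanSpace ℝ (Fin d) → EuclideanSpace ℝ (Fin d))
        (f U : ℝ × EuclideanSpace ℝ (Fin d) → ℝ)
        (DU : ℝ × EuclideanSpace ℝ (Fin d) → EuclideanSpace ℝ (Fin d))
        (η : EuclideanSpace ℝ (Fin d) → ℝ) (k L t : ℝ),
        IsFormBounded δ gδ b → Continuous (Function.uncurry b) →
        IsFormBounded ν gν h → Continuous (Function.uncurry h) → Continuous f →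
        IsExtendedSolution (fun z => ‖h z.1 z.2‖ * f z - inner ℝ (b z.1 z.2) (DU z)) U DU →
        ContDiff ℝ 1 η → (∀ x, L < ‖x‖ → η x = 0) → 0 ≤ k → 0 ≤ t →
        (∫ x, truncPow k p (U (t, x)) * η x ^ 2) + c * gradEnergy k p U DU η t ≤
          C * (cutoffError k p U η t + sourceTerm k p h f U η t +
            weightedMass (fun s => 1 + gδ s + gν s) k p U η t) := by
  have hs0 : 0 < Real.sqrt δ := Real.sqrt_pos.2 hδ0
  have hs2 : Real.sqrt δ < 2 := by
    rw [Real.sqrt_lt' (by norm_num)]; linarith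
  set s := Real.sqrt δ
  have hss : s ^ 2 = δ := Real.sq_sqrt hδ0.le
  rw [div_lt_iff₀ (by linarith)] at hpδ
  set κ := p - 1 - p * s / 2 with hκ
  have hκ0 : 0 < κ := by rw [hκ]; linarith
  have hp0 : 0 < p := by linarith
  -- `μ` is optimal for the drift term; `ε` and `ε'` leave half of the coercivity `κ`.
  set μ := 2 / (p * s) with hμ
  have hμ0 : 0 < μ := by positivity
  set ε := κ / 4 / (1 + p * s / 4) with hε
  have hε0 : 0 < ε := by positivity
  set ε' := κ / 4 / (ν * p ^ 2 / 2) with hε'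
  have hε'0 : 0 < ε' := by positivity
  set C₁ := ε' ^ (1 - p) + 1
  set CN := p * ε' * (2 * ν) + p * μ / 2 * (δ * (1 + 1 / ε)) + p / ε with hCN
  set C := CN + p * C₁ + p + p * ε' + p * μ / 2 with hC
  refine ⟨p * κ / 2, C, by positivity, by positivity, ?_⟩
  intro gδ gν b h f U DU η k L t hb hbc hh hhc hf hsol hη hη0 hk ht
  have hU := hsol.continuous
  have hDU := hsol.continuous_grad
  have hηc : Continuous fun z : ℝ × EuclideanSpace ℝ (Fin d) => η z.2 :=
    hη.continuous.comp continuous_snd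
  have hDηc : Continuous fun z : ℝ × EuclideanSpace ℝ (Fin d) => gradient η z.2 :=
    (continuous_gradient_of_contDiff hη).comp continuous_snd
  have hDη0 := fun x => gradient_eq_zero_of_forall hη0 (x := x)
  have hID : Integrable (fun z => truncPow k (p - 2) (U z) * (‖DU z‖ ^ 2 * η z.2 ^ 2))
      (cylMeasure d t) :=
    integrable_truncPow_mul (L := L) hU (by linarith) ((hDU.norm.pow 2).mul (hηc.pow 2))
      fun z hz => by rw [hη0 _ hz]; simp
  have hIN : Integrable (fun z => truncPow k p (U z) * ‖gradient η z.2‖ ^ 2) (cylMeasure d t) :=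
    integrable_truncPow_mul (L := L) hU (by linarith) (hDηc.norm.pow 2)
      fun z hz => by rw [hDη0 _ hz]; simp
  have hIV : Integrable (fun z => truncPow k p (U z) * η z.2 ^ 2) (cylMeasure d t) :=
    integrable_truncPow_mul (L := L) hU (by linarith) (hηc.pow 2)
      fun z hz => by rw [hη0 _ hz]; simp
  have hIb : Integrable (fun z => truncPow k p (U z) * (‖b z.1 z.2‖ ^ 2 * η z.2 ^ 2))
      (cylMeasure d t) :=
    integrable_truncPow_mul (L := L) hU (by linarith) ((hbc.norm.pow 2).mul (hηc.pow 2))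
      fun z hz => by rw [hη0 _ hz]; simp
  have hIh : Integrable (fun z => truncPow k p (U z) * (‖h z.1 z.2‖ ^ 2 * η z.2 ^ 2))
      (cylMeasure d t) :=
    integrable_truncPow_mul (L := L) hU (by linarith) ((hhc.norm.pow 2).mul (hηc.pow 2))
      fun z hz => by rw [hη0 _ hz]; simp
  have hIS := integrable_sourceTerm (k := k) hhc hf hU hp0.le hη.continuous hη0 t
  have hIγ : Integrable (fun z => 2 * p * (truncPow k (p - 1) (U z) *
      (η z.2 * inner ℝ (DU z) (gradient η z.2)))) (cylMeasure d t) :=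
    (integrable_truncPow_mul (L := L) hU (by linarith) (hηc.mul (hDU.inner hDηc))
      fun z hz => by simp [hη0 _ hz]).const_mul _
  have hIG : Integrable (fun z => p * (truncPow k (p - 1) (U z) *
      ((‖h z.1 z.2‖ * f z - inner ℝ (b z.1 z.2) (DU z)) * η z.2 ^ 2))) (cylMeasure d t) :=
    (integrable_truncPow_mul (L := L) hU (by linarith) (hsol.continuous_source.mul (hηc.pow 2))
      fun z hz => by simp [hη0 _ hz]).const_mul _
  have hid := hsol.energy_identity_truncPow hk hp hη hη0 ht
  have hmono : ∫ x, truncPow k p (U (t, x)) * η x ^ 2 ≤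
      ∫ z, (p * ε' * (truncPow k p (U z) * (‖h z.1 z.2‖ ^ 2 * η z.2 ^ 2)) +
        p * (truncPow k p (U z) * η z.2 ^ 2) +
        p * C₁ * (truncWeight p (h z.1 z.2) * |f z| ^ p * (truncPow k 0 (U z) * η z.2 ^ 2)) +
        p * μ / 2 * (truncPow k p (U z) * (‖b z.1 z.2‖ ^ 2 * η z.2 ^ 2)) +
        p / ε * (truncPow k p (U z) * ‖gradient η z.2‖ ^ 2) +
        (p / (2 * μ) + p * ε - p * (p - 1)) *
          (truncPow k (p - 2) (U z) * (‖DU z‖ ^ 2 * η z.2 ^ 2))) ∂cylMeasure d t := by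
    rw [hid]
    refine integral_mono ?_ ((((((hIh.const_mul _).add (hIV.const_mul _)).add
      (hIS.const_mul _)).add (hIb.const_mul _)).add (hIN.const_mul _)).add (hID.const_mul _))
      fun z => ?_
    · refine (hIG.sub ((hID.const_mul (p * (p - 1))).add hIγ)).congr
        (Eventually.of_forall fun z => ?_)
      simp only [Pi.sub_apply, Pi.add_apply]
      ring
    · simp only
      have e1 : truncPow k (p - 2) (U z) = truncPow k (p / 2 - 1) (U z) ^ 2 := by
        rw [truncPow_sq]; congr 1; ring
      have e2 : truncPow k p (U z) = truncPow k (p / 2) (U z) ^ 2 := by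
        rw [truncPow_sq]; congr 1; ring
      have e3 : truncPow k (p - 1) (U z) =
          truncPow k (p / 2 - 1) (U z) * truncPow k (p / 2) (U z) := by
        rw [truncPow_mul]; congr 1; ring
      have hsrc := truncPow_source_le (k := k) (r := U z) (w := truncWeight p (h z.1 z.2))
        (norm_nonneg (h z.1 z.2)) (abs_nonneg (f z)) hε'0 hp rfl
      rw [e1, e2, e3] at *
      exact energy_integrand_le (F := f z) hp0.le (truncPow_nonneg _ _ _) (truncPow_nonneg _ _ _)
        hμ0 hε0 (abs_real_inner_le_norm _ _) (abs_real_inner_le_norm _ _) hsrc (norm_nonneg _)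
  rw [integral_linear_comb_six hIh hIV hIS hIb hIN hID] at hmono
  have hFb := hb.bound_energy hbc hU hDU hsol.hasGradientAt hsol.eq_zero hη hη0 hk hp t hε0
  have hFh := hh.bound_energy hhc hU hDU hsol.hasGradientAt hsol.eq_zero hη hη0 hk hp t one_pos
  have hgI : ∀ g : ℝ → ℝ, IntegrableOn g (Ioc 0 t) →
      Integrable (fun z => g z.1 * (truncPow k p (U z) * η z.2 ^ 2)) (cylMeasure d t) :=
    fun g hg => integrable_weight_truncPow_mul (L := L) hg hU hp0.le (hηc.pow 2)
      fun z hz => by rw [hη0 _ hz]; simp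
  have hmass : weightedMass (fun s => 1 + gδ s + gν s) k p U η t =
      (∫ z, truncPow k p (U z) * η z.2 ^ 2 ∂cylMeasure d t) + weightedMass gδ k p U η t +
        weightedMass gν k p U η t := by
    have i1 := hgI gδ (hb.integrableOn t)
    have i2 := hgI gν (hh.integrableOn t)
    have i3 : Integrable (fun z => truncPow k p (U z) * η z.2 ^ 2 +
        gδ z.1 * (truncPow k p (U z) * η z.2 ^ 2)) (cylMeasure d t) := hIV.add i1
    rw [weightedMass, weightedMass, weightedMass, ← integral_add hIV i1, ← integral_add i3 i2]
    exact integral_congr_ae (Eventually.of_forall fun z => by simp only; ring)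
  have hmass_nonneg : ∀ g : ℝ → ℝ, (∀ s, 0 ≤ s → 0 ≤ g s) → 0 ≤ weightedMass g k p U η t := by
    intro g hg
    refine integral_nonneg_of_ae ?_
    filter_upwards [ae_cylMeasure_mem] with z hz
    exact mul_nonneg (hg _ hz.1.le) (mul_nonneg (truncPow_nonneg _ _ _) (sq_nonneg _))
  have n2 := cutoffError_nonneg k p U η t
  have n3 := sourceTerm_nonneg k p h f U η t
  have n4 := hmass_nonneg gδ hb.g_nonneg
  have n5 := hmass_nonneg gν hh.g_nonneg
  have n6 : 0 ≤ ∫ z, truncPow k p (U z) * η z.2 ^ 2 ∂cylMeasure d t :=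
    integral_nonneg fun _ => mul_nonneg (truncPow_nonneg _ _ _) (by positivity)
  rw [hmass]
  set IV := ∫ z, truncPow k p (U z) * η z.2 ^ 2 ∂cylMeasure d t
  set ID := gradEnergy k p U DU η t
  set IN := cutoffError k p U η t
  set IS := sourceTerm k p h f U η t
  set Mδ := weightedMass gδ k p U η t
  set Mν := weightedMass gν k p U η t
  rw [show ∫ z, truncWeight p (h z.1 z.2) * |f z| ^ p * (truncPow k 0 (U z) * η z.2 ^ 2)
      ∂cylMeasure d t = IS from rfl,
    show ∫ z, truncPow k p (U z) * ‖gradient η z.2‖ ^ 2 ∂cylMeasure d t = IN from rfl,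
    show ∫ z, truncPow k (p - 2) (U z) * (‖DU z‖ ^ 2 * η z.2 ^ 2) ∂cylMeasure d t = ID from rfl]
    at hmono
  have m1 := mul_le_mul_of_nonneg_left hFh (show 0 ≤ p * ε' by positivity)
  have m2 := mul_le_mul_of_nonneg_left hFb (show 0 ≤ p * μ / 2 by positivity)
  -- The total coefficient of the gradient energy.
  have hcoef : p * ε' * (ν * ((1 + 1) * (p ^ 2 / 4))) +
      p * μ / 2 * (δ * ((1 + ε) * (p ^ 2 / 4))) + (p / (2 * μ) + p * ε - p * (p - 1)) =
      -(p * κ / 2) := by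
    have a1 : ε' * (ν * p ^ 2 / 2) = κ / 4 := by rw [hε']; field_simp
    have a2 : ε * (1 + p * s / 4) = κ / 4 := by rw [hε]; field_simp
    have a3 : μ / 2 * δ * (p ^ 2 / 4) = p * s / 4 := by rw [hμ, ← hss]; field_simp
    have a4 : 1 / (2 * μ) = p * s / 4 := by rw [hμ]; field_simp; norm_num
    have a5 : p / (2 * μ) = p * (1 / (2 * μ)) := by ring
    rw [a5, a4]
    linear_combination p * a1 + p * a2 + p * (1 + ε) * a3 - p * hκ
  have hfin : (∫ x, truncPow k p (U (t, x)) * η x ^ 2) + p * κ / 2 * ID ≤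
      CN * IN + p * C₁ * IS + p * IV + p * ε' * Mν + p * μ / 2 * Mδ := by
    rw [hCN]
    have hcID := congrArg (fun x => x * ID) hcoef
    simp only [div_one] at m1
    linarith
  refine hfin.trans ?_
  have k1 : CN ≤ C := by
    rw [hC]; linarith [show 0 < p * C₁ + p + p * ε' + p * μ / 2 by positivity]
  have k2 : p * C₁ ≤ C := by
    rw [hC]; linarith [show 0 < CN + p + p * ε' + p * μ / 2 by positivity]
  have k3 : p ≤ C := by
    rw [hC]; linarith [show 0 < CN + p * C₁ + p * ε' + p * μ / 2 by positivity]
  have k4 : p * ε' ≤ C := by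
    rw [hC]; linarith [show 0 < CN + p * C₁ + p + p * μ / 2 by positivity]
  have k5 : p * μ / 2 ≤ C := by
    rw [hC]; linarith [show 0 < CN + p * C₁ + p + p * ε' by positivity]
  calc CN * IN + p * C₁ * IS + p * IV + p * ε' * Mν + p * μ / 2 * Mδ ≤
      C * IN + C * IS + C * IV + C * Mν + C * Mδ := by gcongr
    _ = C * (IN + IS + (IV + Mδ + Mν)) := by ring

end EnergyInequality

/-! ### The Sobolev inequality and the gain of integrability -/

section Sobolev

open Filter Topology

variable {d : ℕ} {δ ν p T : ℝ} {gδ gν : ℝ → ℝ}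

/-- The Gagliardo–Nirenberg–Sobolev inequality with Bochner integrals. -/
lemma exists_sobolev_const (hd : 2 ≤ d) :
    ∃ C : ℝ, 0 ≤ C ∧ ∀ w : EuclideanSpace ℝ (Fin d) → ℝ, ContDiff ℝ 1 w → HasCompactSupport w →
      ∫ x, |w x| ^ ((d : ℝ) / (d - 1)) ≤ C * (∫ x, ‖gradient w x‖) ^ ((d : ℝ) / (d - 1)) := by
  have hd1 : (1 : ℝ) < d := by exact_mod_cast hd
  set κ : ℝ := (d : ℝ) / (d - 1)
  have hκ0 : 0 < κ := div_pos (by linarith) (by linarith)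
  have hconj : Real.HolderConjugate
      (Module.finrank ℝ (EuclideanSpace ℝ (Fin d)) : ℝ) κ := by
    rw [finrank_euclideanSpace, Fintype.card_fin]
    exact Real.HolderConjugate.conjExponent hd1
  set C := lintegralPowLePowLIntegralFDerivConst
    (volume : Measure (EuclideanSpace ℝ (Fin d))) κ
  refine ⟨C, C.coe_nonneg, fun w hw hcs => ?_⟩
  have h := lintegral_pow_le_pow_lintegral_fderiv
    (volume : Measure (EuclideanSpace ℝ (Fin d))) hw hcs hconj
  have hgn : ∀ x, ‖gradient w x‖ = ‖fderiv ℝ w x‖ := fun x => by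
    rw [gradient, LinearIsometryEquiv.norm_map]
  have hgi : Integrable fun x => ‖gradient w x‖ := by
    simp only [hgn]
    exact ((hw.continuous_fderiv (by simp)).norm).integrable_of_hasCompactSupport
      (hcs.fderiv ℝ).norm
  have e1 : ∫⁻ x, ‖fderiv ℝ w x‖ₑ = ENNReal.ofReal (∫ x, ‖gradient w x‖) := by
    rw [ofReal_integral_eq_lintegral_ofReal hgi (Eventually.of_forall fun x => norm_nonneg _)]
    refine lintegral_congr fun x => ?_
    rw [hgn, ofReal_norm]
  have hI0 : 0 ≤ ∫ x, ‖gradient w x‖ := integral_nonneg fun _ => norm_nonneg _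
  rw [e1, ENNReal.ofReal_rpow_of_nonneg hI0 hκ0.le] at h
  rw [integral_eq_lintegral_of_nonneg_ae (Eventually.of_forall fun x => by positivity)
    ((hw.continuous.abs.rpow_const fun _ => Or.inr hκ0.le).aestronglyMeasurable)]
  have e2 : ∫⁻ x, ENNReal.ofReal (|w x| ^ κ) = ∫⁻ x, ‖w x‖ₑ ^ κ := lintegral_congr fun x => by
    rw [← ENNReal.ofReal_rpow_of_nonneg (abs_nonneg _) hκ0.le, ← Real.norm_eq_abs,
      ofReal_norm]
  rw [e2]
  have h2 := ENNReal.toReal_mono (ENNReal.mul_ne_top ENNReal.coe_ne_top ENNReal.ofReal_ne_top) h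
  rwa [ENNReal.toReal_mul, ENNReal.toReal_ofReal (by positivity), ENNReal.coe_toReal] at h2

/-- The bound of the energy by the cutoff error and the source term, from the energy inequality and
Grönwall's inequality. -/
lemma exists_energy_bound (d : ℕ) (hδ0 : 0 < δ) (hδ4 : δ < 4) (hν : 0 < ν)
    (hpδ : 2 / (2 - Real.sqrt δ) < p) (hp : 2 ≤ p) (hT : 0 ≤ T)
    (hgδ : IntegrableOn gδ (Ioc 0 T)) (hgν : IntegrableOn gν (Ioc 0 T))
    (hgδ0 : ∀ t, 0 ≤ t → 0 ≤ gδ t) (hgν0 : ∀ t, 0 ≤ t → 0 ≤ gν t) :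
    ∃ C : ℝ, 0 < C ∧
      ∀ (b h : ℝ → EuclideanSpace ℝ (Fin d) → EuclideanSpace ℝ (Fin d))
        (f U : ℝ × EuclideanSpace ℝ (Fin d) → ℝ)
        (DU : ℝ × EuclideanSpace ℝ (Fin d) → EuclideanSpace ℝ (Fin d))
        (η : EuclideanSpace ℝ (Fin d) → ℝ) (k L : ℝ),
        IsFormBounded δ gδ b → Continuous (Function.uncurry b) →
        IsFormBounded ν gν h → Continuous (Function.uncurry h) → Continuous f →
        IsExtendedSolution (fun z => ‖h z.1 z.2‖ * f z - inner ℝ (b z.1 z.2) (DU z)) U DU →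
        ContDiff ℝ 1 η → (∀ x, L < ‖x‖ → η x = 0) → 0 ≤ k →
        (∀ t ∈ Icc 0 T, ∫ x, truncPow k p (U (t, x)) * η x ^ 2 ≤
          C * (cutoffError k p U η T + sourceTerm k p h f U η T)) ∧
        gradEnergy k p U DU η T ≤ C * (cutoffError k p U η T + sourceTerm k p h f U η T) := by
  obtain ⟨c, C, hc, hC, hE⟩ := exists_energy_inequality d hδ0 hδ4 hν hpδ hp
  have hgi : IntegrableOn (fun s => 1 + gδ s + gν s) (Ioc 0 T) :=
    (((integrableOn_const (by simp)).add hgδ).add hgν)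
  obtain ⟨CG, hCG1, hCG⟩ := exists_gronwall_const (a := fun s => C * (1 + gδ s + gν s))
    (T := T) (hgi.const_mul C) fun t ht => by
      have := hgδ0 t ht.1.le
      have := hgν0 t ht.1.le
      positivity
  set I := ∫ s in Ioc 0 T, (1 + gδ s + gν s)
  have hI0 : 0 ≤ I := setIntegral_nonneg measurableSet_Ioc fun s hs => by
    have := hgδ0 s hs.1.le
    have := hgν0 s hs.1.le
    positivity
  refine ⟨CG * C + C / c * (1 + I * (CG * C)), by positivity, ?_⟩
  intro b h f U DU η k L hb hbc hh hhc hf hsol hη hη0 hk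
  have hU := hsol.continuous
  have hp0 : 0 ≤ p := by linarith
  have hηc : Continuous fun z : ℝ × EuclideanSpace ℝ (Fin d) => η z.2 :=
    hη.continuous.comp continuous_snd
  have hDηc : Continuous fun z : ℝ × EuclideanSpace ℝ (Fin d) => gradient η z.2 :=
    (continuous_gradient_of_contDiff hη).comp continuous_snd
  have hDη0 := fun x => gradient_eq_zero_of_forall hη0 (x := x)
  have hIN : Integrable (fun z => truncPow k p (U z) * ‖gradient η z.2‖ ^ 2) (cylMeasure d T) :=
    integrable_truncPow_mul (L := L) hU hp0 (hDηc.norm.pow 2)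
      fun z hz => by rw [hDη0 _ hz]; simp
  have hIS := integrable_sourceTerm (k := k) hhc hf hU hp0 hη.continuous hη0 T
  set R := cutoffError k p U η T + sourceTerm k p h f U η T with hR
  have hR0 : 0 ≤ R := add_nonneg (cutoffError_nonneg _ _ _ _ _) (sourceTerm_nonneg _ _ _ _ _ _ _)
  set y : ℝ → ℝ := fun t => ∫ x, truncPow k p (U (t, x)) * η x ^ 2
  have hy0 : ∀ t, 0 ≤ y t := fun t =>
    integral_nonneg fun x => mul_nonneg (truncPow_nonneg _ _ _) (sq_nonneg _)
  have hmass : ∀ t ∈ Icc 0 T, weightedMass (fun s => 1 + gδ s + gν s) k p U η t =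
      ∫ s in Ioc 0 t, (1 + gδ s + gν s) * y s := fun t ht => by
    rw [weightedMass, ← setIntegral_eq_cylinder (a := fun s => 1 + gδ s + gν s)
      (F := fun z => truncPow k p (U z) * η z.2 ^ 2)
      (integrable_weight_truncPow_mul (L := L) (hgi.mono_set (Ioc_subset_Ioc_right ht.2)) hU hp0
        (hηc.pow 2) fun z hz => by rw [hη0 _ hz]; simp)]
  have hyE : ∀ t ∈ Icc 0 T, y t + c * gradEnergy k p U DU η t ≤
      C * R + ∫ s in Ioc 0 t, C * (1 + gδ s + gν s) * y s := fun t ht => by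
    have h1 := hE gδ gν b h f U DU η k L t hb hbc hh hhc hf hsol hη hη0 hk ht.1
    have h2 : cutoffError k p U η t ≤ cutoffError k p U η T :=
      integral_mono_measure (cylMeasure_mono ht.2) (Eventually.of_forall fun z =>
        mul_nonneg (truncPow_nonneg _ _ _) (sq_nonneg _)) hIN
    have h3 : sourceTerm k p h f U η t ≤ sourceTerm k p h f U η T :=
      integral_mono_measure (cylMeasure_mono ht.2) (Eventually.of_forall fun z =>
        mul_nonneg (mul_nonneg (truncWeight_nonneg _ _) (by positivity))
          (mul_nonneg (truncPow_nonneg _ _ _) (sq_nonneg _))) hIS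
    rw [hmass t ht] at h1
    simp only [mul_assoc C]
    rw [integral_const_mul]
    have h4 : C * (cutoffError k p U η t + sourceTerm k p h f U η t) ≤ C * R := by
      rw [hR]; gcongr
    calc _ ≤ _ := h1
      _ ≤ _ := by rw [mul_add]; linarith
  have hyM : ∃ M, ∀ t ∈ Icc 0 T, y t ≤ M := by
    have hS := isCompact_closedCylinder (d := d) T L
    have hcont : Continuous fun z => truncPow k p (U z) * η z.2 ^ 2 :=
      ((continuous_truncPow k (by linarith)).comp hU).mul (hηc.pow 2)
    obtain ⟨M, hM⟩ := hS.exists_bound_of_continuousOn hcont.continuousOn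
    refine ⟨∫ x, (closedBall (0 : EuclideanSpace ℝ (Fin d)) L).indicator (fun _ => M) x,
      fun t ht => ?_⟩
    refine integral_mono_of_nonneg (Eventually.of_forall fun x =>
      mul_nonneg (truncPow_nonneg _ _ _) (sq_nonneg _))
      ((integrable_indicator_iff measurableSet_closedBall).2
        (integrableOn_const (measure_closedBall_lt_top.ne)))
      (Eventually.of_forall fun x => ?_)
    by_cases hx : ‖x‖ ≤ L
    · rw [indicator_of_mem (by simpa using hx)]
      exact (le_abs_self _).trans (hM (t, x) ⟨ht, by simpa using hx⟩)
    · rw [indicator_of_notMem (by simpa using hx)]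
      simp only
      rw [hη0 x (not_le.1 hx)]; simp
  obtain ⟨M, hM⟩ := hyM
  have hgron := hCG y M (C * R) (fun t _ => hy0 t) hM fun t ht => by
    have h1 := hyE t ht
    have h2 := mul_nonneg hc.le (gradEnergy_nonneg k p U DU η t)
    linarith
  have hTT : T ∈ Icc 0 T := ⟨hT, le_rfl⟩
  have hx0 : 0 ≤ C / c * (1 + I * (CG * C)) := by positivity
  refine ⟨fun t ht => (hgron t ht).trans ?_, ?_⟩
  · rw [add_mul]
    have : 0 ≤ C / c * (1 + I * (CG * C)) * R := mul_nonneg hx0 hR0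
    linarith
  · have h1 := hyE T hTT
    have h2 : ∫ s in Ioc 0 T, C * (1 + gδ s + gν s) * y s ≤
        ∫ s in Ioc 0 T, C * (1 + gδ s + gν s) * (CG * (C * R)) := by
      refine integral_mono_of_nonneg ?_ ((hgi.const_mul C).mul_const _) ?_
      · filter_upwards [ae_restrict_mem measurableSet_Ioc] with s hs
        have := hgδ0 s hs.1.le
        have := hgν0 s hs.1.le
        exact mul_nonneg (by positivity) (hy0 s)
      · filter_upwards [ae_restrict_mem measurableSet_Ioc] with s hs
        have := hgδ0 s hs.1.le
        have := hgν0 s hs.1.le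
        exact mul_le_mul_of_nonneg_left (hgron s (Ioc_subset_Icc_self hs)) (by positivity)
    rw [integral_mul_const, integral_const_mul] at h2
    have h3 : c * gradEnergy k p U DU η T ≤ c * (C / c * (1 + I * (CG * C)) * R) := by
      have e : c * (C / c * (1 + I * (CG * C)) * R) = C * R + C * I * (CG * (C * R)) := by
        field_simp
      rw [e]
      linarith [hy0 T]
    have h4 := le_of_mul_le_mul_left h3 hc
    have h5 : 0 ≤ CG * C * R := by positivity
    rw [add_mul]
    linarith

/-- The Sobolev inequality at a fixed time, applied to `(U - k)_+ ^ p η²`, with the norm of the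
gradient estimated by Young's inequality with parameter `l`. -/
lemma norm_gradient_truncPow_le {v : EuclideanSpace ℝ (Fin d) → ℝ}
    {Dv : EuclideanSpace ℝ (Fin d) → EuclideanSpace ℝ (Fin d)}
    {η : EuclideanSpace ℝ (Fin d) → ℝ} {k l : ℝ} (hv : ∀ x, HasGradientAt v (Dv x) x)
    (hη : ContDiff ℝ 1 η) (hp : 2 ≤ p) (hl : 0 < l) (x : EuclideanSpace ℝ (Fin d)) :
    HasGradientAt (fun x => truncPow k p (v x) * η x ^ 2)
        ((p * truncPow k (p - 1) (v x) * η x ^ 2) • Dv x +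
          (2 * truncPow k p (v x) * η x) • gradient η x) x ∧
      ‖gradient (fun x => truncPow k p (v x) * η x ^ 2) x‖ ≤
        (p / 2 + 1) * (l * (truncPow k p (v x) * η x ^ 2) +
          1 / l * (truncPow k (p - 2) (v x) * (‖Dv x‖ ^ 2 * η x ^ 2) +
            truncPow k p (v x) * ‖gradient η x‖ ^ 2)) := by
  have h1 : HasGradientAt (fun x => truncPow k p (v x) * η x ^ 2)
      ((p * truncPow k (p - 1) (v x) * η x ^ 2) • Dv x +
        (2 * truncPow k p (v x) * η x) • gradient η x) x := by
    have e1 := (hasDerivAt_truncPow k (s := p) (by linarith) (v x)).comp_hasFDerivAt x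
      (hv x).hasFDerivAt
    have e2 : HasGradientAt η (gradient η x) x :=
      (hη.differentiable (by simp)).differentiableAt.hasGradientAt
    rw [hasGradientAt_iff_hasFDerivAt]
    refine (e1.mul (e2.hasFDerivAt.pow 2)).congr_fderiv ?_
    simp only [map_add, map_smul, smul_smul, Function.comp]
    rw [add_comm]
    congr 2
    · ring
    · rw [nsmul_eq_mul, pow_one, Nat.cast_ofNat]; ring
  refine ⟨h1, ?_⟩
  rw [h1.gradient]
  have e1 : truncPow k (p - 2) (v x) = truncPow k (p / 2 - 1) (v x) ^ 2 := by
    rw [truncPow_sq]; congr 1; ring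
  have e2 : truncPow k p (v x) = truncPow k (p / 2) (v x) ^ 2 := by
    rw [truncPow_sq]; congr 1; ring
  have e3 : truncPow k (p - 1) (v x) = truncPow k (p / 2 - 1) (v x) * truncPow k (p / 2) (v x) := by
    rw [truncPow_mul]; congr 1; ring
  rw [e1, e2, e3]
  set X := truncPow k (p / 2 - 1) (v x)
  set W := truncPow k (p / 2) (v x)
  have hX : 0 ≤ X := truncPow_nonneg _ _ _
  have hW : 0 ≤ W := truncPow_nonneg _ _ _
  have hp0 : 0 ≤ p := by linarith
  refine (norm_add_le _ _).trans ?_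
  rw [norm_smul, norm_smul, Real.norm_eq_abs, Real.norm_eq_abs, abs_mul, abs_mul, abs_mul,
    abs_mul, abs_mul, abs_of_nonneg hX, abs_of_nonneg hW, abs_of_nonneg (sq_nonneg W),
    abs_of_nonneg hp0, abs_of_nonneg (sq_nonneg (η x)), abs_two, ← sq_abs (η x)]
  set e := |η x|
  set D := ‖Dv x‖
  set N := ‖gradient η x‖
  have y1 : 2 * (X * D * e) * (W * e) ≤ l * (W * e) ^ 2 + 1 / l * (X * D * e) ^ 2 := by
    have i1 : l * (W * e) ^ 2 + 1 / l * (X * D * e) ^ 2 - 2 * (X * D * e) * (W * e) =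
        1 / l * (l * (W * e) - X * D * e) ^ 2 := by field_simp; ring
    have i2 : 0 ≤ 1 / l * (l * (W * e) - X * D * e) ^ 2 := by positivity
    linarith
  have y2 : 2 * (W * N) * (W * e) ≤ l * (W * e) ^ 2 + 1 / l * (W * N) ^ 2 := by
    have i1 : l * (W * e) ^ 2 + 1 / l * (W * N) ^ 2 - 2 * (W * N) * (W * e) =
        1 / l * (l * (W * e) - W * N) ^ 2 := by field_simp; ring
    have i2 : 0 ≤ 1 / l * (l * (W * e) - W * N) ^ 2 := by positivity
    linarith
  have y3 : 0 ≤ 1 / l * (X * D * e) ^ 2 := by positivity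
  have y4 : 0 ≤ p / 2 * (1 / l * (W * N) ^ 2) := by positivity
  have y5 := mul_le_mul_of_nonneg_left y1 (show 0 ≤ p / 2 by positivity)
  linarith

/-- The gain of integrability: if the cutoff error and the source term are at most `R`, then
`(U - k)_+ ^ p η²` has norm at most `C R` in `L ^ (d / (d - 1))` of space-time. -/
lemma exists_gain_const (d : ℕ) (hd : 2 ≤ d) (hδ0 : 0 < δ) (hδ4 : δ < 4) (hν : 0 < ν)
    (hpδ : 2 / (2 - Real.sqrt δ) < p) (hp : 2 ≤ p) (hT : 0 ≤ T)
    (hgδ : IntegrableOn gδ (Ioc 0 T)) (hgν : IntegrableOn gν (Ioc 0 T))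
    (hgδ0 : ∀ t, 0 ≤ t → 0 ≤ gδ t) (hgν0 : ∀ t, 0 ≤ t → 0 ≤ gν t) :
    ∃ C : ℝ, 0 ≤ C ∧
      ∀ (b h : ℝ → EuclideanSpace ℝ (Fin d) → EuclideanSpace ℝ (Fin d))
        (f U : ℝ × EuclideanSpace ℝ (Fin d) → ℝ)
        (DU : ℝ × EuclideanSpace ℝ (Fin d) → EuclideanSpace ℝ (Fin d))
        (η : EuclideanSpace ℝ (Fin d) → ℝ) (k L R : ℝ),
        IsFormBounded δ gδ b → Continuous (Function.uncurry b) →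
        IsFormBounded ν gν h → Continuous (Function.uncurry h) → Continuous f →
        IsExtendedSolution (fun z => ‖h z.1 z.2‖ * f z - inner ℝ (b z.1 z.2) (DU z)) U DU →
        ContDiff ℝ 1 η → (∀ x, L < ‖x‖ → η x = 0) → 0 ≤ k → 0 < R →
        cutoffError k p U η T + sourceTerm k p h f U η T ≤ R →
        ∫ z, (truncPow k p (U z) * η z.2 ^ 2) ^ ((d : ℝ) / (d - 1)) ∂cylMeasure d T ≤
          C * R ^ ((d : ℝ) / (d - 1)) := by
  obtain ⟨CS, hCS0, hCS⟩ := exists_sobolev_const hd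
  obtain ⟨C₂, hC₂, hE⟩ := exists_energy_bound d hδ0 hδ4 hν hpδ hp hT hgδ hgν hgδ0 hgν0
  have hd2 : (2 : ℝ) ≤ d := by exact_mod_cast hd
  set κ : ℝ := (d : ℝ) / (d - 1) with hκ
  have hκ0 : 0 < κ := div_pos (by linarith) (by linarith)
  have hκ2 : κ ≤ 2 := by rw [hκ, div_le_iff₀ (by linarith)]; linarith
  set C₃ := (p / 2 + 1) * (C₂ + 1) with hC₃
  have hC₃0 : 0 ≤ C₃ := by positivity
  refine ⟨CS * C₃ ^ κ * (C₂ + 1 + T), by positivity, ?_⟩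
  intro b h f U DU η k L R hb hbc hh hhc hf hsol hη hη0 hk hR hle
  have hU := hsol.continuous
  have hDU := hsol.continuous_grad
  have hηc : Continuous fun z : ℝ × EuclideanSpace ℝ (Fin d) => η z.2 :=
    hη.continuous.comp continuous_snd
  have hDηc : Continuous fun z : ℝ × EuclideanSpace ℝ (Fin d) => gradient η z.2 :=
    (continuous_gradient_of_contDiff hη).comp continuous_snd
  have hDη0 := fun x => gradient_eq_zero_of_forall hη0 (x := x)
  obtain ⟨hy, hD⟩ := hE b h f U DU η k L hb hbc hh hhc hf hsol hη hη0 hk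
  have hCR := mul_le_mul_of_nonneg_left hle hC₂.le
  set F : ℝ × EuclideanSpace ℝ (Fin d) → ℝ := fun z =>
    truncPow k (p - 2) (U z) * (‖DU z‖ ^ 2 * η z.2 ^ 2) +
      truncPow k p (U z) * ‖gradient η z.2‖ ^ 2 with hF
  have hID : Integrable (fun z => truncPow k (p - 2) (U z) * (‖DU z‖ ^ 2 * η z.2 ^ 2))
      (cylMeasure d T) :=
    integrable_truncPow_mul (L := L) hU (by linarith) ((hDU.norm.pow 2).mul (hηc.pow 2))
      fun z hz => by rw [hη0 _ hz]; simp
  have hIN : Integrable (fun z => truncPow k p (U z) * ‖gradient η z.2‖ ^ 2) (cylMeasure d T) :=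
    integrable_truncPow_mul (L := L) hU (by linarith) (hDηc.norm.pow 2)
      fun z hz => by rw [hDη0 _ hz]; simp
  have hIF : Integrable F (cylMeasure d T) := hID.add hIN
  have hF0 : ∀ z, 0 ≤ F z := fun z =>
    add_nonneg (mul_nonneg (truncPow_nonneg _ _ _) (by positivity))
      (mul_nonneg (truncPow_nonneg _ _ _) (sq_nonneg _))
  have hIF' := hIF
  rw [cylMeasure_eq_prod] at hIF'
  set q : ℝ → ℝ := fun s => ∫ x, F (s, x) with hq
  have hqi : IntegrableOn q (Ioc 0 T) := hIF'.integral_prod_left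
  have hq0 : ∀ s, 0 ≤ q s := fun s => integral_nonneg fun x => hF0 _
  have hqI : ∫ s in Ioc 0 T, q s ≤ (C₂ + 1) * R := by
    rw [hq, setIntegral_eq_cylinder_one hIF, hF, integral_add hID hIN]
    have h1 : cutoffError k p U η T ≤ R := by
      have := sourceTerm_nonneg k p h f U η T
      linarith
    have h2 : gradEnergy k p U DU η T + cutoffError k p U η T ≤ (C₂ + 1) * R := by linarith
    exact h2
  have hwc : Continuous fun z => truncPow k p (U z) * η z.2 ^ 2 :=
    ((continuous_truncPow k (by linarith)).comp hU).mul (hηc.pow 2)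
  have hw0 : ∀ z, 0 ≤ truncPow k p (U z) * η z.2 ^ 2 := fun z =>
    mul_nonneg (truncPow_nonneg _ _ _) (sq_nonneg _)
  have hIw : Integrable (fun z => (truncPow k p (U z) * η z.2 ^ 2) ^ κ) (cylMeasure d T) :=
    integrable_cylinder_of_continuous (L := L) (hwc.rpow_const fun _ => Or.inr hκ0.le)
      (fun z hz => by rw [hη0 _ hz]; simp [Real.zero_rpow hκ0.ne']) T
  rw [← setIntegral_eq_cylinder_one hIw]
  have hslice : ∀ᵐ s ∂(volume.restrict (Ioc 0 T)),
      ∫ x, (truncPow k p (U (s, x)) * η x ^ 2) ^ κ ≤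
        CS * C₃ ^ κ * R ^ κ * (q s / R + 1) := by
    filter_upwards [ae_restrict_mem measurableSet_Ioc, hIF'.prod_right_ae] with s hs hFs
    have hws : Continuous fun x => truncPow k p (U (s, x)) * η x ^ 2 :=
      hwc.comp (by fun_prop : Continuous fun x : EuclideanSpace ℝ (Fin d) => (s, x))
    have hIy : Integrable fun x => truncPow k p (U (s, x)) * η x ^ 2 :=
      integrable_of_continuous (L := L) hws fun x hx => by rw [hη0 x hx]; simp
    -- The parameter balances the two terms of Young's inequality.
    set l := Real.sqrt ((q s + R) / R) with hl
    have hqR : 0 < q s + R := by linarith [hq0 s]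
    have hl0 : 0 < l := Real.sqrt_pos.2 (by positivity)
    have hgr := norm_gradient_truncPow_le (k := k) (fun x => hsol.hasGradientAt s x) hη hp hl0
    have hw1 : ContDiff ℝ 1 fun x => truncPow k p (U (s, x)) * η x ^ 2 := by
      rw [contDiff_one_iff_fderiv]
      refine ⟨fun x => (hgr x).1.hasFDerivAt.differentiableAt, ?_⟩
      rw [show fderiv ℝ (fun x => truncPow k p (U (s, x)) * η x ^ 2) = fun x =>
        InnerProductSpace.toDual ℝ (EuclideanSpace ℝ (Fin d))
          ((p * truncPow k (p - 1) (U (s, x)) * η x ^ 2) • DU (s, x) +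
          (2 * truncPow k p (U (s, x)) * η x) • gradient η x) from
        funext fun x => (hgr x).1.hasFDerivAt.fderiv]
      refine (InnerProductSpace.toDual ℝ (EuclideanSpace ℝ (Fin d))).continuous.comp ?_
      have hsc : Continuous fun x : EuclideanSpace ℝ (Fin d) => (s, x) := by fun_prop
      have c1 := (continuous_truncPow k (s := p - 1) (by linarith)).comp (hU.comp hsc)
      have c2 := (continuous_truncPow k (s := p) (by linarith)).comp (hU.comp hsc)
      exact (((continuous_const.mul c1).mul (hη.continuous.pow 2)).smul (hDU.comp hsc)).add
        (((continuous_const.mul c2).mul hη.continuous).smul (continuous_gradient_of_contDiff hη))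
    have hcs : HasCompactSupport fun x => truncPow k p (U (s, x)) * η x ^ 2 :=
      HasCompactSupport.intro (isCompact_closedBall (0 : EuclideanSpace ℝ (Fin d)) L)
        fun x hx => by rw [hη0 x (by simpa using hx)]; simp
    have hsob := hCS _ hw1 hcs
    simp only [abs_of_nonneg (hw0 (s, _))] at hsob
    have hgrad : ∫ x, ‖gradient (fun x => truncPow k p (U (s, x)) * η x ^ 2) x‖ ≤
        C₃ * Real.sqrt (R * (q s + R)) := by
      have i1 : ∫ x, ‖gradient (fun x => truncPow k p (U (s, x)) * η x ^ 2) x‖ ≤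
          ∫ x, (p / 2 + 1) * (l * (truncPow k p (U (s, x)) * η x ^ 2) + 1 / l * F (s, x)) := by
        refine integral_mono_of_nonneg (Eventually.of_forall fun _ => norm_nonneg _)
          (((hIy.const_mul l).add (hFs.const_mul (1 / l))).const_mul _)
          (Eventually.of_forall fun x => (hgr x).2)
      rw [integral_const_mul, integral_add (hIy.const_mul l) (hFs.const_mul (1 / l)),
        integral_const_mul, integral_const_mul] at i1
      have i2 := (hy s (Ioc_subset_Icc_self hs)).trans hCR
      have i3 : l * R = Real.sqrt (R * (q s + R)) := by
        rw [hl, show R * (q s + R) = ((q s + R) / R) * R ^ 2 by field_simp,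
          Real.sqrt_mul (by positivity), Real.sqrt_sq hR.le]
      have i4 : 1 / l * (q s + R) = Real.sqrt (R * (q s + R)) := by
        rw [← i3, div_mul_eq_mul_div, one_mul, div_eq_iff hl0.ne', mul_comm l R, mul_assoc, hl,
          Real.mul_self_sqrt (by positivity)]
        field_simp
      have i5 : 1 / l * q s ≤ Real.sqrt (R * (q s + R)) := by
        rw [← i4]; gcongr; linarith
      have i6 : l * ∫ x, truncPow k p (U (s, x)) * η x ^ 2 ≤
          C₂ * Real.sqrt (R * (q s + R)) := by
        rw [← i3]
        calc _ ≤ l * (C₂ * R) := mul_le_mul_of_nonneg_left i2 hl0.le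
          _ = _ := by ring
      refine i1.trans ?_
      rw [hC₃, mul_assoc]
      refine mul_le_mul_of_nonneg_left ?_ (by positivity)
      rw [add_mul, one_mul]
      exact add_le_add i6 i5
    have hpow : (∫ x, ‖gradient (fun x => truncPow k p (U (s, x)) * η x ^ 2) x‖) ^ κ ≤
        C₃ ^ κ * R ^ κ * (q s / R + 1) := by
      have j1 : 1 ≤ q s / R + 1 := by
        have := div_nonneg (hq0 s) hR.le
        linarith
      have j2 : Real.sqrt (R * (q s + R)) = R * Real.sqrt (q s / R + 1) := by
        rw [show R * (q s + R) = R ^ 2 * (q s / R + 1) by field_simp,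
          Real.sqrt_mul (by positivity), Real.sqrt_sq hR.le]
      have j3 : Real.sqrt (q s / R + 1) ^ κ ≤ q s / R + 1 := by
        rw [Real.sqrt_eq_rpow, ← Real.rpow_mul (by linarith)]
        calc _ ≤ (q s / R + 1) ^ (1 : ℝ) := Real.rpow_le_rpow_of_exponent_le j1 (by linarith)
          _ = _ := Real.rpow_one _
      calc _ ≤ (C₃ * Real.sqrt (R * (q s + R))) ^ κ :=
            Real.rpow_le_rpow (integral_nonneg fun _ => norm_nonneg _) hgrad hκ0.le
        _ = C₃ ^ κ * R ^ κ * Real.sqrt (q s / R + 1) ^ κ := by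
            rw [j2, Real.mul_rpow hC₃0 (by positivity), Real.mul_rpow hR.le (by positivity),
              mul_assoc]
        _ ≤ _ := mul_le_mul_of_nonneg_left j3 (by positivity)
    calc _ ≤ _ := hsob
      _ ≤ CS * (C₃ ^ κ * R ^ κ * (q s / R + 1)) := mul_le_mul_of_nonneg_left hpow hCS0
      _ = _ := by ring
  have hbi : IntegrableOn (fun s => CS * C₃ ^ κ * R ^ κ * (q s / R + 1)) (Ioc 0 T) :=
    ((hqi.div_const R).add (integrableOn_const (by simp))).const_mul _
  have hqR : IntegrableOn (fun s => q s / R) (Ioc 0 T) := hqi.div_const R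
  calc ∫ s in Ioc 0 T, ∫ x, (truncPow k p (U (s, x)) * η x ^ 2) ^ κ ≤
      ∫ s in Ioc 0 T, CS * C₃ ^ κ * R ^ κ * (q s / R + 1) :=
        integral_mono_of_nonneg (Eventually.of_forall fun s => integral_nonneg fun x =>
          Real.rpow_nonneg (hw0 (s, x)) _) hbi hslice
    _ = CS * C₃ ^ κ * R ^ κ * ((∫ s in Ioc 0 T, q s) / R + T) := by
        rw [integral_const_mul, integral_add hqR (integrableOn_const (by simp)),
          integral_div]
        simp [hT]
    _ ≤ CS * C₃ ^ κ * R ^ κ * ((C₂ + 1) + T) := by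
        refine mul_le_mul_of_nonneg_left ?_ (by positivity)
        have : (∫ s in Ioc 0 T, q s) / R ≤ C₂ + 1 := by rw [div_le_iff₀ hR]; exact hqI
        linarith
    _ = _ := by ring

end Sobolev

/-! ### De Giorgi iteration -/

section DeGiorgi

open Filter Topology

variable {d : ℕ} {p θ κ T : ℝ} {U f : ℝ × EuclideanSpace ℝ (Fin d) → ℝ}
  {h : ℝ → EuclideanSpace ℝ (Fin d) → EuclideanSpace ℝ (Fin d)}
  {η : EuclideanSpace ℝ (Fin d) → ℝ}

lemma exists_bound_deriv_smoothTransition :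
    ∃ M, 0 ≤ M ∧ ∀ x, |deriv Real.smoothTransition x| ≤ M := by
  have hc : Continuous (deriv Real.smoothTransition) :=
    (Real.smoothTransition.contDiff (n := 1)).continuous_deriv le_rfl
  obtain ⟨M, hM⟩ := (isCompact_Icc (a := (0 : ℝ)) (b := 1)).exists_bound_of_continuousOn
    hc.continuousOn
  refine ⟨|M|, abs_nonneg M, fun x => ?_⟩
  by_cases h0 : x < 0
  · have h1 : Real.smoothTransition =ᶠ[𝓝 x] fun _ => 0 := by
      filter_upwards [isOpen_Iio.mem_nhds h0] with y hy
      exact Real.smoothTransition.zero_of_nonpos (le_of_lt hy)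
    rw [h1.deriv_eq]; simp
  by_cases h2 : 1 < x
  · have h1 : Real.smoothTransition =ᶠ[𝓝 x] fun _ => 1 := by
      filter_upwards [isOpen_Ioi.mem_nhds h2] with y hy
      exact Real.smoothTransition.one_of_one_le (le_of_lt hy)
    rw [h1.deriv_eq]; simp
  · exact (hM x ⟨not_lt.1 h0, not_lt.1 h2⟩).trans (le_abs_self M)

/-- Cutoff functions between concentric balls, with the natural bound on the gradient. -/
lemma exists_cutoff (d : ℕ) :
    ∃ C : ℝ, 0 ≤ C ∧ ∀ r ρ : ℝ, 1 / 2 ≤ r → 0 < ρ → r + ρ ≤ 1 →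
      ∃ η : EuclideanSpace ℝ (Fin d) → ℝ, ContDiff ℝ 1 η ∧ (∀ x, 0 ≤ η x) ∧ (∀ x, η x ≤ 1) ∧
        (∀ x, ‖x‖ < r → η x = 1) ∧ (∀ x, r + ρ ≤ ‖x‖ → η x = 0) ∧
        ∀ x, ‖gradient η x‖ ≤ C / ρ := by
  obtain ⟨M, hM0, hM⟩ := exists_bound_deriv_smoothTransition
  refine ⟨2 * M, by positivity, fun r ρ hr hρ h1 => ?_⟩
  set D := (r + ρ) ^ 2 - r ^ 2 with hD
  have hDρ : ρ ≤ D := by rw [hD]; nlinarith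
  have hD0 : 0 < D := hρ.trans_le hDρ
  set η : EuclideanSpace ℝ (Fin d) → ℝ := fun x =>
    Real.smoothTransition (((r + ρ) ^ 2 - ‖x‖ ^ 2) / D)
  have hzero : ∀ x, r + ρ ≤ ‖x‖ → η x = 0 := fun x hx => by
    refine Real.smoothTransition.zero_of_nonpos (div_nonpos_of_nonpos_of_nonneg ?_ hD0.le)
    nlinarith
  have hC : ContDiff ℝ 1 η := (Real.smoothTransition.contDiff (n := 1)).comp
    ((contDiff_const.sub (contDiff_norm_sq ℝ)).div_const D)
  refine ⟨η, hC, fun x => Real.smoothTransition.nonneg _, fun x => Real.smoothTransition.le_one _,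
    fun x hx => ?_, hzero, fun x => ?_⟩
  · refine Real.smoothTransition.one_of_one_le ?_
    rw [le_div_iff₀ hD0, hD]
    nlinarith [norm_nonneg x]
  · by_cases hx : r + ρ < ‖x‖
    · rw [gradient_eq_zero_of_forall (L := r + ρ) (fun y hy => hzero y hy.le) hx, norm_zero]
      positivity
    · set A : EuclideanSpace ℝ (Fin d) →L[ℝ] ℝ := innerSL ℝ x with hA
      have e1 : HasFDerivAt (fun x : EuclideanSpace ℝ (Fin d) => ((r + ρ) ^ 2 - ‖x‖ ^ 2) * D⁻¹)
          (D⁻¹ • -((2 : ℕ) • A)) x :=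
        ((HasFDerivAt.norm_sq (hasFDerivAt_id x)).const_sub _).mul_const _
      have e2 : HasFDerivAt η (deriv Real.smoothTransition (((r + ρ) ^ 2 - ‖x‖ ^ 2) * D⁻¹) •
          (D⁻¹ • -((2 : ℕ) • A))) x :=
        ((Real.smoothTransition.contDiff (n := 1)).differentiable
          (by simp)).differentiableAt.hasDerivAt.comp_hasFDerivAt x e1
      rw [gradient, LinearIsometryEquiv.norm_map, e2.fderiv, norm_smul, norm_smul, norm_neg,
        ← Nat.cast_smul_eq_nsmul ℝ, norm_smul, hA, innerSL_apply_norm, Real.norm_eq_abs,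
        Real.norm_eq_abs, abs_of_pos (inv_pos.2 hD0)]
      have e3 := hM (((r + ρ) ^ 2 - ‖x‖ ^ 2) * D⁻¹)
      have e4 : ‖x‖ ≤ 1 := (not_lt.1 hx).trans h1
      have e6 : ‖((2 : ℕ) : ℝ)‖ = 2 := by norm_num
      rw [e6]
      calc _ ≤ M * (ρ⁻¹ * (2 * 1)) := by gcongr
        _ = 2 * M / ρ := by rw [div_eq_mul_inv]; ring

/-- The cylinder `(0, T] × B(0, r)`. -/
def spaceTimeCylinder (d : ℕ) (T r : ℝ) : Set (ℝ × EuclideanSpace ℝ (Fin d)) :=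
  Ioc 0 T ×ˢ ball 0 r

lemma measurableSet_spaceTimeCylinder (T r : ℝ) :
    MeasurableSet (spaceTimeCylinder d T r) :=
  measurableSet_Ioc.prod measurableSet_ball

lemma integrableOn_spaceTimeCylinder {F : ℝ × EuclideanSpace ℝ (Fin d) → ℝ} (hF : Measurable F)
    {r C : ℝ} (hC : ∀ z ∈ closedCylinder d T r, |F z| ≤ C) :
    IntegrableOn F (spaceTimeCylinder d T r) := by
  refine Measure.integrableOn_of_bounded (M := C) ?_ hF.aestronglyMeasurable ?_
  · rw [spaceTimeCylinder, Measure.volume_eq_prod, Measure.prod_prod]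
    exact (ENNReal.mul_lt_top measure_Ioc_lt_top measure_ball_lt_top).ne
  · filter_upwards [ae_restrict_mem (measurableSet_spaceTimeCylinder T r)] with z hz
    exact hC z ⟨Ioc_subset_Icc_self hz.1, ball_subset_closedBall hz.2⟩

lemma integrableOn_truncPow (hU : Continuous U) (k r : ℝ) {s : ℝ} (hs : 0 ≤ s) :
    IntegrableOn (fun z => truncPow k s (U z)) (spaceTimeCylinder d T r) := by
  obtain ⟨M, hM⟩ := (isCompact_closedCylinder (d := d) T r).exists_bound_of_continuousOn
    hU.continuousOn
  refine integrableOn_spaceTimeCylinder (F := fun z => truncPow k s (U z))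
    ((measurable_truncPow k s).comp hU.measurable)
    (C := (1 + M + |k|) ^ s) fun z hz => ?_
  rw [abs_of_nonneg (truncPow_nonneg _ _ _)]
  exact truncPow_le hs le_rfl (hM z hz)

lemma integral_cylMeasure_eq_setIntegral {F : ℝ × EuclideanSpace ℝ (Fin d) → ℝ} {r : ℝ}
    (h0 : ∀ z, r ≤ ‖z.2‖ → F z = 0) :
    ∫ z, F z ∂cylMeasure d T = ∫ z in spaceTimeCylinder d T r, F z := by
  refine setIntegral_eq_of_subset_of_forall_sdiff_eq_zero
    (measurableSet_Ioc.prod MeasurableSet.univ) (prod_mono subset_rfl (subset_univ _))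
    fun z hz => h0 z ?_
  by_contra hlt
  exact hz.2 ⟨hz.1.1, by simpa using not_le.1 hlt⟩

/-- The pointwise inequality replacing Hölder's inequality on sets of small measure. -/
lemma rpow_le_add_rpow {g l s t : ℝ} (hg : 0 ≤ g) (hl : 0 < l) (hs : 0 < s) (hst : s ≤ t) :
    g ^ s ≤ l ^ s + l ^ (s - t) * g ^ t := by
  by_cases hgl : g ≤ l
  · have h1 : g ^ s ≤ l ^ s := Real.rpow_le_rpow hg hgl hs.le
    have h2 : 0 ≤ l ^ (s - t) * g ^ t := by positivity
    linarith
  · have hg0 : 0 < g := hl.trans (not_le.1 hgl)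
    have h1 : g ^ (s - t) ≤ l ^ (s - t) :=
      Real.rpow_le_rpow_of_nonpos hl (not_le.1 hgl).le (by linarith)
    have h2 : g ^ s = g ^ (s - t) * g ^ t := by
      rw [← Real.rpow_add hg0]; congr 1; ring
    have h3 : g ^ (s - t) * g ^ t ≤ l ^ (s - t) * g ^ t :=
      mul_le_mul_of_nonneg_right h1 (by positivity)
    have h4 : 0 ≤ l ^ s := by positivity
    linarith

lemma truncPow_add_le {k j s s' r : ℝ} (hj : 0 < j) (hs : 0 ≤ s) (hs' : s ≤ s') :
    truncPow (k + j) s r ≤ j ^ (s - s') * truncPow k s' r := by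
  unfold truncPow
  by_cases h1 : k + j < r
  · have h2 : k < r := by linarith
    have h3 : 0 < r - k := by linarith
    rw [if_pos h1, if_pos h2]
    calc (r - (k + j)) ^ s ≤ (r - k) ^ s := Real.rpow_le_rpow (by linarith) (by linarith) hs
      _ = (r - k) ^ (s - s') * (r - k) ^ s' := by rw [← Real.rpow_add h3]; congr 1; ring
      _ ≤ j ^ (s - s') * (r - k) ^ s' := by
        refine mul_le_mul_of_nonneg_right ?_ (by positivity)
        exact Real.rpow_le_rpow_of_nonpos hj (by linarith) (by linarith)
  · rw [if_neg h1]
    split_ifs with h2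
    · have := sub_pos.2 h2
      positivity
    · simp

/-- The integral of `(U - k)_+ ^ s` over `(0, T] × B(0, r)`. -/
noncomputable def truncMass (U : ℝ × EuclideanSpace ℝ (Fin d) → ℝ) (T s k r : ℝ) : ℝ :=
  ∫ z in spaceTimeCylinder d T r, truncPow k s (U z)

/-- One step of the iteration, from level `k` and radius `r + ρ` to level `k + j` and
radius `r`. -/
lemma truncMass_step {k j r ρ C₀ C₁ ζ : ℝ} (hU : Continuous U) (hf : Continuous f)
    (hh : Continuous (Function.uncurry h)) (hp : 2 ≤ p) (hθ : 1 < θ) (hθκ : θ < κ)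
    (hj : 0 < j) (hj1 : j ≤ 1) (hρ : 0 < ρ)
    (hη : ContDiff ℝ 1 η) (hη0 : ∀ x, 0 ≤ η x) (hη1 : ∀ x, η x ≤ 1)
    (hηr : ∀ x, ‖x‖ < r → η x = 1) (hηR : ∀ x, r + ρ ≤ ‖x‖ → η x = 0)
    (hDη : ∀ x, ‖gradient η x‖ ≤ C₀ / ρ)
    (hgain : ∀ R, 0 < R → cutoffError (k + j) p U η T + sourceTerm (k + j) p h f U η T ≤ R →
      ∫ z, (truncPow (k + j) p (U z) * η z.2 ^ 2) ^ κ ∂cylMeasure d T ≤ C₁ * R ^ κ)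
    (hF : ∫ z in spaceTimeCylinder d T (r + ρ),
      (truncWeight p (h z.1 z.2) * |f z| ^ p) ^ (θ / (θ - 1)) ≤ 1)
    (hζ0 : 0 < ζ) (hζ1 : ζ ≤ 1) (hζ : truncMass U T (p * θ) k (r + ρ) ≤ ζ) :
    truncMass U T (p * θ) (k + j) r ≤
      (1 + C₁) * (((C₀ / ρ) ^ 2 + 2) * (j ^ (-(p * θ)) * ζ ^ (1 / θ))) ^ θ *
        (j ^ (-(p * θ)) * ζ) ^ (1 - θ / κ) := by
  have hp0 : 0 < p := by linarith
  have hθ0 : 0 < θ := by linarith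
  have hκ0 : 0 < κ := by linarith
  have hpθ : 0 < p * θ := by positivity
  have hppθ : p ≤ p * θ := by nlinarith
  set Q := spaceTimeCylinder d T (r + ρ)
  set J := j ^ (-(p * θ)) with hJ
  have hJ0 : 0 < J := Real.rpow_pos_of_pos hj _
  have hI := integrableOn_truncPow (T := T) hU k (r + ρ) hpθ.le
  have hI0 := integrableOn_truncPow (T := T) hU (k + j) (r + ρ) le_rfl
  set a := J * ζ with ha
  have ha0 : 0 < a := by positivity
  -- The measure of the superlevel set, by Chebyshev's inequality.
  have hm : ∫ z in Q, truncPow (k + j) 0 (U z) ≤ a := by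
    calc _ ≤ ∫ z in Q, J * truncPow k (p * θ) (U z) :=
          integral_mono hI0 (hI.const_mul J) fun z => by
            simpa [hJ] using truncPow_add_le (k := k) (r := U z) hj le_rfl hpθ.le
      _ = J * truncMass U T (p * θ) k (r + ρ) := integral_const_mul _ _
      _ ≤ a := mul_le_mul_of_nonneg_left hζ hJ0.le
  have hzθ : ζ ≤ ζ ^ (1 / θ) := by
    calc ζ = ζ ^ (1 : ℝ) := (Real.rpow_one ζ).symm
      _ ≤ _ := Real.rpow_le_rpow_of_exponent_ge hζ0 hζ1 (by rw [div_le_one hθ0]; exact hθ.le)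
  have hcut : cutoffError (k + j) p U η T ≤ (C₀ / ρ) ^ 2 * (J * ζ ^ (1 / θ)) := by
    rw [cutoffError, integral_cylMeasure_eq_setIntegral (r := r + ρ) fun z hz => ?_]
    · have h1 : ∀ z, truncPow (k + j) p (U z) * ‖gradient η z.2‖ ^ 2 ≤
          (C₀ / ρ) ^ 2 * (J * truncPow k (p * θ) (U z)) := fun z => by
        have e1 := truncPow_add_le (k := k) (r := U z) hj hp0.le hppθ
        have e2 : j ^ (p - p * θ) ≤ J :=
          Real.rpow_le_rpow_of_exponent_ge hj hj1 (by linarith)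
        have e3 : truncPow (k + j) p (U z) ≤ J * truncPow k (p * θ) (U z) :=
          e1.trans (mul_le_mul_of_nonneg_right e2 (truncPow_nonneg _ _ _))
        have e4 : ‖gradient η z.2‖ ^ 2 ≤ (C₀ / ρ) ^ 2 :=
          pow_le_pow_left₀ (norm_nonneg _) (hDη _) 2
        rw [mul_comm]
        exact mul_le_mul e4 e3 (truncPow_nonneg _ _ _) (sq_nonneg _)
      calc _ ≤ ∫ z in Q, (C₀ / ρ) ^ 2 * (J * truncPow k (p * θ) (U z)) :=
            integral_mono_of_nonneg (Eventually.of_forall fun z =>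
              mul_nonneg (truncPow_nonneg _ _ _) (sq_nonneg _))
              ((hI.const_mul J).const_mul _) (Eventually.of_forall h1)
        _ = (C₀ / ρ) ^ 2 * (J * truncMass U T (p * θ) k (r + ρ)) := by
            rw [integral_const_mul, integral_const_mul]; rfl
        _ ≤ _ := by gcongr; exact hζ.trans hzθ
    · -- The gradient vanishes where `η` attains its minimum `0`.
      have h2 : IsLocalMin η z.2 := Eventually.of_forall fun y => by rw [hηR _ hz]; exact hη0 y
      have h3 : gradient η z.2 = 0 := by rw [gradient, h2.fderiv_eq_zero, map_zero]
      rw [h3]; simp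
  set θ' := θ / (θ - 1) with hθ'
  have hθ'1 : 1 < θ' := by rw [hθ', lt_div_iff₀ (by linarith)]; linarith
  have hwm : Measurable fun z : ℝ × EuclideanSpace ℝ (Fin d) => truncWeight p (h z.1 z.2) :=
    (measurable_truncWeight p).comp hh.measurable
  have hsource : sourceTerm (k + j) p h f U η T ≤ 2 * (J * ζ ^ (1 / θ)) := by
    rw [sourceTerm, integral_cylMeasure_eq_setIntegral (r := r + ρ) fun z hz => by
      rw [hηR _ hz]; simp]
    set l := a ^ (-(1 / θ')) with hl
    have hl0 : 0 < l := Real.rpow_pos_of_pos ha0 _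
    have hFi : IntegrableOn (fun z => (truncWeight p (h z.1 z.2) * |f z| ^ p) ^ θ') Q := by
      obtain ⟨M, hM⟩ := (isCompact_closedCylinder (d := d) T (r + ρ)).exists_bound_of_continuousOn
        hf.continuousOn
      refine integrableOn_spaceTimeCylinder
        (F := fun z => (truncWeight p (h z.1 z.2) * |f z| ^ p) ^ θ')
        ((hwm.mul (hf.measurable.abs.pow_const p)).pow_const θ') (C := (1 * M ^ p) ^ θ')
        fun z hz => ?_
      have e1 := truncWeight_nonneg p (h z.1 z.2)
      have e2 := truncWeight_le_one hp0.le (h z.1 z.2)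
      have e3 : |f z| ≤ M := hM z hz
      rw [abs_of_nonneg (by positivity)]
      gcongr
    have h1 : ∀ z, truncWeight p (h z.1 z.2) * |f z| ^ p *
        (truncPow (k + j) 0 (U z) * η z.2 ^ 2) ≤ l * truncPow (k + j) 0 (U z) +
          l ^ (1 - θ') * (truncWeight p (h z.1 z.2) * |f z| ^ p) ^ θ' := fun z => by
      have e1 := truncWeight_nonneg p (h z.1 z.2)
      set g := truncWeight p (h z.1 z.2) * |f z| ^ p
      have hg0 : 0 ≤ g := by positivity
      have e2 := rpow_le_add_rpow hg0 hl0 one_pos hθ'1.le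
      rw [Real.rpow_one, Real.rpow_one] at e2
      have e3 := truncPow_nonneg (k + j) 0 (U z)
      have e4 := truncPow_zero_le_one (k + j) (U z)
      have e5 : η z.2 ^ 2 ≤ 1 := pow_le_one₀ (hη0 _) (hη1 _)
      have e6 : 0 ≤ l ^ (1 - θ') * g ^ θ' := by positivity
      calc g * (truncPow (k + j) 0 (U z) * η z.2 ^ 2) ≤ g * (truncPow (k + j) 0 (U z) * 1) := by
            gcongr
        _ ≤ (l + l ^ (1 - θ') * g ^ θ') * truncPow (k + j) 0 (U z) := by
            rw [mul_one]; gcongr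
        _ ≤ _ := by nlinarith
    have hl2 : l ^ (1 - θ') = a ^ (1 / θ) := by
      rw [hl, ← Real.rpow_mul ha0.le]
      congr 1
      rw [hθ']
      have : θ - 1 ≠ 0 := by linarith
      field_simp
      ring
    have hla : l * a = a ^ (1 / θ) := by
      rw [hl, ← Real.rpow_add_one ha0.ne']
      congr 1
      rw [hθ']
      have : θ - 1 ≠ 0 := by linarith
      field_simp
      ring
    have haJ : a ^ (1 / θ) ≤ J * ζ ^ (1 / θ) := by
      rw [ha, Real.mul_rpow hJ0.le hζ0.le]
      gcongr
      calc J ^ (1 / θ) ≤ J ^ (1 : ℝ) := by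
            refine Real.rpow_le_rpow_of_exponent_le ?_ (by rw [div_le_one hθ0]; exact hθ.le)
            exact Real.one_le_rpow_of_pos_of_le_one_of_nonpos hj hj1 (by linarith)
        _ = J := Real.rpow_one J
    calc _ ≤ ∫ z in Q, (l * truncPow (k + j) 0 (U z) +
          l ^ (1 - θ') * (truncWeight p (h z.1 z.2) * |f z| ^ p) ^ θ') :=
          integral_mono_of_nonneg (Eventually.of_forall fun z =>
            mul_nonneg (mul_nonneg (truncWeight_nonneg _ _) (by positivity))
              (mul_nonneg (truncPow_nonneg _ _ _) (sq_nonneg _)))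
            ((hI0.const_mul l).add (hFi.const_mul _)) (Eventually.of_forall h1)
      _ = l * (∫ z in Q, truncPow (k + j) 0 (U z)) +
          l ^ (1 - θ') * ∫ z in Q, (truncWeight p (h z.1 z.2) * |f z| ^ p) ^ θ' := by
          rw [integral_add (hI0.const_mul l) (hFi.const_mul _), integral_const_mul,
            integral_const_mul]
      _ ≤ l * a + l ^ (1 - θ') * 1 := by gcongr
      _ ≤ _ := by rw [hla, hl2]; linarith
  set R := ((C₀ / ρ) ^ 2 + 2) * (J * ζ ^ (1 / θ)) with hR
  have hR0 : 0 < R := by positivity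
  have hg := hgain R hR0 (by rw [hR]; linarith)
  -- The level `l` balances the measure of the superlevel set and the norm in `L ^ κ`.
  set l := R * a ^ (-(1 / κ)) with hl
  have hl0 : 0 < l := by positivity
  have hκi : IntegrableOn (fun z => (truncPow (k + j) p (U z) * η z.2 ^ 2) ^ κ) Q := by
    have hηc : Continuous fun z : ℝ × EuclideanSpace ℝ (Fin d) => η z.2 :=
      hη.continuous.comp continuous_snd
    have hc : Continuous fun z => (truncPow (k + j) p (U z) * η z.2 ^ 2) ^ κ :=
      (((continuous_truncPow _ hp0).comp hU).mul (hηc.pow 2)).rpow_const fun _ => Or.inr hκ0.le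
    obtain ⟨M, hM⟩ := (isCompact_closedCylinder (d := d) T (r + ρ)).exists_bound_of_continuousOn
      hc.continuousOn
    exact integrableOn_spaceTimeCylinder hc.measurable hM
  have hκ' : ∫ z in Q, (truncPow (k + j) p (U z) * η z.2 ^ 2) ^ κ ≤ C₁ * R ^ κ := by
    rw [← integral_cylMeasure_eq_setIntegral (r := r + ρ) fun z hz => by
      rw [hηR _ hz]; simp [Real.zero_rpow hκ0.ne']]
    exact hg
  have hsub : spaceTimeCylinder d T r ⊆ Q := prod_mono subset_rfl (ball_subset_ball (by linarith))
  have hfin : truncMass U T (p * θ) (k + j) r ≤ l ^ θ * a + l ^ (θ - κ) * (C₁ * R ^ κ) := by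
    have h1 : ∀ z ∈ spaceTimeCylinder d T r, truncPow (k + j) (p * θ) (U z) ≤
        l ^ θ * truncPow (k + j) 0 (U z) +
          l ^ (θ - κ) * (truncPow (k + j) p (U z) * η z.2 ^ 2) ^ κ := fun z hz => by
      have e0 : η z.2 = 1 := hηr _ (by simpa using hz.2)
      rw [e0, one_pow, mul_one]
      rcases lt_or_ge (k + j) (U z) with e1 | e1
      · have e2 := rpow_le_add_rpow (truncPow_nonneg (k + j) p (U z)) hl0 hθ0 hθκ.le
        rw [truncPow_rpow _ _ _ _ hθ0.ne'] at e2
        have e3 : truncPow (k + j) 0 (U z) = 1 := by rw [truncPow, if_pos e1, Real.rpow_zero]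
        rw [e3, mul_one]
        exact e2
      · rw [truncPow_of_le e1, truncPow_of_le e1, truncPow_of_le e1, Real.zero_rpow hκ0.ne']
        simp
    have hi2 : IntegrableOn (fun z => l ^ θ * truncPow (k + j) 0 (U z) +
          l ^ (θ - κ) * (truncPow (k + j) p (U z) * η z.2 ^ 2) ^ κ) Q :=
      (hI0.const_mul _).add (hκi.const_mul _)
    calc truncMass U T (p * θ) (k + j) r ≤ ∫ z in spaceTimeCylinder d T r,
          (l ^ θ * truncPow (k + j) 0 (U z) +
          l ^ (θ - κ) * (truncPow (k + j) p (U z) * η z.2 ^ 2) ^ κ) :=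
          setIntegral_mono_on (integrableOn_truncPow hU _ _ hpθ.le) (hi2.mono_set hsub)
            (measurableSet_spaceTimeCylinder _ _) h1
      _ ≤ ∫ z in Q, (l ^ θ * truncPow (k + j) 0 (U z) +
          l ^ (θ - κ) * (truncPow (k + j) p (U z) * η z.2 ^ 2) ^ κ) := by
          refine setIntegral_mono_set hi2 (Eventually.of_forall fun z => ?_)
            (Eventually.of_forall hsub)
          have e1 := truncPow_nonneg (k + j) 0 (U z)
          have e2 := truncPow_nonneg (k + j) p (U z)
          simp only [Pi.zero_apply]
          positivity
      _ = l ^ θ * (∫ z in Q, truncPow (k + j) 0 (U z)) +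
          l ^ (θ - κ) * ∫ z in Q, (truncPow (k + j) p (U z) * η z.2 ^ 2) ^ κ := by
          rw [integral_add (hI0.const_mul _) (hκi.const_mul _), integral_const_mul,
            integral_const_mul]
      _ ≤ _ := by gcongr
  refine hfin.trans (le_of_eq ?_)
  have e1 : l ^ θ * a = R ^ θ * a ^ (1 - θ / κ) := by
    rw [hl, Real.mul_rpow hR0.le (by positivity), ← Real.rpow_mul ha0.le, mul_assoc,
      ← Real.rpow_add_one ha0.ne']
    congr 2; field_simp; ring
  have e2 : l ^ (θ - κ) * R ^ κ = R ^ θ * a ^ (1 - θ / κ) := by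
    rw [hl, Real.mul_rpow hR0.le (by positivity), ← Real.rpow_mul ha0.le, mul_right_comm,
      ← Real.rpow_add hR0]
    congr 2
    · ring
    · field_simp; ring
  rw [e1, mul_left_comm, e2]
  ring

end DeGiorgi

/-! ### Local boundedness for normalized data -/

section Boundedness

open Filter Topology

variable {d : ℕ} {p θ T : ℝ}

/-- Fast geometric convergence: a superlinear recursion with geometrically growing constants
forces geometric decay when started below a threshold. -/
lemma exists_fast_convergence_threshold {α B C : ℝ} (hα : 0 < α) (hB : 1 < B) (hC : 0 < C) :
    ∃ ζ₀, 0 < ζ₀ ∧ ζ₀ ≤ 1 ∧ ∀ Z : ℕ → ℝ, Z 0 ≤ ζ₀ →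
      (∀ n ζ, 0 < ζ → ζ ≤ 1 → Z n ≤ ζ → Z (n + 1) ≤ C * B ^ n * ζ ^ (1 + α)) →
      ∃ γ, 0 ≤ γ ∧ γ < 1 ∧ ∀ n, Z n ≤ ζ₀ * γ ^ n := by
  have hB0 : 0 < B := by linarith
  set γ : ℝ := B ^ (-(1 / α)) with hγ
  have hγ0 : 0 < γ := by positivity
  have hγ1 : γ < 1 := Real.rpow_lt_one_of_one_lt_of_neg hB (by simp [hα])
  have hγα : B * γ ^ α = 1 := by
    rw [hγ, ← Real.rpow_mul hB0.le]
    nth_rewrite 1 [← Real.rpow_one B]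
    rw [← Real.rpow_add hB0]
    field_simp
    simp
  set ζ₀ : ℝ := min 1 ((γ / C) ^ (1 / α))
  have hζ0 : 0 < ζ₀ := lt_min one_pos (by positivity)
  have hζ1 : ζ₀ ≤ 1 := min_le_left _ _
  have hζα : C * ζ₀ ^ α ≤ γ := by
    have h1 : ζ₀ ^ α ≤ ((γ / C) ^ (1 / α)) ^ α := Real.rpow_le_rpow hζ0.le (min_le_right _ _) hα.le
    rw [← Real.rpow_mul (by positivity), one_div, inv_mul_cancel₀ hα.ne', Real.rpow_one,
      le_div_iff₀ hC] at h1
    linarith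
  refine ⟨ζ₀, hζ0, hζ1, fun Z h0 hZ => ⟨γ, hγ0.le, hγ1, fun n => ?_⟩⟩
  induction n with
  | zero => simpa using h0
  | succ n ih =>
    have hpos : 0 < ζ₀ * γ ^ n := by positivity
    have h1 := hZ n _ hpos (mul_le_one₀ hζ1 (by positivity) (pow_le_one₀ hγ0.le hγ1.le)) ih
    refine h1.trans ?_
    have h2 : (γ ^ n) ^ α = (γ ^ α) ^ n := by
      rw [← Real.rpow_natCast, ← Real.rpow_natCast, ← Real.rpow_mul hγ0.le,
        ← Real.rpow_mul hγ0.le, mul_comm]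
    rw [Real.rpow_add hpos, Real.rpow_one, Real.mul_rpow hζ0.le (by positivity), h2]
    calc C * B ^ n * (ζ₀ * γ ^ n * (ζ₀ ^ α * (γ ^ α) ^ n))
        = ζ₀ * γ ^ n * (C * ζ₀ ^ α) * (B * γ ^ α) ^ n := by rw [mul_pow]; ring
      _ ≤ ζ₀ * γ ^ n * γ := by
        rw [hγα, one_pow, mul_one]; exact mul_le_mul_of_nonneg_left hζα hpos.le
      _ = ζ₀ * γ ^ (n + 1) := by rw [pow_succ]; ring

/-- The constant of `truncMass_step` for dyadic levels and radii grows geometrically. -/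
lemma dyadic_step_const_le {C₀ C₁ s α ζ : ℝ} (hC₁ : 0 ≤ C₁) (hθ : 0 < θ)
    (hζ : 0 < ζ) (n : ℕ) :
    (1 + C₁) * (((C₀ / (1 / 2) ^ (n + 2)) ^ 2 + 2) *
        ((((1 / 2 : ℝ) ^ (n + 1)) ^ (-s)) * ζ ^ (1 / θ))) ^ θ *
        ((((1 / 2 : ℝ) ^ (n + 1)) ^ (-s)) * ζ) ^ α ≤
      (1 + C₁) * ((16 * C₀ ^ 2 + 2) * 2 ^ s) ^ θ * ((2 : ℝ) ^ s) ^ α *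
        ((4 * 2 ^ s) ^ θ * ((2 : ℝ) ^ s) ^ α) ^ n * ζ ^ (1 + α) := by
  set A : ℝ := 2 ^ s with hA
  have hA0 : 0 < A := by positivity
  have hj : ((1 / 2 : ℝ) ^ (n + 1)) ^ (-s) = A * A ^ n := by
    rw [← Real.rpow_natCast, ← Real.rpow_mul (by positivity), one_div, Real.inv_rpow (by norm_num),
      ← Real.rpow_neg (by norm_num), ← pow_succ', hA, ← Real.rpow_natCast (2 ^ s),
      ← Real.rpow_mul (by norm_num)]
    congr 1; ring
  have hρ : (C₀ / (1 / 2) ^ (n + 2)) ^ 2 = 16 * C₀ ^ 2 * 4 ^ n := by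
    rw [one_div, inv_pow, div_inv_eq_mul, pow_add, mul_pow, mul_pow, ← pow_mul, mul_comm n 2,
      pow_mul]
    norm_num; ring
  have hD : (C₀ / (1 / 2) ^ (n + 2)) ^ 2 + 2 ≤ (16 * C₀ ^ 2 + 2) * 4 ^ n := by
    have h4 : (1 : ℝ) ≤ 4 ^ n := one_le_pow₀ (by norm_num)
    rw [hρ]; linarith
  rw [hj]
  have hζθ : (ζ ^ (1 / θ)) ^ θ = ζ := by
    rw [← Real.rpow_mul hζ.le, one_div, inv_mul_cancel₀ hθ.ne', Real.rpow_one]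
  have hpow : ∀ {x : ℝ}, 0 ≤ x → ∀ q : ℝ, (x ^ n) ^ q = (x ^ q) ^ n := fun hx q => by
    rw [← Real.rpow_natCast, ← Real.rpow_natCast, ← Real.rpow_mul hx, ← Real.rpow_mul hx, mul_comm]
  calc _ ≤ (1 + C₁) * ((16 * C₀ ^ 2 + 2) * 4 ^ n * (A * A ^ n * ζ ^ (1 / θ))) ^ θ *
        (A * A ^ n * ζ) ^ α := by gcongr
    _ = (1 + C₁) * ((16 * C₀ ^ 2 + 2) * A * (4 * A) ^ n * ζ ^ (1 / θ)) ^ θ *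
        (A * A ^ n * ζ) ^ α := by rw [mul_pow]; congr 3; ring
    _ = _ := by
      rw [Real.mul_rpow (by positivity) (by positivity), hζθ,
        Real.mul_rpow (x := (16 * C₀ ^ 2 + 2) * A) (by positivity) (by positivity),
        Real.mul_rpow (x := A * A ^ n) (by positivity) hζ.le,
        Real.mul_rpow (x := A) (y := A ^ n) hA0.le (by positivity), hpow (by positivity),
        hpow hA0.le, Real.rpow_add hζ, Real.rpow_one, mul_pow]
      ring

lemma truncMass_nonneg (U : ℝ × EuclideanSpace ℝ (Fin d) → ℝ) (T s k r : ℝ) :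
    0 ≤ truncMass U T s k r :=
  integral_nonneg fun _ => truncPow_nonneg _ _ _

lemma truncMass_anti {U : ℝ × EuclideanSpace ℝ (Fin d) → ℝ} (hU : Continuous U) {s k k' r r' : ℝ}
    (hs : 0 ≤ s) (hk : k ≤ k') (hr : r' ≤ r) : truncMass U T s k' r' ≤ truncMass U T s k r := by
  have hmono : ∀ ρ, truncMass U T s k' ρ ≤ truncMass U T s k ρ := fun ρ => by
    refine integral_mono (integrableOn_truncPow hU _ _ hs) (integrableOn_truncPow hU _ _ hs)
      fun z => ?_
    simp only [truncPow]
    split_ifs with h1 h2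
    · exact Real.rpow_le_rpow (by linarith) (by linarith) hs
    · linarith
    · have := sub_nonneg.2 (le_of_lt ‹k < U z›)
      positivity
    · rfl
  refine (setIntegral_mono_set (integrableOn_truncPow hU _ _ hs)
    (Eventually.of_forall fun z => truncPow_nonneg _ _ _) ?_).trans (hmono r)
  exact (prod_mono subset_rfl (ball_subset_ball hr)).eventuallyLE

/-- A continuous function with vanishing mass above the level `k` is at most `k`. -/
lemma le_of_truncMass_nonpos {U : ℝ × EuclideanSpace ℝ (Fin d) → ℝ} (hU : Continuous U)
    {s k r : ℝ} (hs : 0 ≤ s) (hT : 0 < T) (h : truncMass U T s k r ≤ 0) {t : ℝ}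
    {x : EuclideanSpace ℝ (Fin d)} (ht : t ∈ Icc 0 T) (hx : x ∈ ball 0 r) : U (t, x) ≤ k := by
  have h0 : truncMass U T s k r = 0 := le_antisymm h (truncMass_nonneg _ _ _ _ _)
  have hae := (setIntegral_eq_zero_iff_of_nonneg_ae
    (Eventually.of_forall fun z => truncPow_nonneg k s (U z))
    (integrableOn_truncPow hU k r hs)).1 h0
  have hopen : IsOpen ({z | k < U z} ∩ Ioo 0 T ×ˢ ball (0 : EuclideanSpace ℝ (Fin d)) r) :=
    (isOpen_lt continuous_const hU).inter (isOpen_Ioo.prod isOpen_ball)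
  have hnull : volume ({z | k < U z} ∩ Ioo 0 T ×ˢ ball (0 : EuclideanSpace ℝ (Fin d)) r) = 0 := by
    rw [EventuallyEq, ae_restrict_iff' (measurableSet_spaceTimeCylinder T r)] at hae
    refine measure_mono_null (fun z hz => ?_) (ae_iff.1 hae)
    have hz0 : k < U z := hz.1
    simp only [mem_ofPred_eq, Classical.not_imp]
    refine ⟨⟨Ioo_subset_Ioc_self hz.2.1, hz.2.2⟩, ?_⟩
    rw [truncPow, if_pos hz0]
    exact (by positivity : 0 < (U z - k) ^ s).ne'
  have hempty := hopen.measure_eq_zero_iff (μ := volume) |>.1 hnull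
  have hsub : Ioo 0 T ⊆ {t | U (t, x) ≤ k} := fun t' ht' => by
    by_contra hlt
    have hlt' : k < U (t', x) := not_le.1 hlt
    have : (t', x) ∈ ({z | k < U z} ∩ Ioo 0 T ×ˢ ball (0 : EuclideanSpace ℝ (Fin d)) r) :=
      ⟨hlt', ht', hx⟩
    rw [hempty] at this
    exact this
  have hcl : IsClosed {t | U (t, x) ≤ k} :=
    isClosed_le (hU.comp (continuous_id.prodMk continuous_const)) continuous_const
  have := closure_minimal hsub hcl
  rw [closure_Ioo hT.ne] at this
  exact this ht

/-- Local boundedness for normalized data: if the source is normalized on `(0, T] × B(0, 1)`, a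
small enough mass of the positive part of the solution there forces `U ≤ 1` on the smaller
cylinder. -/
lemma exists_boundedness_threshold (d : ℕ) (hd : 3 ≤ d) {δ ν : ℝ} (hδ0 : 0 < δ) (hδ4 : δ < 4)
    (hν : 0 < ν) {gδ gν : ℝ → ℝ} (hT : 0 < T) (hθ : 1 < θ) (hθd : θ < (d : ℝ) / (d - 1))
    (hpδ : 2 / (2 - Real.sqrt δ) < p) (hp : 2 ≤ p)
    (hgδ : IntegrableOn gδ (Ioc 0 T)) (hgν : IntegrableOn gν (Ioc 0 T))
    (hgδ0 : ∀ t, 0 ≤ t → 0 ≤ gδ t) (hgν0 : ∀ t, 0 ≤ t → 0 ≤ gν t) :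
    ∃ ζ₀ : ℝ, 0 < ζ₀ ∧
      ∀ (b h : ℝ → EuclideanSpace ℝ (Fin d) → EuclideanSpace ℝ (Fin d))
        (f U : ℝ × EuclideanSpace ℝ (Fin d) → ℝ)
        (DU : ℝ × EuclideanSpace ℝ (Fin d) → EuclideanSpace ℝ (Fin d)),
        IsFormBounded δ gδ b → Continuous (Function.uncurry b) →
        IsFormBounded ν gν h → Continuous (Function.uncurry h) → Continuous f →
        IsExtendedSolution (fun z => ‖h z.1 z.2‖ * f z - inner ℝ (b z.1 z.2) (DU z)) U DU →
        ∫ z in spaceTimeCylinder d T 1,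
          (truncWeight p (h z.1 z.2) * |f z| ^ p) ^ (θ / (θ - 1)) ≤ 1 →
        truncMass U T (p * θ) 0 1 ≤ ζ₀ →
        ∀ t ∈ Icc (0 : ℝ) T, ∀ x ∈ ball (0 : EuclideanSpace ℝ (Fin d)) (1 / 2), U (t, x) ≤ 1 := by
  obtain ⟨C₁, hC₁, hgain⟩ := exists_gain_const d (by omega) hδ0 hδ4 hν hpδ hp hT.le hgδ hgν hgδ0
    hgν0
  obtain ⟨C₀, hC₀, hcut⟩ := exists_cutoff d
  set κ : ℝ := (d : ℝ) / (d - 1)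
  have hp0 : 0 < p := by linarith
  have hθ0 : 0 < θ := by linarith
  have hα : 0 < 1 - θ / κ := by
    rw [sub_pos, div_lt_one (by linarith)]; exact hθd
  have hs : 0 < p * θ := by positivity
  set A : ℝ := 2 ^ (p * θ)
  have hA1 : 1 < A := Real.one_lt_rpow (by norm_num) hs
  have hB : 1 < (4 * A) ^ θ * A ^ (1 - θ / κ) :=
    one_lt_mul_of_lt_of_le (Real.one_lt_rpow (by linarith) hθ0)
      (Real.one_le_rpow hA1.le hα.le)
  obtain ⟨ζ₀, hζ₀, -, hthr⟩ := exists_fast_convergence_threshold hα hB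
    (C := (1 + C₁) * ((16 * C₀ ^ 2 + 2) * A) ^ θ * A ^ (1 - θ / κ)) (by positivity)
  refine ⟨ζ₀, hζ₀, fun b h f U DU hb hbc hh hhc hf hsol hF hmass t ht x hx => ?_⟩
  have hU := hsol.continuous
  have hFm : Measurable fun z : ℝ × EuclideanSpace ℝ (Fin d) =>
      (truncWeight p (h z.1 z.2) * |f z| ^ p) ^ (θ / (θ - 1)) :=
    ((((measurable_truncWeight p).comp hhc.measurable).mul
      (hf.measurable.abs.pow_const p)).pow_const _)
  have hFint : IntegrableOn (fun z : ℝ × EuclideanSpace ℝ (Fin d) =>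
      (truncWeight p (h z.1 z.2) * |f z| ^ p) ^ (θ / (θ - 1))) (spaceTimeCylinder d T 1) := by
    obtain ⟨M, hM⟩ := (isCompact_closedCylinder (d := d) T 1).exists_bound_of_continuousOn
      hf.continuousOn
    refine integrableOn_spaceTimeCylinder hFm (C := (1 * M ^ p) ^ (θ / (θ - 1))) fun z hz => ?_
    have h1 := truncWeight_nonneg p (h z.1 z.2)
    have h2 := truncWeight_le_one hp0.le (h z.1 z.2)
    have h3 : |f z| ≤ M := hM z hz
    rw [abs_of_nonneg (by positivity)]
    gcongr
  obtain ⟨γ, hγ0, hγ1, hdecay⟩ := hthr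
    (fun n => truncMass U T (p * θ) (1 - (1 / 2) ^ n) (1 / 2 + (1 / 2) ^ (n + 1)))
    (by norm_num; exact hmass) fun n ζ hζ0 hζ1 hζ => by
      have hn1 : (1 / 2 : ℝ) ^ n ≤ 1 := pow_le_one₀ (by norm_num) (by norm_num)
      have e1 : (1 / 2 : ℝ) ^ (n + 1) = 1 / 2 * (1 / 2) ^ n := pow_succ' _ _
      have e2 : (1 / 2 : ℝ) ^ (n + 2) = 1 / 4 * (1 / 2) ^ n := by rw [pow_add]; ring
      have er : (1 / 2 : ℝ) + (1 / 2) ^ (n + 2) + (1 / 2) ^ (n + 2) =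
          1 / 2 + (1 / 2) ^ (n + 1) := by
        rw [e1, e2]; ring
      have ek : 1 - (1 / 2 : ℝ) ^ n + (1 / 2) ^ (n + 1) = 1 - (1 / 2) ^ (n + 1) := by rw [e1]; ring
      have hρ : (0 : ℝ) < (1 / 2) ^ (n + 2) := by positivity
      have hr1 : (1 / 2 : ℝ) + (1 / 2) ^ (n + 2) + (1 / 2) ^ (n + 2) ≤ 1 := by rw [er, e1]; linarith
      obtain ⟨η, hη, hη0, hη1, hηr, hηR, hDη⟩ := hcut (1 / 2 + (1 / 2) ^ (n + 2))
        ((1 / 2) ^ (n + 2)) (by linarith) hρ hr1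
      have hF' : ∫ z in spaceTimeCylinder d T
          (1 / 2 + (1 / 2) ^ (n + 2) + (1 / 2) ^ (n + 2)),
          (truncWeight p (h z.1 z.2) * |f z| ^ p) ^ (θ / (θ - 1)) ≤ 1 := by
        refine (setIntegral_mono_set hFint (Eventually.of_forall fun z => ?_) ?_).trans hF
        · have := truncWeight_nonneg p (h z.1 z.2)
          simp only [Pi.zero_apply]
          positivity
        · exact (prod_mono subset_rfl (ball_subset_ball hr1)).eventuallyLE
      have hstep := truncMass_step (k := 1 - (1 / 2) ^ n) (j := (1 / 2) ^ (n + 1)) (C₁ := C₁)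
        (κ := κ) hU hf hhc hp hθ hθd (by positivity) (by rw [e1]; linarith) hρ hη hη0 hη1 hηr hηR
        hDη (fun R hR hle => hgain b h f U DU η _ _ R hb hbc hh hhc hf hsol hη
          (fun x hx => hηR x hx.le) (by rw [ek, e1]; linarith) hR hle) hF' hζ0 hζ1
        (by rw [er]; exact hζ)
      rw [ek] at hstep
      exact hstep.trans (dyadic_step_const_le hC₁ hθ0 hζ0 n)
  refine le_of_truncMass_nonpos hU hs.le hT ?_ ht hx (k := 1)
  have hlim : Tendsto (fun n : ℕ => ζ₀ * γ ^ n) atTop (𝓝 (ζ₀ * 0)) :=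
    (tendsto_pow_atTop_nhds_zero_of_lt_one hγ0 hγ1).const_mul _
  rw [mul_zero] at hlim
  refine ge_of_tendsto hlim (Eventually.of_forall fun n => (truncMass_anti hU hs.le ?_ ?_).trans
    (hdecay n))
  · simp
  · simp

end Boundedness

/-! ### Extension to negative times and scaling -/

section Extension

open Filter Topology

variable {d : ℕ}

lemma setIntegral_Ioi_eq_integral {F : ℝ × EuclideanSpace ℝ (Fin d) → ℝ} (hF : Continuous F)
    (hc : HasCompactSupport F) (h0 : ∀ z, z.1 ≤ 0 → F z = 0) :
    ∫ t in Ioi (0 : ℝ), ∫ x, F (t, x) = ∫ z, F z := by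
  rw [setIntegral_eq_integral_of_forall_compl_eq_zero fun t ht => ?_, Measure.volume_eq_prod,
    integral_prod _ (by
      rw [← Measure.volume_eq_prod]; exact hF.integrable_of_hasCompactSupport hc)]
  have ht0 : t ≤ 0 := not_lt.1 ht
  simp [h0 (t, _) ht0]

/-- The extension of a solution of the Cauchy problem by zero to negative times. Since the weak
formulation only tests at positive times, the drift term can be moved to the source. -/
lemma IsCauchySolution.isExtendedSolution
    {b : ℝ → EuclideanSpace ℝ (Fin d) → EuclideanSpace ℝ (Fin d)}
    {F u : ℝ → EuclideanSpace ℝ (Fin d) → ℝ} (hu : IsCauchySolution b F u)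
    (hb : Continuous (Function.uncurry b)) (hF : Continuous (Function.uncurry F)) :
    IsExtendedSolution
      (fun z => F z.1 z.2 - inner ℝ (b z.1 z.2) (gradient (u (max z.1 0)) z.2))
      (fun z => u (max z.1 0) z.2) (fun z => gradient (u (max z.1 0)) z.2) := by
  have hret : Continuous fun z : ℝ × EuclideanSpace ℝ (Fin d) => (max z.1 0, z.2) :=
    (continuous_fst.max continuous_const).prodMk continuous_snd
  have hmem : ∀ z : ℝ × EuclideanSpace ℝ (Fin d),
      (max z.1 0, z.2) ∈ Ici (0 : ℝ) ×ˢ (univ : Set (EuclideanSpace ℝ (Fin d))) :=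
    fun z => ⟨mem_Ici.2 (le_max_right _ _), mem_univ _⟩
  have hU : Continuous fun z : ℝ × EuclideanSpace ℝ (Fin d) => u (max z.1 0) z.2 :=
    hu.continuousOn.comp_continuous hret hmem
  have hDU : Continuous fun z : ℝ × EuclideanSpace ℝ (Fin d) => gradient (u (max z.1 0)) z.2 :=
    hu.continuousOn_gradient.comp_continuous hret hmem
  have hbD : Continuous fun z : ℝ × EuclideanSpace ℝ (Fin d) =>
      inner ℝ (b z.1 z.2) (gradient (u (max z.1 0)) z.2) := hb.inner hDU
  refine ⟨hF.sub hbD, hU, hDU, fun t x => (hu.differentiable _ (le_max_right _ _) x).hasGradientAt,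
    fun z hz => by simp [max_eq_right hz, hu.initial], fun φ hφ hφc hφs => ?_⟩
  have hnot : ∀ z : ℝ × EuclideanSpace ℝ (Fin d), z.1 ≤ 0 → z ∉ tsupport φ := fun z hz hmem =>
    absurd (hφs hmem).1 (not_lt.2 hz)
  have hweak := hu.weak (fun t x => φ (t, x)) ⟨hφ, hφc, hφs⟩
  have hφd : Differentiable ℝ φ := hφ.differentiable (by simp)
  have hφ' : Continuous fun z => fderiv ℝ φ z := hφ.continuous_fderiv (by simp)
  have hzero : ∀ z ∉ tsupport φ, φ z = 0 := fun z hz => image_eq_zero_of_notMem_tsupport hz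
  have hzero' : ∀ z ∉ tsupport φ, fderiv ℝ φ z = 0 := fun z hz =>
    fderiv_of_notMem_tsupport (𝕜 := ℝ) hz
  set A : ℝ × EuclideanSpace ℝ (Fin d) → ℝ := fun z =>
    -(u (max z.1 0) z.2 * fderiv ℝ φ z (1, 0)) +
      fderiv ℝ φ z (0, gradient (u (max z.1 0)) z.2) with hA
  set B : ℝ × EuclideanSpace ℝ (Fin d) → ℝ := fun z =>
    inner ℝ (b z.1 z.2) (gradient (u (max z.1 0)) z.2) * φ z with hB
  set D : ℝ × EuclideanSpace ℝ (Fin d) → ℝ := fun z => F z.1 z.2 * φ z with hD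
  have hAc : Continuous A := (hU.mul (hφ'.clm_apply continuous_const)).neg.add
    (hφ'.clm_apply (continuous_const.prodMk hDU))
  have hBc : Continuous B := hbD.mul hφ.continuous
  have hDc : Continuous D := hF.mul hφ.continuous
  have hA0 : ∀ z ∉ tsupport φ, A z = 0 := fun z hz => by simp [hA, hzero' z hz]
  have hB0 : ∀ z ∉ tsupport φ, B z = 0 := fun z hz => by simp [hB, hzero z hz]
  have hD0 : ∀ z ∉ tsupport φ, D z = 0 := fun z hz => by simp [hD, hzero z hz]
  have hAs : HasCompactSupport A := HasCompactSupport.intro hφc hA0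
  have hBs : HasCompactSupport B := HasCompactSupport.intro hφc hB0
  have hDs : HasCompactSupport D := HasCompactSupport.intro hφc hD0
  have hleft : ∫ t in Ioi (0 : ℝ), ∫ x,
      (-(u t x * deriv (fun s => φ (s, x)) t) +
        inner ℝ (gradient (u t) x) (gradient (fun y => φ (t, y)) x) +
        inner ℝ (b t x) (gradient (u t) x) * φ (t, x)) = ∫ z, (A z + B z) := by
    rw [← setIntegral_Ioi_eq_integral (F := fun z => A z + B z) (hAc.add hBc)
      (hAs.add hBs) fun z hz => by
      simp [hA0 z (hnot z hz), hB0 z (hnot z hz)]]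
    refine setIntegral_congr_fun measurableSet_Ioi fun t ht => ?_
    have ht0 : max t 0 = t := max_eq_left (le_of_lt ht)
    refine integral_congr_ae (Eventually.of_forall fun x => ?_)
    have h1 : deriv (fun s => φ (s, x)) t = fderiv ℝ φ (t, x) (1, 0) := by
      have h2 : HasDerivAt (fun s : ℝ => (s, x)) ((1 : ℝ), (0 : EuclideanSpace ℝ (Fin d))) t :=
        (hasDerivAt_id t).prodMk (hasDerivAt_const t x)
      exact ((hφd (t, x)).hasFDerivAt.comp_hasDerivAt t h2).deriv
    have h3 : inner ℝ (gradient (u t) x) (gradient (fun y => φ (t, y)) x) =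
        fderiv ℝ φ (t, x) (0, gradient (u t) x) := by
      rw [real_inner_comm, inner_gradient, fderiv_slice hφd]
    simp only [hA, hB, ht0, h1, h3]
  have hright : ∫ t in Ioi (0 : ℝ), ∫ x, F t x * φ (t, x) = ∫ z, D z :=
    setIntegral_Ioi_eq_integral hDc hDs fun z hz => hD0 z (hnot z hz)
  have hmain : ∫ z, (A z + B z) = ∫ z, D z := by rw [← hleft, ← hright]; exact hweak
  rw [integral_add (hAc.integrable_of_hasCompactSupport hAs)
    (hBc.integrable_of_hasCompactSupport hBs)] at hmain
  have hsub : ∫ z, (D z - B z) = (∫ z, D z) - ∫ z, B z :=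
    integral_sub (hDc.integrable_of_hasCompactSupport hDs)
      (hBc.integrable_of_hasCompactSupport hBs)
  calc ∫ z, A z = ∫ z, (D z - B z) := by rw [hsub]; linarith
    _ = _ := by
      refine integral_congr_ae (Eventually.of_forall fun z => ?_)
      simp only [hB, hD]; ring

/-- The notion of solution is invariant under scaling. -/
lemma IsExtendedSolution.const_mul {G U : ℝ × EuclideanSpace ℝ (Fin d) → ℝ}
    {DU : ℝ × EuclideanSpace ℝ (Fin d) → EuclideanSpace ℝ (Fin d)}
    (h : IsExtendedSolution G U DU) (c : ℝ) :
    IsExtendedSolution (fun z => c * G z) (fun z => c * U z) (fun z => c • DU z) := by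
  refine ⟨continuous_const.mul h.continuous_source, continuous_const.mul h.continuous,
    h.continuous_grad.const_smul c, fun t x => ?_, fun z hz => by simp [h.eq_zero z hz],
    fun φ hφ hφc hφs => ?_⟩
  · rw [hasGradientAt_iff_hasFDerivAt, map_smul]
    exact (h.hasGradientAt t x).hasFDerivAt.const_mul c
  · have h1 := congrArg (c * ·) (h.weak φ hφ hφc hφs)
    simp only [← integral_const_mul] at h1
    refine Eq.trans ?_ (h1.trans ?_)
    · refine integral_congr_ae (Eventually.of_forall fun z => ?_)
      have h2 : ((0 : ℝ), c • DU z) = c • ((0 : ℝ), DU z) := by simp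
      simp only [h2, map_smul, smul_eq_mul]; ring
    · refine integral_congr_ae (Eventually.of_forall fun z => ?_)
      simp only; ring

lemma mul_abs_inv_mul_rpow {w M : ℝ} (hw : 0 ≤ w) (hM : 0 < M) (p q y : ℝ) :
    (w * |M⁻¹ * y| ^ p) ^ q = (M ^ (p * q))⁻¹ * (w ^ q * |y| ^ (p * q)) := by
  have hM' : 0 < M⁻¹ := inv_pos.2 hM
  rw [abs_mul, abs_of_pos hM', Real.mul_rpow hw (by positivity),
    ← Real.rpow_mul (x := M⁻¹ * |y|) (by positivity), Real.mul_rpow hM'.le (abs_nonneg _),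
    Real.inv_rpow hM.le]
  ring

lemma truncMass_zero_inv_mul (U : ℝ × EuclideanSpace ℝ (Fin d) → ℝ) (T r : ℝ) {s M : ℝ}
    (hs : 0 < s) (hM : 0 < M) :
    truncMass (fun z => M⁻¹ * U z) T s 0 r = (M ^ s)⁻¹ * truncMass U T s 0 r := by
  have h1 : ∀ y : ℝ, truncPow 0 s (M⁻¹ * y) = (M ^ s)⁻¹ * truncPow 0 s y := fun y => by
    have h2 : max (M⁻¹ * y) 0 = M⁻¹ * max y 0 := by
      rw [mul_max_of_nonneg _ _ (inv_pos.2 hM).le, mul_zero]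
    rw [truncPow_eq_max hs, truncPow_eq_max hs, sub_zero, sub_zero, h2,
      Real.mul_rpow (inv_pos.2 hM).le (le_max_right _ _), Real.inv_rpow hM.le]
  simp only [truncMass, h1, integral_const_mul]

lemma intervalIntegral_eq_setIntegral_spaceTimeCylinder {T r : ℝ} (hT : 0 ≤ T)
    {F : ℝ × EuclideanSpace ℝ (Fin d) → ℝ} (hF : IntegrableOn F (spaceTimeCylinder d T r)) :
    ∫ s in (0 : ℝ)..T, ∫ y in ball (0 : EuclideanSpace ℝ (Fin d)) r, F (s, y) =
      ∫ z in spaceTimeCylinder d T r, F z := by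
  rw [intervalIntegral.integral_of_le hT]
  exact (setIntegral_prod F hF).symm

end Extension

/-! ### The local maximum estimate -/

theorem proposition2 (d : ℕ) (hd : 3 ≤ d) (δ ν : ℝ) (hδ0 : 0 < δ) (hδ4 : δ < 4) (hν : 0 < ν)
    (gδ gν : ℝ → ℝ) (T : ℝ) (hT : 0 < T)
    (θ : ℝ) (hθ1 : 1 < θ) (hθd : θ < (d : ℝ) / ((d : ℝ) - 1))
    (p : ℝ) (hpδ : 2 / (2 - Real.sqrt δ) < p) (hp2 : 2 ≤ p) :
    ∃ K : ℝ, 0 < K ∧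
      ∀ (b h : ℝ → EuclideanSpace ℝ (Fin d) → EuclideanSpace ℝ (Fin d))
        (f u : ℝ → EuclideanSpace ℝ (Fin d) → ℝ),
        IsFormBounded δ gδ b → IsTestFunction b →
        IsFormBounded ν gν h → IsTestFunction h →
        Continuous (Function.uncurry f) → HasCompactSupport (Function.uncurry f) →
        IsCauchySolution b (fun t x => ‖h t x‖ * f t x) u →
        ∀ t ∈ Icc (0 : ℝ) T, ∀ x ∈ ball (0 : EuclideanSpace ℝ (Fin d)) (1 / 2),
          max (u t x) 0 ≤
            2 * (∫ s in (0 : ℝ)..T, ∫ y in ball (0 : EuclideanSpace ℝ (Fin d)) 1,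
                truncWeight p (h s y) ^ (θ / (θ - 1)) * |f s y| ^ (p * (θ / (θ - 1)))) ^
                  (1 / (p * (θ / (θ - 1))))
            + K * ((∫ s in (0 : ℝ)..T, ∫ y in ball (0 : EuclideanSpace ℝ (Fin d)) 1,
                  max (u s y) 0 ^ p)
                + (∫ s in (0 : ℝ)..T, ∫ y in ball (0 : EuclideanSpace ℝ (Fin d)) 1,
                  max (u s y) 0 ^ (p * θ)) ^ (1 / θ)) ^ (1 / p) := by
  -- The class of admissible `b`, `h` is empty unless `gδ`, `gν` are nonnegative and locally
  -- integrable on `[0, ∞)`.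
  by_cases hg : ((∀ t, 0 ≤ t → 0 ≤ gδ t) ∧ LocallyIntegrableOn gδ (Ici (0 : ℝ))) ∧
      ((∀ t, 0 ≤ t → 0 ≤ gν t) ∧ LocallyIntegrableOn gν (Ici (0 : ℝ)))
  swap
  · exact ⟨1, one_pos, fun b h f u hb _ hh _ _ _ _ => absurd
      ⟨⟨hb.g_nonneg, hb.g_locallyIntegrable⟩, hh.g_nonneg, hh.g_locallyIntegrable⟩ hg⟩
  obtain ⟨⟨hgδ0, hgδ⟩, hgν0, hgν⟩ := hg
  have hint : ∀ {g : ℝ → ℝ}, LocallyIntegrableOn g (Ici (0 : ℝ)) → IntegrableOn g (Ioc 0 T) :=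
    fun hg => (hg.integrableOn_compact_subset (t := Icc 0 T) Icc_subset_Ici_self
      isCompact_Icc).mono_set Ioc_subset_Icc_self
  obtain ⟨ζ₀, hζ₀, hbound⟩ := exists_boundedness_threshold d hd hδ0 hδ4 hν hT hθ1 hθd hpδ hp2
    (hint hgδ) (hint hgν) hgδ0 hgν0
  have hp0 : 0 < p := by linarith
  have hθ0 : 0 < θ := by linarith
  have hs : 0 < p * θ := by positivity
  set q := θ / (θ - 1)
  set K := ζ₀ ^ (-(1 / (p * θ))) with hK
  have hK0 : 0 < K := by positivity
  refine ⟨K, hK0, fun b h f u hb hbt hh hht hf _ hu t ht x hx => ?_⟩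
  have hbc := hbt.smooth.continuous
  have hhc := hht.smooth.continuous
  have hsol := hu.isExtendedSolution hbc (F := fun t x => ‖h t x‖ * f t x) (hhc.norm.mul hf)
  set U : ℝ × EuclideanSpace ℝ (Fin d) → ℝ := fun z => u (max z.1 0) z.2 with hU
  set DU : ℝ × EuclideanSpace ℝ (Fin d) → EuclideanSpace ℝ (Fin d) :=
    fun z => gradient (u (max z.1 0)) z.2
  set W : ℝ × EuclideanSpace ℝ (Fin d) → ℝ := fun z =>
    truncWeight p (h z.1 z.2) ^ q * |f z.1 z.2| ^ (p * q) with hW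
  have hW0 : ∀ z, 0 ≤ W z := fun z => by
    have := truncWeight_nonneg p (h z.1 z.2)
    simp only [hW]; positivity
  have hWint : IntegrableOn W (spaceTimeCylinder d T 1) := by
    obtain ⟨M, hM⟩ := (isCompact_closedCylinder (d := d) T 1).exists_bound_of_continuousOn
      hf.continuousOn
    refine integrableOn_spaceTimeCylinder (F := W)
      ((((measurable_truncWeight p).comp hhc.measurable).pow_const q).mul
        (hf.measurable.abs.pow_const (p * q))) (C := 1 ^ q * M ^ (p * q)) fun z hz => ?_
    have h1 := truncWeight_nonneg p (h z.1 z.2)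
    have h2 := truncWeight_le_one hp0.le (h z.1 z.2)
    have h3 : |f z.1 z.2| ≤ M := hM z hz
    rw [abs_of_nonneg (hW0 z)]
    simp only [hW]
    gcongr
  have hUT : ∀ {s : ℝ}, 0 < s → ∫ r in (0 : ℝ)..T, ∫ y in ball (0 : EuclideanSpace ℝ (Fin d)) 1,
      max (u r y) 0 ^ s = truncMass U T s 0 1 := fun {s} hs => by
    rw [truncMass, ← intervalIntegral_eq_setIntegral_spaceTimeCylinder hT.le
      (integrableOn_truncPow hsol.continuous 0 1 hs.le)]
    refine intervalIntegral.integral_congr_ae (Filter.Eventually.of_forall fun r hr => ?_)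
    rw [uIoc_of_le hT.le] at hr
    simp only [truncPow_eq_max hs, hU, max_eq_left hr.1.le, sub_zero]
  rw [hUT hp0, hUT hs, intervalIntegral_eq_setIntegral_spaceTimeCylinder hT.le hWint]
  set S := ∫ z in spaceTimeCylinder d T 1, W z
  set I := truncMass U T (p * θ) 0 1
  have hS0 : 0 ≤ S := integral_nonneg hW0
  have hI0 : 0 ≤ I := truncMass_nonneg _ _ _ _ _
  have hJ0 : 0 ≤ truncMass U T p 0 1 := truncMass_nonneg _ _ _ _ _
  have hIJ : I ^ (1 / (p * θ)) ≤ (truncMass U T p 0 1 + I ^ (1 / θ)) ^ (1 / p) := by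
    calc I ^ (1 / (p * θ)) = (I ^ (1 / θ)) ^ (1 / p) := by
          rw [← Real.rpow_mul hI0]; congr 1; field_simp
      _ ≤ _ := Real.rpow_le_rpow (by positivity) (by linarith) (by positivity)
  have hut : u t x = U (t, x) := by simp only [hU, max_eq_left ht.1]
  suffices hmain : U (t, x) ≤ S ^ (1 / (p * q)) + K * I ^ (1 / (p * θ)) by
    have hSq : 0 ≤ S ^ (1 / (p * q)) := by positivity
    have hKI := mul_le_mul_of_nonneg_left hIJ hK0.le
    have hKI0 : 0 ≤ K * I ^ (1 / (p * θ)) := by positivity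
    rw [hut]
    exact max_le (by linarith) (by linarith)
  -- The summand `ε` makes `M` positive; the two inequalities `hSM` and `hIM` say that `f / M` and
  -- `U / M` satisfy the normalization and the smallness condition.
  refine le_of_forall_pos_le_add fun ε hε => ?_
  set M := S ^ (1 / (p * q)) + K * I ^ (1 / (p * θ)) + ε with hM
  have hSq : 0 ≤ S ^ (1 / (p * q)) := by positivity
  have hKI0 : 0 ≤ K * I ^ (1 / (p * θ)) := by positivity
  have hM0 : 0 < M := by positivity
  have hpq : 0 < p * q := by positivity
  have hSM : S ≤ M ^ (p * q) := by
    calc S = (S ^ (1 / (p * q))) ^ (p * q) := by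
          rw [← Real.rpow_mul hS0, one_div, inv_mul_cancel₀ hpq.ne', Real.rpow_one]
      _ ≤ _ := Real.rpow_le_rpow hSq (by linarith) hpq.le
  have hIM : I ≤ ζ₀ * M ^ (p * θ) := by
    have h1 : (K * I ^ (1 / (p * θ))) ^ (p * θ) = ζ₀⁻¹ * I := by
      rw [Real.mul_rpow hK0.le (by positivity), hK, ← Real.rpow_mul hζ₀.le, ← Real.rpow_mul hI0,
        one_div, inv_mul_cancel₀ hs.ne', Real.rpow_one, neg_mul, inv_mul_cancel₀ hs.ne',
        Real.rpow_neg_one]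
    have h2 : (K * I ^ (1 / (p * θ))) ^ (p * θ) ≤ M ^ (p * θ) :=
      Real.rpow_le_rpow hKI0 (by linarith) hs.le
    rw [h1, inv_mul_le_iff₀ hζ₀] at h2
    exact h2
  have hfin := hbound b h (fun z => M⁻¹ * f z.1 z.2) (fun z => M⁻¹ * U z) (fun z => M⁻¹ • DU z)
    hb hbc hh hhc (continuous_const.mul hf)
    (by
      convert hsol.const_mul M⁻¹ using 2 with z
      rw [inner_smul_right]; ring)
    (by
      have h1 : ∀ z : ℝ × EuclideanSpace ℝ (Fin d),
          (truncWeight p (h z.1 z.2) * |M⁻¹ * f z.1 z.2| ^ p) ^ q = (M ^ (p * q))⁻¹ * W z :=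
        fun z => mul_abs_inv_mul_rpow (truncWeight_nonneg p _) hM0 p q (f z.1 z.2)
      simp only [h1, integral_const_mul]
      rw [inv_mul_le_iff₀ (by positivity), mul_one]
      exact hSM)
    (by
      rw [truncMass_zero_inv_mul U T 1 hs hM0, inv_mul_le_iff₀ (by positivity), mul_comm _ ζ₀]
      exact hIM)
    t ht x hx
  rwa [inv_mul_le_iff₀ hM0, mul_one] at hfin
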